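/- **Setting.** Let $T\ge 1$, $\mathbb T=\{0,\dots,T\}$, $\mathbb T_t=\{t,\dots,T\}$, and let $(\Omega,\mathcal F,(\mathcal F_t)_{t\in\mathbb T},\mathbb P)$ be a filtered probability space with $\mathcal F_0$ complete and trivial and $\mathcal F_T=\mathcal F$. Let $1\le m\le d$, $M=\mathbb R^m\times\{0\}^{d-m}$, $M_t=L^\infty_t(M)$, and let $M_{t,+}$ be its non-negative elements. For a set $C$ of bounded $\mathcal F_s$-measurable vectors, $C^*=\{u\in L^1_s(\mathbb R^d):\mathbb E[u^\top c]\ge 0\ \forall c\in C\}$; $M_t^\perp=\{u\in L^1_t(\mathbb R^d):\mathbb E[u^\top c]=0\ \forall c\in M_t\}$; $\Gamma_t(w)=\{u\in L^\infty_t(\mathbb R^d): w^\top u\ge 0\}$; $\mathcal G(M_t;M_{t,+})$ is the family of $D\subseteq M_t$ with $D=\operatorname{cl}\operatorname{co}(D+M_{t,+})$, the closure being weak*. $\mathcal R^{\infty,d}_t$ is the space of bounded adapted $\mathbb R^d$-valued processes vanishing before $t$, with the topology $\sigma(\mathcal R^{\infty,d}_t,\mathcal A^{1,d}_t)$, where $\mathcal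 A^{1,d}_t$ consists of the adapted processes $a$ of integrable variation vanishing before $t$ and the pairing is $\mathbb E[\sum_s \Delta a_s^\top X_s]$. Let $\mu=(\mu_t)$ be adapted with $\sum_t\mu_t=1$ and $\mathbb P[\min_t\mu_t>\epsilon]=1$ for some $\epsilon>0$. The optional space is $\bar\Omega=\Omega\times\mathbb T$ with $\bar{\mathcal F}=\sigma(A\times\{t\}:A\in\mathcal F_t,\,t\in\mathbb T)$, $\bar{\mathcal F}_t=\sigma(D_r\times\{r\},D_t\times\mathbb T_t: D_r\in\mathcal F_r,\ r<t,\ D_t\in\mathcal F_t)$ and $\bar{\mathbb P}=\mathbb P\otimes\mu$, i.e. $\bar{\mathbb E}[X]=\mathbb E[\sum_t\mu_tX_t]$. Barred objects are formed on this space. For $\mathbb Q\ll\mathbb P$, $\xi_{t,s}(\mathbb Q)=\mathbb E_s[\frac{d\mathbb Q}{d\mathbb P}]/\mathbb E_t[\frac{d\mathbb Q}{d\mathbb P}]$ where the denominator is positive and $1$ elsewhere; $\mathbb E^{\mathbb Q}_t[X]=\mathbb E_t[\xi_{t,T}(\mathbb Q)X]$; $w_t^s(\mathbb Q,w)=\operatorname{diag}(w)\,\xi_{t,s}(\mathbb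 Q)$ (componentwise for vectors of measures), and likewise $\bar\xi,\bar{\mathbb E}^{\bar{\mathbb Q}}_t,\bar w_t^s$. $\mathcal M(\mathbb P)$ is the set of probability measures $\mathbb Q\ll\mathbb P$, and $\mathcal M_t(\mathbb P)$ the set of those with $\mathbb Q=\mathbb P$ on $\mathcal F_t$. **Risk measures.** A closed conditionally coherent risk measure for processes $\rho_t:\mathcal R^{\infty,d}_t\to\mathcal G(M_t;M_{t,+})$ is a map that is cash invariant ($\rho_t(X+u1_{\mathbb T_t})=\rho_t(X)-u$ for $u\in M_t$), monotone ($X\le Y\Rightarrow\rho_t(X)\subseteq\rho_t(Y)$), finite at zero ($\rho_t(0)$ is nonempty, closed, $\mathcal F_t$-decomposable, and equals $L^\infty_t(K)$ for an $\mathcal F_t$-measurable random closed set $K\subseteq M$ with $\mathbb P[K=M]=0$), conditionally convex ($\lambda\rho_t(X)+(1-\lambda)\rho_t(Y)\subseteq\rho_t(\lambda X+(1-\lambda)Y)$ for $\lambda\in L^\infty_t([0,1])$), conditionally positively homogeneous ($\rho_t(\lambda X)=\lambda\rho_t(X)$ for $\lambda\in L^\infty_t(\mathbb R_{++})$), and has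 closed graph in $\mathcal R_t^{\infty,d}\times M_t$. Risk measures for vectors $R_s:L^\infty_s(\mathbb R^d)\to\mathcal G(M_s;M_{s,+})$ and $\bar R_t:\bar L^\infty(\mathbb R^d)\to\mathcal G(\bar M_t;\bar M_{t,+})$ are defined in the same way, with weak* topologies. Acceptance sets are $A_t=\{X:0\in\rho_t(X)\}$, $A_{R_s}=\{Z:0\in R_s(Z)\}$, $\bar A_t=\{X:0\in\bar R_t(X)\}$. **Dual variables.** $$\mathcal W_t=\{(\mathbb Q_s,w_s)_{s\in\mathbb T_t}:\mathbb Q_s\in\mathcal M_t(\mathbb P)^d,\ w_s\in M_{t,+}^*,\ w_t^s(\mathbb Q_s,w_s)\in L^1_s(\mathbb R^d_+)\ \forall s\in\mathbb T_t\},$$ $$\mathcal W_t^{\max}=\Big\{(\mathbb Q,w)\in\mathcal W_t:\sum_{s\in\mathbb T_t}w_s^\top\mathbb E^{\mathbb Q_s}_t[Z_s]\ge 0\ \text{a.s.}\ \forall Z\in A_t\Big\},$$ $$\mathcal W_{R_s}^{\max}=\{w\in M_{s,+}^*\cap L^1_s(\mathbb R^d_+): w\in A_{R_s}^*\},$$ $$\bar{\mathcal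 W}_t=\{(\bar{\mathbb Q},\bar w):\bar{\mathbb Q}\in\bar{\mathcal M}_t(\bar{\mathbb P})^d,\ \bar w\in\bar M_{t,+}^*,\ \bar w_t^T(\bar{\mathbb Q},\bar w)\in\bar L^1(\mathbb R^d_+)\},$$ $$\bar{\mathcal W}_t^{\max}=\{(\bar{\mathbb Q},\bar w)\in\bar{\mathcal W}_t:\bar w_t^T(\bar{\mathbb Q},\bar w)\in\bar A_t^*\}.$$ A risk measure "has dual representation with respect to" a set $\mathcal V$ of dual variables if, for every $X$ in its domain, respectively $$\bar R_t(X)=\bar M_t\cap\bigcap_{(\bar{\mathbb Q},\bar w)\in\mathcal V}\big(\bar{\mathbb E}^{\bar{\mathbb Q}}_t[-X]+\bar\Gamma_t(\bar w)\big),\qquad R_s(X)=M_s\cap\bigcap_{w\in\mathcal V}\big(-X+\Gamma_s(w)\big),$$ $$\rho_t(X)=\Big\{u\in M_t:\ \sum_{s\in\mathbb T_t}w_s^\top u\ \ge\ \sum_{s\in\mathbb T_t}w_s^\top\mathbb E^{\mathbb Q_s}_t[-X_s]\ \text{a.s. for all }(\mathbb Q,w)\in\mathcal V\Big\}.$$ **The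 maps.** A decomposition $\bar{\mathbb Q}_i=\mathbb Q_i\otimes\psi_i$ consists of $\mathbb Q_i\in\mathcal M(\mathbb P)$ and an adapted $\psi_i\ge0$ with $\sum_t\psi_{t,i}=1$ such that $\bar{\mathbb E}^{\bar{\mathbb Q}_i}[X]=\mathbb E^{\mathbb Q_i}[\sum_t\psi_{t,i}X_t]$ for all $X\in\bar L^\infty(\mathbb R)$. Given decompositions for $i=1,\dots,d$, put $W_t(\bar{\mathbb Q},\bar w)=(\hat{\mathbb Q},w)$ with, for $s\in\mathbb T_t$, $$\frac{d\hat{\mathbb Q}_{s,i}}{d\mathbb P}=\frac{\psi_{s,i}}{\mathbb E^{\mathbb Q_i}_t[\psi_{s,i}]}\,\xi_{t,s}(\mathbb Q_i)\,1_{\{\mathbb E^{\mathbb Q_i}_t[\psi_{s,i}]>0\}}+\frac{\mu_s}{\mathbb E_t[\mu_s]}\,1_{\{\mathbb E^{\mathbb Q_i}_t[\psi_{s,i}]=0\}},\qquad w_{s,i}=\frac{\mathbb E^{\mathbb Q_i}_t[\psi_{s,i}]}{1-\sum_{r<t}\mu_r}\,\bar w_{t,i}.$$ Conversely $\bar W_t(\mathbb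 Q,w)=(\bar{\mathbb Q},\bar w)$ with $\bar w=\sum_{s\in\mathbb T_t}\operatorname{diag}(1_{\{w_s>0\}})w_s\,1_{\mathbb T_t}$ and $$\Big(\frac{d\bar{\mathbb Q}_i}{d\bar{\mathbb P}}\Big)_s=1\ \ (s<t),\qquad \Big(\frac{d\bar{\mathbb Q}_i}{d\bar{\mathbb P}}\Big)_s=\frac{1-\sum_{r<t}\mu_r}{\mu_s}\Big(\frac{w_{s,i}}{\bar w_{t,i}}1_{\{\bar w_{t,i}>0\}}+\frac{1}{T-t+1}1_{\{\bar w_{t,i}=0\}}\Big)\xi_{t,s}(\mathbb Q_{s,i})\ \ (s\in\mathbb T_t).$$ **Corollary.** Fix $t\in\mathbb T$. 1. Let $\rho_t$ be a closed conditionally coherent risk measure for processes and let $R_s$, $s<t$, be closed conditionally coherent risk measures for vectors. Then $\bar R_t(X)=\sum_{s<t}R_s(X_s)1_{\{s\}}+\rho_t(\pi_{t,T}(X))1_{\mathbb T_t}$, where $\pi_{t,T}(X)_s=X_s1_{\{s\ge t\}}$, is a closed conditionally coherent risk measure on the optional filtration, it has dual representation with respect to $\bar{\mathcal W}_t^{\max}$,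 and $$\bar{\mathcal W}_t^{\max}=\{(\bar{\mathbb Q},\bar w)\in\bar{\mathcal W}_t:\ \bar w_s\in\mathcal W_{R_s}^{\max}\ \forall s<t,\ \ W_t(\bar{\mathbb Q},\bar w)\in\mathcal W_t^{\max}\},$$ whether $W_t$ is evaluated through some or through every decomposition of $\bar{\mathbb Q}$. 2. Let $\bar R_t$ be a closed conditionally coherent risk measure on the optional filtration. Then $\rho_t(X)=\bar R_t(X1_{\mathbb T_t})_t$ and $R_s(Z)=\bar R_t(Z1_{\{s\}})_s$, $s<t$, are closed conditionally coherent risk measures, they have dual representations with respect to $\mathcal W_t^{\max}$ and $\mathcal W_{R_s}^{\max}$, and $$\mathcal W_{R_s}^{\max}=\bigcup_{\bar{\mathbb Q}\in\bar{\mathcal M}_t(\bar{\mathbb P})^d}\{\bar w_s:(\bar{\mathbb Q},\bar w)\in\bar{\mathcal W}_t^{\max}\},\qquad \mathcal W_t^{\max}=\{(\mathbb Q,w)\in\mathcal W_t:\bar W_t(\mathbb Q,w)\in\bar{\mathcal W}_t^{\max}\}.$$ Moreover, the dual representations remain valid with the sets of dual variables restricted to those $(\bar{\mathbb Q},\bar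 w)$ with $\bar w\notin\bar M_t^\perp$, those $w$ with $w\notin M_s^\perp$, and those $(\mathbb Q,w)$ with $w_s\notin M_t^\perp$ for some $s\in\mathbb T_t$, respectively. -/

import Mathlib

open MeasureTheory Set
open scoped Topology Pointwise

/-!
Conventions.  Random vectors are represented by honest measurable functions `Ω → Fin d → ℝ`, and all
relations between them are required only almost surely.  Since risk measures are monotone for the
almost sure order and have upper sets as values, they automatically respect almost sure equality.
A risk measure is a total function on random vectors (or processes); only its values on the domain
named in its definition matter.
-/

namespace SetRisk

/-! ### Spaces of random vectors over a probability space `(Ω, m0, P)` and a sub-σ-algebra `F` -/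

section Spaces

variable {Ω : Type*} {m0 : MeasurableSpace Ω}

/-- `L^∞(Ω, F, P; ℝ^d)`. -/
def LInf (P : @Measure Ω m0) (F : MeasurableSpace Ω) (d : ℕ) : Set (Ω → Fin d → ℝ) :=
  {X | Measurable[F] X ∧ ∃ C : ℝ, ∀ᵐ ω ∂P, ∀ i, |X ω i| ≤ C}

/-- `L^1(Ω, F, P; ℝ^d)`. -/
def LOne (P : @Measure Ω m0) (F : MeasurableSpace Ω) (d : ℕ) : Set (Ω → Fin d → ℝ) :=
  {Z | Measurable[F] Z ∧ ∀ i, Integrable (fun ω => Z ω i) P}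

/-- `L^1(Ω, F, P; ℝ^d_+)`. -/
def LOnePos (P : @Measure Ω m0) (F : MeasurableSpace Ω) (d : ℕ) : Set (Ω → Fin d → ℝ) :=
  {Z | Z ∈ LOne P F d ∧ ∀ᵐ ω ∂P, ∀ i, 0 ≤ Z ω i}

/-- The pairing `E[Zᵀ X]`. -/
noncomputable def pairing {d : ℕ} (P : @Measure Ω m0) (Z X : Ω → Fin d → ℝ) : ℝ :=
  ∫ ω, Z ω ⬝ᵥ X ω ∂P

/-- The coarsest topology on `S` for which `x ↦ pair b x` is continuous for every `b ∈ B`. -/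
abbrev dualTop {α β : Type*} (S : Set α) (B : Set β) (pair : β → α → ℝ) : TopologicalSpace S :=
  TopologicalSpace.induced (fun (x : S) (b : B) => pair b x) inferInstance

/-- The weak* topology `σ(L^∞(F), L^1(F))`, restricted to a subset `S` of `L^∞(F)`. -/
noncomputable abbrev weakStar {d : ℕ} (P : @Measure Ω m0) (F : MeasurableSpace Ω)
    (S : Set (Ω → Fin d → ℝ)) : TopologicalSpace S :=
  dualTop S (LOne P F d) (pairing P)

/-- The space of eligible portfolios `M = ℝ^m × {0}^{d-m}`. -/
def eligible (d m : ℕ) : Set (Fin d → ℝ) := {x | ∀ i : Fin d, m ≤ (i : ℕ) → x i = 0}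

/-- `L^∞(F; M)`, the `F`-measurable eligible portfolios. -/
def MElig (P : @Measure Ω m0) (F : MeasurableSpace Ω) (d m : ℕ) : Set (Ω → Fin d → ℝ) :=
  {u | u ∈ LInf P F d ∧ ∀ᵐ ω ∂P, u ω ∈ eligible d m}

/-- The non-negative eligible portfolios. -/
def MPos (P : @Measure Ω m0) (F : MeasurableSpace Ω) (d m : ℕ) : Set (Ω → Fin d → ℝ) :=
  {u | u ∈ MElig P F d m ∧ ∀ᵐ ω ∂P, ∀ i, 0 ≤ u ω i}

/-- The positive dual cone `C^*` in `L^1(F)` of a set `C` of bounded random vectors. -/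
def dualCone {d : ℕ} (P : @Measure Ω m0) (F : MeasurableSpace Ω) (C : Set (Ω → Fin d → ℝ)) :
    Set (Ω → Fin d → ℝ) :=
  {Z | Z ∈ LOne P F d ∧ ∀ c ∈ C, 0 ≤ pairing P Z c}

/-- `M^⊥` in `L^1(F)`. -/
def MPerp (P : @Measure Ω m0) (F : MeasurableSpace Ω) (d m : ℕ) : Set (Ω → Fin d → ℝ) :=
  {Z | Z ∈ LOne P F d ∧ ∀ u ∈ MElig P F d m, pairing P Z u = 0}

/-- `Γ(w) = {u ∈ L^∞(F) : wᵀ u ≥ 0}`. -/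
def Gam {d : ℕ} (P : @Measure Ω m0) (F : MeasurableSpace Ω) (w : Ω → Fin d → ℝ) :
    Set (Ω → Fin d → ℝ) :=
  {u | u ∈ LInf P F d ∧ ∀ᵐ ω ∂P, 0 ≤ w ω ⬝ᵥ u ω}

/-- Closure of `D ⊆ L^∞(F; M)` in the weak* subspace topology of `L^∞(F; M)`. -/
def closureM {d : ℕ} (P : @Measure Ω m0) (F : MeasurableSpace Ω) (m : ℕ)
    (D : Set (Ω → Fin d → ℝ)) : Set (Ω → Fin d → ℝ) :=
  Subtype.val '' (@closure _ (weakStar P F (MElig P F d m)) (Subtype.val ⁻¹' D))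

/-- The upper sets `𝓤(M; M_+)`. -/
def upperSets (P : @Measure Ω m0) (F : MeasurableSpace Ω) (d m : ℕ) :
    Set (Set (Ω → Fin d → ℝ)) :=
  {D | D ⊆ MElig P F d m ∧ D = D + MPos P F d m}

/-- The closed convex upper sets `𝓖(M; M_+)`. -/
def closedUpperSets (P : @Measure Ω m0) (F : MeasurableSpace Ω) (d m : ℕ) :
    Set (Set (Ω → Fin d → ℝ)) :=
  {D | D ⊆ MElig P F d m ∧ D = closureM P F m (convexHull ℝ (D + MPos P F d m))}

/-! ### Measures, conditional densities and conditional expectations -/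

/-- Probability measures on `(Ω, m0)` that are absolutely continuous with respect to `P`. -/
def probAC (P : @Measure Ω m0) : Set (@Measure Ω m0) :=
  {Q | IsProbabilityMeasure Q ∧ Q ≪ P}

/-- Those that coincide with `P` on `F`. -/
def probOn (P : @Measure Ω m0) (F : MeasurableSpace Ω) : Set (@Measure Ω m0) :=
  {Q | Q ∈ probAC P ∧ ∀ A, MeasurableSet[F] A → Q A = P A}

/-- `ξ(Q) = E[dQ/dP | G] / E[dQ/dP | F]` where the denominator is positive, and `1` elsewhere;
with `F = F_t` and `G = F_s` this is `ξ_{t,s}(Q)`. -/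
noncomputable def xi (P : @Measure Ω m0) (F G : MeasurableSpace Ω) (Q : @Measure Ω m0) (ω : Ω) :
    ℝ :=
  open Classical in
  if 0 < (P[fun ω' => (Q.rnDeriv P ω').toReal | F]) ω then
    (P[fun ω' => (Q.rnDeriv P ω').toReal | G]) ω / (P[fun ω' => (Q.rnDeriv P ω').toReal | F]) ω
  else 1

/-- The `P`-almost sure version `E[ξ_{t,T}(Q) Y | F]` of the conditional expectation of a random
variable; the terminal σ-algebra is the whole σ-algebra `m0`. -/
noncomputable def condQ (P : @Measure Ω m0) (F : MeasurableSpace Ω) (Q : @Measure Ω m0)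
    (Y : Ω → ℝ) : Ω → ℝ :=
  P[fun ω => xi P F m0 Q ω * Y ω | F]

/-- The same for random vectors, component by component, under a vector of measures. -/
noncomputable def condQVec {d : ℕ} (P : @Measure Ω m0) (F : MeasurableSpace Ω)
    (Q : Fin d → @Measure Ω m0) (X : Ω → Fin d → ℝ) : Ω → Fin d → ℝ :=
  fun ω i => condQ P F (Q i) (fun ω' => X ω' i) ω

/-- `diag(w) ξ(Q)`; with `F = F_t` and `G = F_s` this is `w_t^s(Q, w)`. -/
noncomputable def wTrans {d : ℕ} (P : @Measure Ω m0) (F G : MeasurableSpace Ω)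
    (Q : Fin d → @Measure Ω m0) (w : Ω → Fin d → ℝ) : Ω → Fin d → ℝ :=
  fun ω i => w ω i * xi P F G (Q i) ω

/-! ### Set-valued conditional risk measures for vectors -/

/-- Finiteness at zero, for the value `D` at `0` of a risk measure: `D` is nonempty, closed,
decomposable, and the set of selections of a random closed subset of `M` that almost surely differs
from `M`. -/
structure FiniteAtZero {d : ℕ} (P : @Measure Ω m0) (F : MeasurableSpace Ω) (m : ℕ)
    (D : Set (Ω → Fin d → ℝ)) : Prop where
  nonempty : D.Nonempty
  closed : IsClosed[weakStar P F (MElig P F d m)] (Subtype.val ⁻¹' D)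
  decomposable : ∀ A : Set Ω, MeasurableSet[F] A → ∀ u ∈ D, ∀ v ∈ D,
    A.indicator u + Aᶜ.indicator v ∈ D
  randomSet : ∃ K : Ω → Set (Fin d → ℝ),
    (∀ ω, IsClosed (K ω) ∧ K ω ⊆ eligible d m) ∧
    MeasurableSet[F.prod inferInstance] {p : Ω × (Fin d → ℝ) | p.2 ∈ K p.1} ∧
    D = {u | u ∈ LInf P F d ∧ ∀ᵐ ω ∂P, u ω ∈ K ω} ∧
    ∀ᵐ ω ∂P, K ω ≠ eligible d m

/-- `R` is a set-valued conditional risk measure for vectors, defined on `L^∞(G; ℝ^d)` and with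
values in the upper sets of `L^∞(F; M)`. -/
structure IsVecRisk {d : ℕ} (P : @Measure Ω m0) (G F : MeasurableSpace Ω) (m : ℕ)
    (R : (Ω → Fin d → ℝ) → Set (Ω → Fin d → ℝ)) : Prop where
  upper : ∀ X ∈ LInf P G d, R X ∈ upperSets P F d m
  cashInvariant : ∀ X ∈ LInf P G d, ∀ u ∈ MElig P F d m, R (X + u) = (fun v => v - u) '' R X
  monotone : ∀ X ∈ LInf P G d, ∀ Y ∈ LInf P G d, (∀ᵐ ω ∂P, ∀ i, X ω i ≤ Y ω i) → R X ⊆ R Y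
  finiteAtZero : FiniteAtZero P F m (R 0)

/-- `R : L^∞(G; ℝ^d) → 𝓖(M; M_+)` is a closed conditionally coherent risk measure for vectors. -/
structure IsClosedCoherentVec {d : ℕ} (P : @Measure Ω m0) (G F : MeasurableSpace Ω) (m : ℕ)
    (R : (Ω → Fin d → ℝ) → Set (Ω → Fin d → ℝ)) : Prop extends IsVecRisk P G F m R where
  closedUpper : ∀ X ∈ LInf P G d, R X ∈ closedUpperSets P F d m
  condConvex : ∀ X ∈ LInf P G d, ∀ Y ∈ LInf P G d, ∀ l : Ω → ℝ, Measurable[F] l →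
    (∀ᵐ ω ∂P, 0 ≤ l ω ∧ l ω ≤ 1) → ∀ u ∈ R X, ∀ v ∈ R Y,
      (fun ω => l ω • u ω + (1 - l ω) • v ω) ∈ R (fun ω => l ω • X ω + (1 - l ω) • Y ω)
  condPosHom : ∀ X ∈ LInf P G d, ∀ l : Ω → ℝ, Measurable[F] l →
    (∀ᵐ ω ∂P, 0 < l ω) → (∃ C : ℝ, ∀ᵐ ω ∂P, l ω ≤ C) →
      R (fun ω => l ω • X ω) =
        {v | v ∈ MElig P F d m ∧ ∃ u ∈ R X, ∀ᵐ ω ∂P, v ω = l ω • u ω}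
  closedGraph : IsClosed[@instTopologicalSpaceProd _ _
      (weakStar P G (LInf P G d)) (weakStar P F (MElig P F d m))]
    {p : (LInf P G d) × (MElig P F d m) | (p.2 : Ω → Fin d → ℝ) ∈ R p.1}

/-- The acceptance set of a risk measure for vectors. -/
def accVec {d : ℕ} (P : @Measure Ω m0) (G : MeasurableSpace Ω)
    (R : (Ω → Fin d → ℝ) → Set (Ω → Fin d → ℝ)) : Set (Ω → Fin d → ℝ) :=
  {X | X ∈ LInf P G d ∧ 0 ∈ R X}

/-- The dual variables `(Q, w)` of risk measures for vectors on `L^∞(m0)`. -/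
def dualVec (P : @Measure Ω m0) (F : MeasurableSpace Ω) (d m : ℕ) :
    Set ((Fin d → @Measure Ω m0) × (Ω → Fin d → ℝ)) :=
  {p | (∀ i, p.1 i ∈ probOn P F) ∧ p.2 ∈ dualCone P F (MPos P F d m) ∧
    wTrans P F m0 p.1 p.2 ∈ LOnePos P m0 d}

/-- The maximal set of dual variables of a risk measure for vectors on `L^∞(m0)`. -/
def dualVecMax {d : ℕ} (P : @Measure Ω m0) (F : MeasurableSpace Ω) (m : ℕ)
    (R : (Ω → Fin d → ℝ) → Set (Ω → Fin d → ℝ)) :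
    Set ((Fin d → @Measure Ω m0) × (Ω → Fin d → ℝ)) :=
  {p | p ∈ dualVec P F d m ∧ wTrans P F m0 p.1 p.2 ∈ dualCone P m0 (accVec P m0 R)}

/-- The maximal set of dual variables of a risk measure for vectors that is restricted to
`L^∞(F)`; such a risk measure needs no vector of probability measures. -/
def dualRestrMax {d : ℕ} (P : @Measure Ω m0) (F : MeasurableSpace Ω) (m : ℕ)
    (R : (Ω → Fin d → ℝ) → Set (Ω → Fin d → ℝ)) : Set (Ω → Fin d → ℝ) :=
  {w | w ∈ dualCone P F (MPos P F d m) ∧ w ∈ LOnePos P F d ∧ w ∈ dualCone P F (accVec P F R)}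

/-- `(E^Q[-X | F] + Γ(w)) ∩ M`. -/
def halfVec {d : ℕ} (P : @Measure Ω m0) (F : MeasurableSpace Ω) (m : ℕ)
    (Q : Fin d → @Measure Ω m0) (w X : Ω → Fin d → ℝ) : Set (Ω → Fin d → ℝ) :=
  ({condQVec P F Q (-X)} + Gam P F w) ∩ MElig P F d m

/-- `(-X + Γ(w)) ∩ M`. -/
def halfRestr {d : ℕ} (P : @Measure Ω m0) (F : MeasurableSpace Ω) (m : ℕ)
    (w X : Ω → Fin d → ℝ) : Set (Ω → Fin d → ℝ) :=
  ({-X} + Gam P F w) ∩ MElig P F d m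

end Spaces

/-! ### Set-valued conditional risk measures for processes -/

section Processes

variable {Ω : Type*} {mΩ : MeasurableSpace Ω} {T : ℕ}

/-- `𝓡_t^{∞,d}`: bounded adapted processes that vanish before `t`. -/
def ProcInf (P : Measure Ω) (ℱ : Filtration (Fin (T + 1)) mΩ) (d : ℕ) (t : Fin (T + 1)) :
    Set (Fin (T + 1) → Ω → Fin d → ℝ) :=
  {X | (∀ s, X s ∈ LInf P (ℱ s) d) ∧ ∀ s < t, X s = 0}

/-- The increment `Δa_s = a_s - a_{s-1}`, where `a_{-1} = 0`. -/
def incr {d : ℕ} (a : Fin (T + 1) → Ω → Fin d → ℝ) (s : Fin (T + 1)) : Ω → Fin d → ℝ :=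
  a s - if s.val = 0 then 0 else a ⟨s.val - 1, by omega⟩

/-- `𝓐_t^{1,d}`: adapted processes of integrable variation that vanish before `t`. -/
def ProcOne (P : Measure Ω) (ℱ : Filtration (Fin (T + 1)) mΩ) (d : ℕ) (t : Fin (T + 1)) :
    Set (Fin (T + 1) → Ω → Fin d → ℝ) :=
  {a | (∀ s, Measurable[ℱ s] (a s)) ∧ (∀ s i, Integrable (fun ω => incr a s ω i) P) ∧
    ∀ s < t, a s = 0}

/-- The pairing `E[∑_s Δa_sᵀ X_s]`. -/
noncomputable def procPairing {d : ℕ} (P : Measure Ω) (a X : Fin (T + 1) → Ω → Fin d → ℝ) : ℝ :=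
  ∫ ω, ∑ s, incr a s ω ⬝ᵥ X s ω ∂P

/-- The topology `σ(𝓡_t^{∞,d}, 𝓐_t^{1,d})`. -/
noncomputable abbrev procTop (P : Measure Ω) (ℱ : Filtration (Fin (T + 1)) mΩ) (d : ℕ)
    (t : Fin (T + 1)) : TopologicalSpace (ProcInf P ℱ d t) :=
  dualTop (ProcInf P ℱ d t) (ProcOne P ℱ d t) (procPairing P)

/-- The process `u 1_{𝕋_t}`. -/
def constFrom {d : ℕ} (t : Fin (T + 1)) (u : Ω → Fin d → ℝ) : Fin (T + 1) → Ω → Fin d → ℝ :=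
  fun s => if t ≤ s then u else 0

/-- The projection `π_{t,T}`. -/
def projFrom {d : ℕ} (t : Fin (T + 1)) (X : Fin (T + 1) → Ω → Fin d → ℝ) :
    Fin (T + 1) → Ω → Fin d → ℝ :=
  fun s => if t ≤ s then X s else 0

/-- `ρ` is a set-valued conditional risk measure for processes at time `t`. -/
structure IsProcRisk {d : ℕ} (P : Measure Ω) (ℱ : Filtration (Fin (T + 1)) mΩ) (m : ℕ)
    (t : Fin (T + 1)) (ρ : (Fin (T + 1) → Ω → Fin d → ℝ) → Set (Ω → Fin d → ℝ)) : Prop where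
  upper : ∀ X ∈ ProcInf P ℱ d t, ρ X ∈ upperSets P (ℱ t) d m
  cashInvariant : ∀ X ∈ ProcInf P ℱ d t, ∀ u ∈ MElig P (ℱ t) d m,
    ρ (X + constFrom t u) = (fun v => v - u) '' ρ X
  monotone : ∀ X ∈ ProcInf P ℱ d t, ∀ Y ∈ ProcInf P ℱ d t,
    (∀ s, ∀ᵐ ω ∂P, ∀ i, X s ω i ≤ Y s ω i) → ρ X ⊆ ρ Y
  finiteAtZero : FiniteAtZero P (ℱ t) m (ρ 0)

/-- `ρ : 𝓡_t^{∞,d} → 𝓖(M_t; M_{t,+})` is a closed conditionally coherent risk measure for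
processes. -/
structure IsClosedCoherentProc {d : ℕ} (P : Measure Ω) (ℱ : Filtration (Fin (T + 1)) mΩ) (m : ℕ)
    (t : Fin (T + 1)) (ρ : (Fin (T + 1) → Ω → Fin d → ℝ) → Set (Ω → Fin d → ℝ)) : Prop
    extends IsProcRisk P ℱ m t ρ where
  closedUpper : ∀ X ∈ ProcInf P ℱ d t, ρ X ∈ closedUpperSets P (ℱ t) d m
  condConvex : ∀ X ∈ ProcInf P ℱ d t, ∀ Y ∈ ProcInf P ℱ d t, ∀ l : Ω → ℝ, Measurable[ℱ t] l →
    (∀ᵐ ω ∂P, 0 ≤ l ω ∧ l ω ≤ 1) → ∀ u ∈ ρ X, ∀ v ∈ ρ Y,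
      (fun ω => l ω • u ω + (1 - l ω) • v ω) ∈ ρ (fun s ω => l ω • X s ω + (1 - l ω) • Y s ω)
  condPosHom : ∀ X ∈ ProcInf P ℱ d t, ∀ l : Ω → ℝ, Measurable[ℱ t] l →
    (∀ᵐ ω ∂P, 0 < l ω) → (∃ C : ℝ, ∀ᵐ ω ∂P, l ω ≤ C) →
      ρ (fun s ω => l ω • X s ω) =
        {v | v ∈ MElig P (ℱ t) d m ∧ ∃ u ∈ ρ X, ∀ᵐ ω ∂P, v ω = l ω • u ω}
  closedGraph : IsClosed[@instTopologicalSpaceProd _ _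
      (procTop P ℱ d t) (weakStar P (ℱ t) (MElig P (ℱ t) d m))]
    {p : (ProcInf P ℱ d t) × (MElig P (ℱ t) d m) | (p.2 : Ω → Fin d → ℝ) ∈ ρ p.1}

/-- The acceptance set of a risk measure for processes. -/
def accProc {d : ℕ} (P : Measure Ω) (ℱ : Filtration (Fin (T + 1)) mΩ) (t : Fin (T + 1))
    (ρ : (Fin (T + 1) → Ω → Fin d → ℝ) → Set (Ω → Fin d → ℝ)) :
    Set (Fin (T + 1) → Ω → Fin d → ℝ) :=
  {X | X ∈ ProcInf P ℱ d t ∧ 0 ∈ ρ X}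

/-- The dual variables `(Q, w) = ((Q_s)_{s ≥ t}, (w_s)_{s ≥ t})` of risk measures for
processes. -/
def dualProc (P : Measure Ω) (ℱ : Filtration (Fin (T + 1)) mΩ) (d m : ℕ) (t : Fin (T + 1)) :
    Set ((Ici t → Fin d → Measure Ω) × (Ici t → Ω → Fin d → ℝ)) :=
  {p | (∀ s i, p.1 s i ∈ probOn P (ℱ t)) ∧
    (∀ s, p.2 s ∈ dualCone P (ℱ t) (MPos P (ℱ t) d m)) ∧
    ∀ s : Ici t, wTrans P (ℱ t) (ℱ s) (p.1 s) (p.2 s) ∈ LOnePos P (ℱ s) d}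

/-- The maximal set of dual variables of a risk measure for processes. -/
def dualProcMax {d : ℕ} (P : Measure Ω) (ℱ : Filtration (Fin (T + 1)) mΩ) (m : ℕ)
    (t : Fin (T + 1)) (ρ : (Fin (T + 1) → Ω → Fin d → ℝ) → Set (Ω → Fin d → ℝ)) :
    Set ((Ici t → Fin d → Measure Ω) × (Ici t → Ω → Fin d → ℝ)) :=
  {p | p ∈ dualProc P ℱ d m t ∧ ∀ Z ∈ accProc P ℱ t ρ,
    ∀ᵐ ω ∂P, 0 ≤ ∑ s : Ici t, p.2 s ω ⬝ᵥ condQVec P (ℱ t) (p.1 s) (Z s) ω}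

/-- `{u ∈ M_t : ∑_s w_sᵀ u ≥ ∑_s w_sᵀ E_t^{Q_s}[-X_s]}`. -/
def halfProc {d : ℕ} (P : Measure Ω) (ℱ : Filtration (Fin (T + 1)) mΩ) (m : ℕ)
    (t : Fin (T + 1)) (Q : Ici t → Fin d → Measure Ω) (w : Ici t → Ω → Fin d → ℝ)
    (X : Fin (T + 1) → Ω → Fin d → ℝ) : Set (Ω → Fin d → ℝ) :=
  {u | u ∈ MElig P (ℱ t) d m ∧ ∀ᵐ ω ∂P,
    ∑ s : Ici t, w s ω ⬝ᵥ condQVec P (ℱ t) (Q s) (-X s) ω ≤ ∑ s : Ici t, w s ω ⬝ᵥ u ω}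

/-! ### The optional filtration -/

/-- The optional σ-algebra on `Ω × 𝕋`. -/
abbrev optSigma (ℱ : Filtration (Fin (T + 1)) mΩ) : MeasurableSpace (Ω × Fin (T + 1)) :=
  MeasurableSpace.generateFrom {B | ∃ s, ∃ A, MeasurableSet[ℱ s] A ∧ B = A ×ˢ {s}}

/-- The optional filtration at time `t`. -/
abbrev optFilt (ℱ : Filtration (Fin (T + 1)) mΩ) (t : Fin (T + 1)) :
    MeasurableSpace (Ω × Fin (T + 1)) :=
  MeasurableSpace.generateFrom
    {B | (∃ r < t, ∃ D, MeasurableSet[ℱ r] D ∧ B = D ×ˢ {r}) ∨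
      ∃ D, MeasurableSet[ℱ t] D ∧ B = D ×ˢ Ici t}

/-- Adapted reference processes `μ`. -/
structure IsReference (P : Measure Ω) (ℱ : Filtration (Fin (T + 1)) mΩ)
    (μ : Fin (T + 1) → Ω → ℝ) : Prop where
  adapted : ∀ s, Measurable[ℱ s] (μ s)
  sum_eq_one : ∀ᵐ ω ∂P, ∑ s, μ s ω = 1
  bounded_below : ∃ ε : ℝ, 0 < ε ∧ ∀ᵐ ω ∂P, ∀ s, ε < μ s ω

/-- The measure `P ⊗ μ` on the optional σ-algebra, `B ↦ E[∑_s μ_s 1_B(·, s)]`. -/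
noncomputable def optMeasure (P : Measure Ω) (ℱ : Filtration (Fin (T + 1)) mΩ)
    (μ : Fin (T + 1) → Ω → ℝ) : @Measure (Ω × Fin (T + 1)) (optSigma ℱ) :=
  ∑ s, @Measure.map _ _ mΩ (optSigma ℱ) (fun ω => (ω, s))
    (P.withDensity fun ω => ENNReal.ofReal (μ s ω))

/-- Optional random measures `ψ ∈ Ψ(P)`. -/
def optRandomMeasures (P : Measure Ω) (ℱ : Filtration (Fin (T + 1)) mΩ) :
    Set (Fin (T + 1) → Ω → ℝ) :=
  {ψ | (∀ s, Measurable[ℱ s] (ψ s)) ∧ (∀ s, ∀ᵐ ω ∂P, 0 ≤ ψ s ω) ∧ ∀ᵐ ω ∂P, ∑ s, ψ s ω = 1}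

/-- `Qbar = Q ⊗ ψ`, with `Q ∈ 𝓜(P)` and `ψ ∈ Ψ(P)`: the expectation under `Qbar` of every
bounded `X` is `E^Q[∑_s ψ_s X_s]`. -/
def IsDecomp (P : Measure Ω) (ℱ : Filtration (Fin (T + 1)) mΩ) (μ : Fin (T + 1) → Ω → ℝ)
    (Qbar : @Measure (Ω × Fin (T + 1)) (optSigma ℱ)) (Q : Measure Ω)
    (ψ : Fin (T + 1) → Ω → ℝ) : Prop :=
  Q ∈ probAC P ∧ ψ ∈ optRandomMeasures P ℱ ∧
  ∀ X : Ω × Fin (T + 1) → ℝ, Measurable[optSigma ℱ] X →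
    (∃ C : ℝ, ∀ᵐ x ∂(optMeasure P ℱ μ), |X x| ≤ C) →
      ∫ x, X x ∂Qbar = ∫ ω, ∑ s, ψ s ω * X (ω, s) ∂Q

/-- The section `X_s` of a function on `Ω × 𝕋`. -/
def sect {E : Type*} (X : Ω × Fin (T + 1) → E) (s : Fin (T + 1)) : Ω → E := fun ω => X (ω, s)

/-! ### Passing between processes and the optional filtration -/

/-- `R̄_t(X) = ∑_{s<t} R_s(X_s) 1_{s} + ρ_t(π_{t,T}(X)) 1_{𝕋_t}`. -/
def toOptional {d : ℕ} (t : Fin (T + 1))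
    (ρ : (Fin (T + 1) → Ω → Fin d → ℝ) → Set (Ω → Fin d → ℝ))
    (R : Fin (T + 1) → (Ω → Fin d → ℝ) → Set (Ω → Fin d → ℝ))
    (X : Ω × Fin (T + 1) → Fin d → ℝ) : Set (Ω × Fin (T + 1) → Fin d → ℝ) :=
  {u | ∃ (v : Fin (T + 1) → Ω → Fin d → ℝ) (z : Ω → Fin d → ℝ),
    (∀ s < t, v s ∈ R s (sect X s)) ∧ z ∈ ρ (projFrom t (sect X)) ∧
    u = fun x => if x.2 < t then v x.2 x.1 else z x.1}

/-- `ρ_t(X) = R̄_t(X 1_{𝕋_t})_t`. -/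
def toProc {d : ℕ} (t : Fin (T + 1))
    (Rbar : (Ω × Fin (T + 1) → Fin d → ℝ) → Set (Ω × Fin (T + 1) → Fin d → ℝ))
    (X : Fin (T + 1) → Ω → Fin d → ℝ) : Set (Ω → Fin d → ℝ) :=
  (fun u => sect u t) '' Rbar (fun x => if t ≤ x.2 then X x.2 x.1 else 0)

/-- `R_s(Z) = R̄_t(Z 1_{s})_s`. -/
def toRestr {d : ℕ}
    (Rbar : (Ω × Fin (T + 1) → Fin d → ℝ) → Set (Ω × Fin (T + 1) → Fin d → ℝ))
    (s : Fin (T + 1)) (Z : Ω → Fin d → ℝ) : Set (Ω → Fin d → ℝ) :=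
  (fun u => sect u s) '' Rbar (fun x => if x.2 = s then Z x.1 else 0)

/-- The map `W_t`, on `Qbar = Q ⊗ ψ` given through a decomposition, and `w̄`. -/
noncomputable def Wmap {d : ℕ} (P : Measure Ω) (ℱ : Filtration (Fin (T + 1)) mΩ)
    (μ : Fin (T + 1) → Ω → ℝ) (t : Fin (T + 1)) (Q : Fin d → Measure Ω)
    (ψ : Fin d → Fin (T + 1) → Ω → ℝ) (wbar : Ω × Fin (T + 1) → Fin d → ℝ) :
    (Ici t → Fin d → Measure Ω) × (Ici t → Ω → Fin d → ℝ) :=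
  open Classical in
  (fun s i => P.withDensity fun ω => ENNReal.ofReal
      (if 0 < condQ P (ℱ t) (Q i) (ψ i s) ω then
        ψ i s ω / condQ P (ℱ t) (Q i) (ψ i s) ω * xi P (ℱ t) (ℱ s) (Q i) ω
      else μ s ω / (P[μ s | ℱ t]) ω),
    fun s ω i => condQ P (ℱ t) (Q i) (ψ i s) ω / (1 - ∑ r ∈ Finset.Iio t, μ r ω) * wbar (ω, t) i)

/-- `∑_{s ≥ t} diag(1_{w_s > 0}) w_s`. -/
noncomputable def wbarSum {d : ℕ} {t : Fin (T + 1)} (w : Ici t → Ω → Fin d → ℝ) :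
    Ω → Fin d → ℝ :=
  open Classical in
  fun ω i => ∑ s : Ici t, if 0 < w s ω i then w s ω i else 0

/-- The density `(dQ̄_i/dP̄)_r` of the measures in `W̄_t(Q, w)`.  Where the total weight vanishes,
the mass is spread evenly over the `T - t + 1` times in `𝕋_t`. -/
noncomputable def WbarDensity {d : ℕ} (P : Measure Ω) (ℱ : Filtration (Fin (T + 1)) mΩ)
    (μ : Fin (T + 1) → Ω → ℝ) (t : Fin (T + 1)) (Q : Ici t → Fin d → Measure Ω)
    (w : Ici t → Ω → Fin d → ℝ) (i : Fin d) (x : Ω × Fin (T + 1)) : ℝ :=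
  open Classical in
  if h : t ≤ x.2 then
    (1 - ∑ r ∈ Finset.Iio t, μ r x.1) / μ x.2 x.1 *
      (if 0 < wbarSum w x.1 i then w ⟨x.2, h⟩ x.1 i / wbarSum w x.1 i
        else 1 / ((Fintype.card (Ici t) : ℕ) : ℝ)) *
      xi P (ℱ t) (ℱ x.2) (Q ⟨x.2, h⟩ i) x.1
  else 1

/-- The map `W̄_t`. -/
noncomputable def WbarMap {d : ℕ} (P : Measure Ω) (ℱ : Filtration (Fin (T + 1)) mΩ)
    (μ : Fin (T + 1) → Ω → ℝ) (t : Fin (T + 1))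
    (p : (Ici t → Fin d → Measure Ω) × (Ici t → Ω → Fin d → ℝ)) :
    (Fin d → @Measure (Ω × Fin (T + 1)) (optSigma ℱ)) × (Ω × Fin (T + 1) → Fin d → ℝ) :=
  (fun i => (optMeasure P ℱ μ).withDensity fun x =>
      ENNReal.ofReal (WbarDensity P ℱ μ t p.1 p.2 i x),
    fun x => if t ≤ x.2 then wbarSum p.2 x.1 else 0)

/-! ### Dual representations of coherent risk measures

Each of the following says that the risk measure is the intersection of the half-spaces given by a
set of dual variables. -/

/-- Dual representation of a risk measure for vectors with respect to `W`. -/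
def RepVec {Ω' : Type*} {m0 : MeasurableSpace Ω'} {d : ℕ} (P : @Measure Ω' m0)
    (F : MeasurableSpace Ω') (m : ℕ) (R : (Ω' → Fin d → ℝ) → Set (Ω' → Fin d → ℝ))
    (W : Set ((Fin d → @Measure Ω' m0) × (Ω' → Fin d → ℝ))) : Prop :=
  ∀ X ∈ LInf P m0 d, R X = MElig P F d m ∩ ⋂ p ∈ W, halfVec P F m p.1 p.2 X

/-- Dual representation of a restricted risk measure for vectors with respect to `W`. -/
def RepRestr {Ω' : Type*} {m0 : MeasurableSpace Ω'} {d : ℕ} (P : @Measure Ω' m0)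
    (F : MeasurableSpace Ω') (m : ℕ) (R : (Ω' → Fin d → ℝ) → Set (Ω' → Fin d → ℝ))
    (W : Set (Ω' → Fin d → ℝ)) : Prop :=
  ∀ X ∈ LInf P F d, R X = MElig P F d m ∩ ⋂ w ∈ W, halfRestr P F m w X

/-- Dual representation of a risk measure for processes with respect to `W`. -/
def RepProc {d : ℕ} (P : Measure Ω) (ℱ : Filtration (Fin (T + 1)) mΩ) (m : ℕ) (t : Fin (T + 1))
    (ρ : (Fin (T + 1) → Ω → Fin d → ℝ) → Set (Ω → Fin d → ℝ))
    (W : Set ((Ici t → Fin d → Measure Ω) × (Ici t → Ω → Fin d → ℝ))) : Prop :=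
  ∀ X ∈ ProcInf P ℱ d t,
    ρ X = MElig P (ℱ t) d m ∩ ⋂ p ∈ W, halfProc P ℱ m t p.1 p.2 X

end Processes

end SetRisk

/-! The representations are bipolar theorems for acceptance sets. By cash invariance, `u ∈ R X`
means that `X + u` is acceptable. The acceptance set is a weakly closed convex cone, stable under
multiplication by non-negative bounded random variables that are measurable at the evaluation time.
A position outside it is therefore separated by an element `Z` of the predual that is non-negative
on the cone and negative at the position (`exists_pair_separating`). Acceptability of non-negative
positions forces `Z ≥ 0`, and such a `Z` factors as a weight `E[Z | F]` times a conditional density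
`ξ(Q)` (`exists_wTrans_eq`), so it is a dual variable. Stability under indicators turns scalar
inequalities into almost sure ones. Finiteness at zero gives an eligible portfolio that is not
acceptable; a small perturbation makes `Z` non-zero there as well
(`exists_pair_separating_ne_zero`), which keeps the weight out of `M^⊥`. Hence `repVec_of_subset`,
`repRestr_of_subset` and `repProc_of_subset` hold for every set of dual variables between the
maximal one and its part outside `M^⊥`.

The transfer between the two settings rests on sections. A function on the optional space is a
process; measurability at time `t` means adaptedness before `t` and being constant in time from `t`
on. Because `μ` is bounded away from zero, boundedness, integrability and the weak topologies are
those of the sections, so a risk measure on the optional filtration is a product of one-time risk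
measures before `t` and one risk measure for processes from `t` on. All axioms pass through this
product; closedness of graphs passes because taking sections and embedding them are weakly
continuous.

For the dual variables, positivity of a functional on the optional acceptance set splits along the
same product (`forall_pairing_nonneg_iff`). It remains to see that the two maps preserve the
functional on the part from `t` on, up to a factor. The identities are `w_t^s(W_t(Q̄, w̄)) = μ_s
w̄_t^T(Q̄, w̄)_s / (1 - ∑_{r<t} μ_r)` (`wTrans_Wmap_ae_eq`) and `μ_s w̄_t^T(W̄_t(Q, w))_s = (1 -
∑_{r<t} μ_r) w_t^s(Q_s, w_s)` (`mul_sect_wTrans_WbarMap_ae_eq`). The factor is positive, measurable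
at time `t`, and bounded together with its inverse, so it does not affect positivity.

Evaluating `W_t` needs a decomposition `Q̄ = Q ⊗ ψ`. One exists by a multiplicative decomposition
built backwards in time (`exists_multiplicative_decomposition`). Every decomposition satisfies
`E_s[dQ/dP] ψ_s = μ_s (dQ̄/dP̄)_s`, so the functional obtained does not depend on the choice; this
is why "some" and "every" give the same set. -/

set_option linter.unusedSectionVars false

namespace SetRisk

/-! ### Separation in topologies induced by a pairing -/

section DualTopology

variable {α β α' β' : Type*}

/-- Weak continuity only asks for an adjoint: each test functional of the target must pull back to a
test functional of the source. -/
theorem continuous_dualTop {S : Set α} {B : Set β} {pair : β → α → ℝ} {S' : Set α'} {B' : Set β'}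
    {pair' : β' → α' → ℝ} (f : S → S')
    (h : ∀ b' ∈ B', ∃ b ∈ B, ∀ x : S, pair' b' (f x) = pair b x) :
    @Continuous S S' (dualTop S B pair) (dualTop S' B' pair') f := by
  let _ : TopologicalSpace S := dualTop S B pair
  refine continuous_induced_rng.2 (continuous_pi fun b' => ?_)
  obtain ⟨b, hb, e⟩ := h b' b'.2
  have h1 : Continuous fun x : S => fun b : B => pair b x := continuous_induced_dom
  exact ((continuous_apply (⟨b, hb⟩ : B)).comp h1).congr fun x => (e x).symm

/-- Hahn–Banach separation of a point from a closed convex cone in a topology that is induced by a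
family of functionals that is closed under linear combinations. -/
theorem exists_pair_separating [AddCommGroup α] [Module ℝ α] {S : Set α} {B : Set β}
    {pair : β → α → ℝ} {A : Set α} (hAS : A ⊆ S)
    (hA : IsClosed[dualTop S B pair] (Subtype.val ⁻¹' A : Set S))
    (h0 : (0 : α) ∈ A) (hadd : ∀ x ∈ A, ∀ y ∈ A, x + y ∈ A)
    (hsmul : ∀ c : ℝ, 0 < c → ∀ x ∈ A, c • x ∈ A)
    (padd : ∀ b ∈ B, ∀ x ∈ S, ∀ y ∈ S, pair b (x + y) = pair b x + pair b y)
    (psmul : ∀ b ∈ B, ∀ (c : ℝ), ∀ x ∈ S, pair b (c • x) = c * pair b x)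
    (hB : ∀ c : B →₀ ℝ, ∃ b ∈ B, ∀ x ∈ S, pair b x = c.sum fun b' r => r * pair b' x)
    {x₀ : α} (hx₀ : x₀ ∈ S) (hx₀A : x₀ ∉ A) :
    ∃ b ∈ B, (∀ y ∈ A, 0 ≤ pair b y) ∧ pair b x₀ < 0 := by
  let _ : TopologicalSpace S := dualTop S B pair
  -- The set `S` is not given as a topological vector space, so Hahn–Banach is applied in the
  -- locally convex space `ℝ^B`, from which `S` inherits its topology through `φ`.
  let φ : α → B → ℝ := fun x b => pair b x
  have hφadd : ∀ x ∈ S, ∀ y ∈ S, φ (x + y) = φ x + φ y := fun x hx y hy => by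
    ext b; exact padd b b.2 x hx y hy
  have hφsmul : ∀ c : ℝ, ∀ x ∈ S, φ (c • x) = c • φ x := fun c x hx => by
    ext b; exact psmul b b.2 c x hx
  have hconv : Convex ℝ (φ '' A) := by
    rintro _ ⟨x, hx, rfl⟩ _ ⟨y, hy, rfl⟩ a b ha hb hab
    rcases ha.eq_or_lt with rfl | ha
    · simp only [zero_add] at hab; subst hab; exact ⟨y, hy, by simp⟩
    rcases hb.eq_or_lt with rfl | hb
    · simp only [add_zero] at hab; subst hab; exact ⟨x, hx, by simp⟩
    refine ⟨a • x + b • y, hadd _ (hsmul a ha x hx) _ (hsmul b hb y hy), ?_⟩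
    rw [hφadd _ (hAS (hsmul a ha x hx)) _ (hAS (hsmul b hb y hy)), hφsmul _ _ (hAS hx),
      hφsmul _ _ (hAS hy)]
  have hnot : φ x₀ ∉ closure (φ '' A) := by
    intro hmem
    have him : φ '' A = (fun x : S => φ x) '' (Subtype.val ⁻¹' A) := by
      ext g; constructor
      · rintro ⟨x, hx, rfl⟩; exact ⟨⟨x, hAS hx⟩, hx, rfl⟩
      · rintro ⟨x, hx, rfl⟩; exact ⟨x, hx, rfl⟩
    rw [him] at hmem
    have : (⟨x₀, hx₀⟩ : S) ∈ closure (Subtype.val ⁻¹' A : Set S) := closure_induced.2 hmem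
    rw [hA.closure_eq] at this
    exact hx₀A this
  obtain ⟨f, u, hfx, hfu⟩ := geometric_hahn_banach_point_closed hconv.closure isClosed_closure hnot
  have hf0 : f (φ 0) = 0 := by
    have : φ 0 = 0 := by
      have := hφsmul 0 0 (hAS h0); simpa using this
    rw [this, map_zero]
  have hu : u < 0 := hf0 ▸ hfu _ (subset_closure ⟨0, h0, rfl⟩)
  -- The image is a cone: a point with a negative value could be rescaled to have the value exactly
  -- `u`, against strict separation.
  have hpos : ∀ y ∈ A, 0 ≤ f (φ y) := by
    intro y hy
    by_contra! hneg
    have hc : 0 < u / f (φ y) := div_pos_of_neg_of_neg hu hneg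
    have := hfu _ (subset_closure ⟨(u / f (φ y)) • y, hsmul _ hc y hy, rfl⟩)
    rw [hφsmul _ _ (hAS hy), map_smul, smul_eq_mul, div_mul_cancel₀ _ hneg.ne] at this
    exact lt_irrefl _ this
  -- A continuous functional on a product of lines is a finite combination of coordinates, and `hB`
  -- realizes every such combination by one element of `B`.
  have hspan : (f : (B → ℝ) →ₗ[ℝ] ℝ) ∈
      Submodule.span ℝ (range fun b : B => (LinearMap.proj b : (B → ℝ) →ₗ[ℝ] ℝ)) := by
    rw [LinearMap.mem_span_iff_continuous]
    have : (⨅ b : B, TopologicalSpace.induced (LinearMap.proj b : (B → ℝ) →ₗ[ℝ] ℝ) inferInstance)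
      = (inferInstance : TopologicalSpace (B → ℝ)) := rfl
    rw [this]
    exact f.continuous
  obtain ⟨c, hc⟩ := (Finsupp.mem_span_range_iff_exists_finsupp).1 hspan
  obtain ⟨b, hb, hbe⟩ := hB c
  have key : ∀ x ∈ S, pair b x = f (φ x) := fun x hx => by
    rw [hbe x hx]
    have := congrArg (fun g : (B → ℝ) →ₗ[ℝ] ℝ => g (φ x)) hc
    simp only [Finsupp.sum, LinearMap.sum_apply, LinearMap.smul_apply, LinearMap.proj_apply,
      smul_eq_mul, ContinuousLinearMap.coe_coe] at this
    exact this
  exact ⟨b, hb, fun y hy => (key y (hAS hy)).symm ▸ hpos y hy,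
    (key x₀ hx₀).symm ▸ (hfx.trans hu)⟩

/-- Two points outside a closed convex cone: one functional separates the first point and does not
vanish at the second one. -/
theorem exists_pair_separating_ne_zero [AddCommGroup α] [Module ℝ α] {S : Set α} {B : Set β}
    {pair : β → α → ℝ} {A : Set α} (hAS : A ⊆ S)
    (hA : IsClosed[dualTop S B pair] (Subtype.val ⁻¹' A : Set S))
    (h0 : (0 : α) ∈ A) (hadd : ∀ x ∈ A, ∀ y ∈ A, x + y ∈ A)
    (hsmul : ∀ c : ℝ, 0 < c → ∀ x ∈ A, c • x ∈ A)
    (padd : ∀ b ∈ B, ∀ x ∈ S, ∀ y ∈ S, pair b (x + y) = pair b x + pair b y)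
    (psmul : ∀ b ∈ B, ∀ (c : ℝ), ∀ x ∈ S, pair b (c • x) = c * pair b x)
    (hB : ∀ c : B →₀ ℝ, ∃ b ∈ B, ∀ x ∈ S, pair b x = c.sum fun b' r => r * pair b' x)
    {x₀ x₁ : α} (hx₀ : x₀ ∈ S) (hx₀A : x₀ ∉ A) (hx₁ : x₁ ∈ S) (hx₁A : x₁ ∉ A) :
    ∃ b ∈ B, (∀ y ∈ A, 0 ≤ pair b y) ∧ pair b x₀ < 0 ∧ pair b x₁ ≠ 0 := by
  obtain ⟨b, hb, hbA, hb0⟩ :=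
    exists_pair_separating hAS hA h0 hadd hsmul padd psmul hB hx₀ hx₀A
  obtain ⟨b', hb', hbA', hb1⟩ :=
    exists_pair_separating hAS hA h0 hadd hsmul padd psmul hB hx₁ hx₁A
  by_cases h1 : pair b x₁ = 0
  · obtain ⟨ε, hε, hε0⟩ : ∃ ε : ℝ, 0 < ε ∧ pair b x₀ + ε * pair b' x₀ < 0 := by
      have hpos : 0 < |pair b' x₀| + 1 := by positivity
      -- With this `ε`, the perturbation adds at most half of `-pair b x₀` at `x₀`, so the sum stays
      -- negative there; at `x₁`, where `b` vanishes, it is negative thanks to `b'`.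
      refine ⟨-pair b x₀ / (2 * (|pair b' x₀| + 1)), by apply div_pos <;> linarith, ?_⟩
      have h2 : -pair b x₀ / (2 * (|pair b' x₀| + 1)) * pair b' x₀ ≤
          -pair b x₀ / (2 * (|pair b' x₀| + 1)) * (|pair b' x₀| + 1) :=
        mul_le_mul_of_nonneg_left ((le_abs_self _).trans (by linarith))
          (by apply div_nonneg <;> linarith)
      have h3 : -pair b x₀ / (2 * (|pair b' x₀| + 1)) * (|pair b' x₀| + 1) = -pair b x₀ / 2 := by
        field_simp
      linarith
    obtain ⟨e, he, hee⟩ := hB (Finsupp.single ⟨b, hb⟩ 1 + Finsupp.single ⟨b', hb'⟩ ε)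
    have key : ∀ x ∈ S, pair e x = pair b x + ε * pair b' x := fun x hx => by
      rw [hee x hx, Finsupp.sum_add_index' (by simp) (by intros; ring)]
      simp
    refine ⟨e, he, fun y hy => ?_, ?_, ?_⟩
    · rw [key y (hAS hy)]
      exact add_nonneg (hbA y hy) (mul_nonneg hε.le (hbA' y hy))
    · rwa [key _ hx₀]
    · rw [key _ hx₁, h1, zero_add]
      exact (mul_neg_of_pos_of_neg hε hb1).ne
  · exact ⟨b, hb, hbA, hb0, h1⟩

end DualTopology

/-! ### Conditional expectations, conditional densities and their factorization -/

section CondExp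

variable {Ω : Type*} {F G m0 : MeasurableSpace Ω} {P : Measure Ω}

theorem ae_nonneg_of_setIntegral_nonneg (hF : F ≤ m0) {g : Ω → ℝ} (hg : Measurable[F] g)
    (hgi : Integrable g P) (h : ∀ A, MeasurableSet[F] A → 0 ≤ ∫ ω in A, g ω ∂P) :
    ∀ᵐ ω ∂P, 0 ≤ g ω := by
  have hgi' : Integrable g (P.trim hF) := hgi.trim hF hg.stronglyMeasurable
  refine ae_of_ae_trim hF (ae_nonneg_of_forall_setIntegral_nonneg hgi' fun s hs _ => ?_)
  rw [← setIntegral_trim hF hg.stronglyMeasurable hs]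
  exact h s hs

theorem ae_eq_of_setIntegral_eq (hF : F ≤ m0) {f g : Ω → ℝ} (hf : Measurable[F] f)
    (hg : Measurable[F] g) (hfi : Integrable f P) (hgi : Integrable g P)
    (h : ∀ A, MeasurableSet[F] A → ∫ ω in A, f ω ∂P = ∫ ω in A, g ω ∂P) : f =ᵐ[P] g := by
  have h1 := ae_nonneg_of_setIntegral_nonneg hF (hf.sub hg) (hfi.sub hgi) fun A hA => by
    simp only [Pi.sub_apply]
    rw [integral_sub hfi.integrableOn hgi.integrableOn, h A hA, sub_self]
  have h2 := ae_nonneg_of_setIntegral_nonneg hF (hg.sub hf) (hgi.sub hfi) fun A hA => by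
    simp only [Pi.sub_apply]
    rw [integral_sub hgi.integrableOn hfi.integrableOn, h A hA, sub_self]
  filter_upwards [h1, h2] with ω a b
  simp only [Pi.sub_apply] at a b
  linarith

variable [IsProbabilityMeasure P]

theorem measurable_condExp' {f : Ω → ℝ} : Measurable[F] (P[f | F]) :=
  stronglyMeasurable_condExp.measurable

/-- The measures with densities `Z` and `E[Z | F]` have the same trace on `F`. Working with extended
non-negative integrals avoids any integrability assumption on the product `g Z`. -/
theorem lintegral_mul_condExp (hF : F ≤ m0) {g : Ω → ENNReal} (hg : Measurable[F] g) {Z : Ω → ℝ}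
    (hZ : Integrable Z P) (hZ0 : 0 ≤ᵐ[P] Z) :
    ∫⁻ ω, g ω * ENNReal.ofReal (Z ω) ∂P = ∫⁻ ω, g ω * ENNReal.ofReal (P[Z | F] ω) ∂P := by
  have key : ∀ Y : Ω → ℝ, Integrable Y P → ∫⁻ ω, g ω * ENNReal.ofReal (Y ω) ∂P =
      ∫⁻ ω, g ω ∂((P.withDensity fun ω => ENNReal.ofReal (Y ω)).trim hF) := by
    intro Y hY
    rw [lintegral_trim hF hg, lintegral_withDensity_eq_lintegral_mul₀
      hY.aestronglyMeasurable.aemeasurable.ennreal_ofReal (hg.mono hF le_rfl).aemeasurable]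
    exact lintegral_congr fun ω => mul_comm _ _
  rw [key Z hZ, key _ integrable_condExp]
  congr 1
  refine @Measure.ext _ F _ _ fun A hA => ?_
  rw [trim_measurableSet_eq hF hA, trim_measurableSet_eq hF hA, withDensity_apply _ (hF _ hA),
    withDensity_apply _ (hF _ hA), ← ofReal_integral_eq_lintegral_ofReal hZ.integrableOn
      (ae_restrict_of_ae hZ0), ← ofReal_integral_eq_lintegral_ofReal
      integrable_condExp.integrableOn (ae_restrict_of_ae (condExp_nonneg hZ0)),
    setIntegral_condExp hF hZ hA]

theorem setLIntegral_mul_condExp (hF : F ≤ m0) {g : Ω → ENNReal} (hg : Measurable[F] g)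
    {Z : Ω → ℝ} (hZ : Integrable Z P) (hZ0 : 0 ≤ᵐ[P] Z) {A : Set Ω} (hA : MeasurableSet[F] A) :
    ∫⁻ ω in A, g ω * ENNReal.ofReal (Z ω) ∂P =
      ∫⁻ ω in A, g ω * ENNReal.ofReal (P[Z | F] ω) ∂P := by
  have h := lintegral_mul_condExp hF (hg.indicator hA) hZ hZ0
  rw [← lintegral_indicator (hF _ hA), ← lintegral_indicator (hF _ hA)]
  simpa only [indicator_mul_left] using h

/-- On the `F`-event where the conditional expectation is non-positive, the integral of the
non-negative `Z` is zero. This makes the fallback values in all the quotients below harmless. -/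
theorem eq_zero_of_condExp_nonpos (hF : F ≤ m0) {Z : Ω → ℝ}
    (hZ : Integrable Z P) (hZ0 : 0 ≤ᵐ[P] Z) : ∀ᵐ ω ∂P, P[Z | F] ω ≤ 0 → Z ω = 0 := by
  have hA : MeasurableSet[F] {ω | P[Z | F] ω ≤ 0} :=
    measurable_condExp' measurableSet_Iic
  have h1 : ∫ ω in {ω | P[Z | F] ω ≤ 0}, Z ω ∂P ≤ 0 := by
    rw [← setIntegral_condExp hF hZ hA]
    exact setIntegral_nonpos (hF _ hA) fun ω h => h
  have h2 := (setIntegral_eq_zero_iff_of_nonneg_ae (ae_restrict_of_ae hZ0) hZ.integrableOn).1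
    (le_antisymm h1 (integral_nonneg_of_ae (ae_restrict_of_ae hZ0)))
  exact (ae_restrict_iff' (hF _ hA)).1 h2

/-! ### Measures that coincide with `P` on a sub-σ-algebra -/

/-- The density of `Q` as a real function. -/
noncomputable abbrev dens (P Q : Measure Ω) : Ω → ℝ := fun ω => (Q.rnDeriv P ω).toReal

theorem integrable_dens {Q : Measure Ω} (hQ : Q ∈ probAC P) : Integrable (dens P Q) P := by
  have := hQ.1
  exact Measure.integrable_toReal_rnDeriv

theorem dens_nonneg {Q : Measure Ω} : 0 ≤ᵐ[P] dens P Q :=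
  Filter.Eventually.of_forall fun _ => ENNReal.toReal_nonneg

theorem measurable_dens {Q : Measure Ω} : Measurable (dens P Q) :=
  (Measure.measurable_rnDeriv Q P).ennreal_toReal

theorem setIntegral_dens {Q : Measure Ω} (hQ : Q ∈ probAC P) (A : Set Ω) :
    ∫ ω in A, dens P Q ω ∂P = Q.real A := by
  have := hQ.1
  exact Measure.setIntegral_toReal_rnDeriv hQ.2 A

/-- Testing on events of `F` turns agreement of `Q` and `P` there into normalization of the density.
The denominator in `xi` is then one, so `xi` is simply the conditional expectation of `dQ/dP`. -/
theorem condExp_dens (hF : F ≤ m0) {Q : Measure Ω} (hQ : Q ∈ probOn P F) :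
    P[dens P Q | F] =ᵐ[P] fun _ => 1 := by
  refine ae_eq_of_setIntegral_eq hF measurable_condExp' measurable_const integrable_condExp
    (integrable_const _) fun A hA => ?_
  rw [setIntegral_condExp hF (integrable_dens hQ.1) hA, setIntegral_dens hQ.1]
  simp [Measure.real, hQ.2 A hA]

theorem mem_probOn_of_condExp_dens (hF : F ≤ m0) {Q : Measure Ω} (hQ : Q ∈ probAC P)
    (h : P[dens P Q | F] =ᵐ[P] fun _ => 1) : Q ∈ probOn P F := by
  have := hQ.1
  refine ⟨hQ, fun A hA => ?_⟩
  have h1 := setIntegral_condExp hF (integrable_dens hQ) hA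
  rw [setIntegral_dens hQ, setIntegral_congr_ae (hF _ hA) (h.mono fun ω e _ => e)] at h1
  simp only [integral_const, smul_eq_mul, mul_one, measureReal_restrict_apply_univ] at h1
  exact ((measureReal_eq_measureReal_iff).1 h1).symm

theorem xi_ae_eq (hF : F ≤ m0) {Q : Measure Ω} (hQ : Q ∈ probOn P F) :
    xi P F G Q =ᵐ[P] P[dens P Q | G] := by
  filter_upwards [condExp_dens hF hQ] with ω h
  simp only [xi]
  rw [h]
  simp

theorem xi_self_ae_eq (hF : F ≤ m0) {Q : Measure Ω} (hQ : Q ∈ probOn P F) :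
    xi P F m0 Q =ᵐ[P] dens P Q := by
  refine (xi_ae_eq hF hQ).trans ?_
  rw [condExp_of_stronglyMeasurable le_rfl measurable_dens.stronglyMeasurable
    (integrable_dens hQ.1)]

theorem measurable_xi (hFG : F ≤ G) {Q : Measure Ω} : Measurable[G] (xi P F G Q) := by
  have h1 : Measurable[G] (P[dens P Q | F]) := measurable_condExp'.mono hFG le_rfl
  have h2 : Measurable[G] (P[dens P Q | G]) := measurable_condExp'
  exact Measurable.ite (measurableSet_lt measurable_const h1) (h2.div h1) measurable_const

theorem integrable_mul_of_bound {f g : Ω → ℝ} {C : ℝ} (hf : Integrable f P)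
    (hg : AEStronglyMeasurable g P) (hC : ∀ᵐ ω ∂P, |g ω| ≤ C) :
    Integrable (fun ω => f ω * g ω) P :=
  hf.mul_bdd hg (by simpa using hC)

theorem condQ_ae_eq (hF : F ≤ m0) (hFG : F ≤ G) (hG : G ≤ m0) {Q : Measure Ω}
    (hQ : Q ∈ probOn P F) {y : Ω → ℝ} (hy : Measurable[G] y) {C : ℝ}
    (hC : ∀ᵐ ω ∂P, |y ω| ≤ C) :
    condQ P F Q y =ᵐ[P] P[fun ω => P[dens P Q | G] ω * y ω | F] := by
  have hi : Integrable (fun ω => dens P Q ω * y ω) P :=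
    integrable_mul_of_bound (integrable_dens hQ.1) (hy.mono hG le_rfl).aestronglyMeasurable hC
  have h1 : condQ P F Q y =ᵐ[P] P[fun ω => dens P Q ω * y ω | F] :=
    condExp_congr_ae ((xi_self_ae_eq hF hQ).mono fun ω h => by simp only [h])
  refine h1.trans ((condExp_condExp_of_le hFG hG).symm.trans (condExp_congr_ae ?_))
  exact condExp_mul_of_stronglyMeasurable_right hy.stronglyMeasurable hi (integrable_dens hQ.1)

/-- The conditional density is non-negative with conditional mean one, so the bounds `± C` on `y`
survive averaging. -/
theorem condQ_bound (hF : F ≤ m0) {Q : Measure Ω}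
    (hQ : Q ∈ probOn P F) {y : Ω → ℝ} (hy : Measurable y) {C : ℝ}
    (hC : ∀ᵐ ω ∂P, |y ω| ≤ C) : ∀ᵐ ω ∂P, |condQ P F Q y ω| ≤ C := by
  have hL := integrable_dens hQ.1
  have e := xi_self_ae_eq hF hQ
  have hi : Integrable (fun ω => xi P F m0 Q ω * y ω) P :=
    integrable_mul_of_bound (hL.congr e.symm) hy.aestronglyMeasurable hC
  have hc : ∀ c : ℝ, P[fun ω => c * dens P Q ω | F] =ᵐ[P] fun _ => c := fun c => by
    refine (condExp_smul c (dens P Q) F).trans ((condExp_dens hF hQ).mono fun ω h => ?_)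
    simp [h]
  have h1 := condExp_mono (m := F) hi (hL.const_mul C) (by
    filter_upwards [e, hC] with ω h1 h2
    rw [h1, mul_comm C]
    exact mul_le_mul_of_nonneg_left (abs_le.1 h2).2 ENNReal.toReal_nonneg)
  have h2 := condExp_mono (m := F) (hL.const_mul (-C)) hi (by
    filter_upwards [e, hC] with ω h1 h2
    rw [h1, mul_comm (-C)]
    exact mul_le_mul_of_nonneg_left (abs_le.1 h2).1 ENNReal.toReal_nonneg)
  filter_upwards [h1, h2, hc C, hc (-C)] with ω a b c e
  rw [c] at a
  rw [e] at b
  exact abs_le.2 ⟨b, a⟩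

theorem integrable_mul_condQ (hF : F ≤ m0) {Q : Measure Ω} (hQ : Q ∈ probOn P F) {w y : Ω → ℝ}
    (hwi : Integrable w P) (hy : Measurable y) {C : ℝ} (hC : ∀ᵐ ω ∂P, |y ω| ≤ C) :
    Integrable (fun ω => w ω * condQ P F Q y ω) P :=
  integrable_mul_of_bound hwi integrable_condExp.aestronglyMeasurable (condQ_bound hF hQ hy hC)

/-- Adjointness of `w ↦ w ξ(Q)` and `y ↦ E^Q[y | F]`, localized to events of `F`. Only the product
`w ξ` has to be integrable for the `F`-measurable `w` to be pulled out, since `y` is bounded. -/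
theorem setIntegral_mul_condQ (hFG : F ≤ G) (hG : G ≤ m0) {Q : Measure Ω}
    (hQ : Q ∈ probOn P F) {w y : Ω → ℝ} (hw : Measurable[F] w)
    (hwx : Integrable (fun ω => w ω * xi P F G Q ω) P) (hy : Measurable[G] y) {C : ℝ}
    (hC : ∀ᵐ ω ∂P, |y ω| ≤ C) {A : Set Ω} (hA : MeasurableSet[F] A) :
    ∫ ω in A, w ω * xi P F G Q ω * y ω ∂P = ∫ ω in A, w ω * condQ P F Q y ω ∂P := by
  have hF := hFG.trans hG
  have hyA := (hy.mono hG le_rfl).aestronglyMeasurable (μ := P)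
  have e := xi_ae_eq (G := G) hF hQ
  have hi := integrable_mul_of_bound hwx hyA hC
  have hi' : Integrable ((fun ω => w ω) * fun ω => P[dens P Q | G] ω * y ω) P :=
    hi.congr (e.mono fun ω h => by simp [h, mul_assoc])
  have h1 := condExp_mul_of_stronglyMeasurable_left (m := F) hw.stronglyMeasurable hi'
    (integrable_mul_of_bound integrable_condExp hyA hC)
  have h2 := condQ_ae_eq hF hFG hG hQ hy hC
  calc ∫ ω in A, w ω * xi P F G Q ω * y ω ∂P
      = ∫ ω in A, ((fun ω => w ω) * fun ω => P[dens P Q | G] ω * y ω) ω ∂P :=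
        setIntegral_congr_ae (hF _ hA) (e.mono fun ω h _ => by simp [h, mul_assoc])
    _ = _ := (setIntegral_condExp hF hi' hA).symm
    _ = _ := setIntegral_congr_ae (hF _ hA) (by
        filter_upwards [h1, h2] with ω a b _
        rw [a, Pi.mul_apply, b])

theorem withDensity_mem_probOn (hF : F ≤ m0) {f : Ω → ℝ}
    (h : ∀ A, MeasurableSet[F] A → ∫⁻ ω in A, ENNReal.ofReal (f ω) ∂P = P A) :
    (P.withDensity fun ω => ENNReal.ofReal (f ω)) ∈ probOn P F := by
  have h' : ∀ A, MeasurableSet[F] A → (P.withDensity fun ω => ENNReal.ofReal (f ω)) A = P A :=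
    fun A hA => by rw [withDensity_apply _ (hF _ hA), h A hA]
  exact ⟨⟨⟨by rw [h' _ MeasurableSet.univ, measure_univ]⟩, withDensity_absolutelyContinuous _ _⟩,
    h'⟩

theorem dens_withDensity {f : Ω → ℝ} (hf : Measurable f) (hf0 : 0 ≤ᵐ[P] f) :
    dens P (P.withDensity fun ω => ENNReal.ofReal (f ω)) =ᵐ[P] f := by
  filter_upwards [Measure.rnDeriv_withDensity P hf.ennreal_ofReal, hf0] with ω h h0
  simp only [dens, h, ENNReal.toReal_ofReal h0]

theorem xi_withDensity (hF : F ≤ m0) (hG : G ≤ m0) {f : Ω → ℝ} (hf : Measurable[G] f)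
    (hf0 : 0 ≤ᵐ[P] f) (h : ∀ A, MeasurableSet[F] A → ∫⁻ ω in A, ENNReal.ofReal (f ω) ∂P = P A) :
    xi P F G (P.withDensity fun ω => ENNReal.ofReal (f ω)) =ᵐ[P] f := by
  have hQ := withDensity_mem_probOn hF h
  have hd := dens_withDensity (hf.mono hG le_rfl) hf0
  refine (xi_ae_eq hF hQ).trans ((condExp_congr_ae hd).trans ?_)
  rw [condExp_of_stronglyMeasurable hG hf.stronglyMeasurable
    ((integrable_dens hQ.1).congr hd)]

/-- Every non-negative integrable random variable splits into its conditional expectation and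
a conditional density. -/
theorem setLIntegral_condDensity (hF : F ≤ m0) {Z b : Ω → ℝ} (hZ : Integrable Z P)
    (hZ0 : 0 ≤ᵐ[P] Z) (hb : Integrable b P) (hb0 : 0 ≤ᵐ[P] b) (hb1 : P[b | F] =ᵐ[P] fun _ => 1)
    {c f : Ω → ℝ} (hc : Measurable[F] c) (hcZ : c =ᵐ[P] P[Z | F])
    (hf : ∀ᵐ ω ∂P, f ω = if 0 < c ω then Z ω / c ω else b ω) {A : Set Ω}
    (hA : MeasurableSet[F] A) : ∫⁻ ω in A, ENNReal.ofReal (f ω) ∂P = P A := by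
  classical
  have hS : MeasurableSet[F] {ω | 0 < c ω} := hc measurableSet_Ioi
  -- Both branches are products of an `F`-measurable factor with `Z` or `b`, so each of these may be
  -- replaced by its conditional expectation. The quotient `Z / c` is not known to be integrable at
  -- this point, hence the extended integrals.
  have e1 : ∀ᵐ ω ∂P, ENNReal.ofReal (f ω) =
      {ω | 0 < c ω}.indicator (fun ω => ENNReal.ofReal (c ω)⁻¹) ω * ENNReal.ofReal (Z ω) +
      {ω | 0 < c ω}ᶜ.indicator (fun _ => 1) ω * ENNReal.ofReal (b ω) := by
    filter_upwards [hf] with ω h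
    rw [h]
    by_cases h0 : 0 < c ω
    · simp only [h0, if_true, mem_ofPred_eq, indicator_of_mem, mem_compl_iff, not_true,
        not_false_eq_true, indicator_of_notMem, zero_mul, add_zero]
      rw [div_eq_inv_mul, ENNReal.ofReal_mul (inv_nonneg.2 h0.le)]
    · simp [h0]
  rw [setLIntegral_congr_fun_ae (hF _ hA) (e1.mono fun ω h _ => h)]
  have hg1 : Measurable[F] ({ω | 0 < c ω}.indicator fun ω => ENNReal.ofReal (c ω)⁻¹) :=
    (hc.inv.ennreal_ofReal).indicator hS
  have hg2 : Measurable[F] ({ω | 0 < c ω}ᶜ.indicator fun _ => (1 : ENNReal)) :=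
    measurable_const.indicator hS.compl
  have m1 : AEMeasurable (fun ω => {ω | 0 < c ω}.indicator (fun ω => ENNReal.ofReal (c ω)⁻¹) ω *
      ENNReal.ofReal (Z ω)) (P.restrict A) := ((hg1.mono hF le_rfl).aemeasurable.mul
      hZ.aestronglyMeasurable.aemeasurable.ennreal_ofReal).restrict
  have m2 : AEMeasurable (fun ω => {ω | 0 < c ω}.indicator (fun ω => ENNReal.ofReal (c ω)⁻¹) ω *
      ENNReal.ofReal (P[Z | F] ω)) (P.restrict A) := ((hg1.mono hF le_rfl).aemeasurable.mul
      integrable_condExp.aestronglyMeasurable.aemeasurable.ennreal_ofReal).restrict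
  rw [lintegral_add_left' m1,
    setLIntegral_mul_condExp hF hg1 hZ hZ0 hA, setLIntegral_mul_condExp hF hg2 hb hb0 hA,
    ← lintegral_add_left' m2,
    ← setLIntegral_one]
  refine setLIntegral_congr_fun_ae (hF _ hA) ?_
  filter_upwards [hcZ, hb1] with ω h h1 _
  rw [h1, ← h]
  by_cases h0 : 0 < c ω
  · simp only [h0, mem_ofPred_eq, indicator_of_mem, mem_compl_iff, not_true, not_false_eq_true,
      indicator_of_notMem, zero_mul, add_zero]
    rw [← ENNReal.ofReal_mul (inv_nonneg.2 h0.le), inv_mul_cancel₀ h0.ne', ENNReal.ofReal_one]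
  · simp [h0]

/-- The measure has density `Z / E[Z | F]` where the denominator is positive and one elsewhere.
Where `E[Z | F]` vanishes so does `Z`, so the arbitrary value there does not spoil the
factorization. -/
theorem exists_mul_xi_eq (hFG : F ≤ G) (hG : G ≤ m0) {Z : Ω → ℝ} (hZ : Measurable[G] Z)
    (hZi : Integrable Z P) (hZ0 : 0 ≤ᵐ[P] Z) : ∃ Q ∈ probOn P F,
    (fun ω => P[Z | F] ω * xi P F G Q ω) =ᵐ[P] Z := by
  classical
  have hF := hFG.trans hG
  let f : Ω → ℝ := fun ω => if 0 < P[Z | F] ω then Z ω / P[Z | F] ω else 1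
  have hc : Measurable[G] (P[Z | F]) := measurable_condExp'.mono hFG le_rfl
  have hf : Measurable[G] f :=
    Measurable.ite (measurableSet_lt measurable_const hc) (hZ.div hc) measurable_const
  have hf0 : 0 ≤ᵐ[P] f := by
    filter_upwards [hZ0] with ω h
    simp only [f, Pi.zero_apply]
    split_ifs with h'
    · exact div_nonneg h h'.le
    · exact zero_le_one
  have h : ∀ A, MeasurableSet[F] A → ∫⁻ ω in A, ENNReal.ofReal (f ω) ∂P = P A := fun A hA =>
    setLIntegral_condDensity hF hZi hZ0 (integrable_const 1) (Filter.Eventually.of_forall fun _ =>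
      zero_le_one) (by rw [condExp_const hF]) measurable_condExp' (Filter.EventuallyEq.rfl)
      (Filter.Eventually.of_forall fun _ => rfl) hA
  refine ⟨_, withDensity_mem_probOn hF h, ?_⟩
  filter_upwards [xi_withDensity hF hG hf hf0 h, eq_zero_of_condExp_nonpos hF hZi hZ0,
    condExp_nonneg (m := F) hZ0] with ω h1 h2 h3
  rw [h1]
  simp only [f]
  split_ifs with h'
  · exact mul_div_cancel₀ _ h'.ne'
  · rw [h2 (not_lt.1 h'), mul_one]
    exact le_antisymm (not_lt.1 h') h3

end CondExp

/-! ### Algebra of the random vector spaces and sets that are finite at zero -/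

section VectorSpaces

variable {Ω : Type*} {F G m0 : MeasurableSpace Ω} {P : Measure Ω} {d m : ℕ}

theorem measurable_coord {X : Ω → Fin d → ℝ} (hX : Measurable[F] X) (i : Fin d) :
    Measurable[F] fun ω => X ω i :=
  (measurable_pi_apply i).comp hX

theorem zero_mem_LInf : (0 : Ω → Fin d → ℝ) ∈ LInf P F d :=
  ⟨measurable_const, 0, Filter.Eventually.of_forall fun _ _ => by simp⟩

theorem mono_mem_LInf (hFG : F ≤ G) {X : Ω → Fin d → ℝ} (hX : X ∈ LInf P F d) : X ∈ LInf P G d :=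
  ⟨hX.1.mono hFG le_rfl, hX.2⟩

theorem add_mem_LInf {X Y : Ω → Fin d → ℝ} (hX : X ∈ LInf P F d) (hY : Y ∈ LInf P F d) :
    X + Y ∈ LInf P F d := by
  obtain ⟨hXm, C, hC⟩ := hX
  obtain ⟨hYm, D, hD⟩ := hY
  refine ⟨hXm.add hYm, C + D, ?_⟩
  filter_upwards [hC, hD] with ω h1 h2 i
  exact (abs_add_le _ _).trans (add_le_add (h1 i) (h2 i))

theorem smul_fun_mem_LInf {X : Ω → Fin d → ℝ} (hX : X ∈ LInf P F d) {l : Ω → ℝ}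
    (hl : Measurable[F] l) {C : ℝ} (hC : ∀ᵐ ω ∂P, |l ω| ≤ C) :
    (fun ω => l ω • X ω) ∈ LInf P F d := by
  obtain ⟨hXm, D, hD⟩ := hX
  refine ⟨hl.smul hXm, C * D, ?_⟩
  filter_upwards [hC, hD] with ω h1 h2 i
  rw [Pi.smul_apply, smul_eq_mul, abs_mul]
  exact mul_le_mul h1 (h2 i) (abs_nonneg _) ((abs_nonneg _).trans h1)

theorem const_smul_mem_LInf {X : Ω → Fin d → ℝ} (hX : X ∈ LInf P F d) (c : ℝ) :
    c • X ∈ LInf P F d :=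
  smul_fun_mem_LInf hX (l := fun _ => c) measurable_const (Filter.Eventually.of_forall fun _ => le_rfl)

theorem neg_mem_LInf {X : Ω → Fin d → ℝ} (hX : X ∈ LInf P F d) : -X ∈ LInf P F d := by
  simpa using const_smul_mem_LInf hX (-1)

theorem sub_mem_LInf {X Y : Ω → Fin d → ℝ} (hX : X ∈ LInf P F d) (hY : Y ∈ LInf P F d) :
    X - Y ∈ LInf P F d := by
  rw [sub_eq_add_neg]; exact add_mem_LInf hX (neg_mem_LInf hY)

theorem exists_bound_of_mem_LInf {X : Ω → Fin d → ℝ} (hX : X ∈ LInf P F d) :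
    ∃ C, ∀ i, ∀ᵐ ω ∂P, |X ω i| ≤ C :=
  ⟨hX.2.choose, fun i => hX.2.choose_spec.mono fun _ h => h i⟩

theorem zero_mem_MElig : (0 : Ω → Fin d → ℝ) ∈ MElig P F d m :=
  ⟨zero_mem_LInf, Filter.Eventually.of_forall fun _ _ _ => rfl⟩

theorem add_mem_MElig {u v : Ω → Fin d → ℝ} (hu : u ∈ MElig P F d m) (hv : v ∈ MElig P F d m) :
    u + v ∈ MElig P F d m := by
  refine ⟨add_mem_LInf hu.1 hv.1, ?_⟩
  filter_upwards [hu.2, hv.2] with ω h1 h2 i hi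
  simp [h1 i hi, h2 i hi]

theorem smul_fun_mem_MElig {u : Ω → Fin d → ℝ} (hu : u ∈ MElig P F d m) {l : Ω → ℝ}
    (hl : Measurable[F] l) {C : ℝ} (hC : ∀ᵐ ω ∂P, |l ω| ≤ C) :
    (fun ω => l ω • u ω) ∈ MElig P F d m := by
  refine ⟨smul_fun_mem_LInf hu.1 hl hC, hu.2.mono fun ω h i hi => ?_⟩
  simp [h i hi]

theorem neg_mem_MElig {u : Ω → Fin d → ℝ} (hu : u ∈ MElig P F d m) : -u ∈ MElig P F d m :=
  ⟨neg_mem_LInf hu.1, hu.2.mono fun ω h i hi => by simp [h i hi]⟩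

theorem sub_mem_MElig {u v : Ω → Fin d → ℝ} (hu : u ∈ MElig P F d m) (hv : v ∈ MElig P F d m) :
    u - v ∈ MElig P F d m := by
  rw [sub_eq_add_neg]; exact add_mem_MElig hu (neg_mem_MElig hv)

theorem zero_mem_MPos : (0 : Ω → Fin d → ℝ) ∈ MPos P F d m :=
  ⟨zero_mem_MElig, Filter.Eventually.of_forall fun _ _ => le_rfl⟩

theorem integrable_dot (hG : G ≤ m0) {Z X : Ω → Fin d → ℝ}
    (hZ : ∀ i, Integrable (fun ω => Z ω i) P) (hX : X ∈ LInf P G d) :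
    Integrable (fun ω => Z ω ⬝ᵥ X ω) P := by
  obtain ⟨C, hC⟩ := exists_bound_of_mem_LInf hX
  exact integrable_finsetSum _ fun i _ => (hZ i).mul_bdd
    ((measurable_coord hX.1 i).mono hG le_rfl).aestronglyMeasurable (by simpa using hC i)

theorem pairing_add (hG : G ≤ m0) {Z X Y : Ω → Fin d → ℝ} (hZ : Z ∈ LOne P G d)
    (hX : X ∈ LInf P G d) (hY : Y ∈ LInf P G d) :
    pairing P Z (X + Y) = pairing P Z X + pairing P Z Y := by
  simp only [pairing, Pi.add_apply, dotProduct_add]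
  exact integral_add (integrable_dot hG hZ.2 hX) (integrable_dot hG hZ.2 hY)

theorem pairing_smul (Z X : Ω → Fin d → ℝ) (c : ℝ) :
    pairing P Z (c • X) = c * pairing P Z X := by
  simp only [pairing, Pi.smul_apply, dotProduct_smul, smul_eq_mul]
  exact integral_const_mul _ _

theorem add_mem_LOne {Z Y : Ω → Fin d → ℝ} (hZ : Z ∈ LOne P F d) (hY : Y ∈ LOne P F d) :
    Z + Y ∈ LOne P F d :=
  ⟨hZ.1.add hY.1, fun i => (hZ.2 i).add (hY.2 i)⟩

theorem zero_mem_LOne : (0 : Ω → Fin d → ℝ) ∈ LOne P F d :=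
  ⟨measurable_const, fun _ => integrable_zero _ _ _⟩

theorem const_smul_mem_LOne {Z : Ω → Fin d → ℝ} (hZ : Z ∈ LOne P F d) (c : ℝ) :
    c • Z ∈ LOne P F d :=
  ⟨hZ.1.const_smul c, fun i => (hZ.2 i).const_mul c⟩

theorem smul_fun_mem_LOne (hF : F ≤ m0) {Z : Ω → Fin d → ℝ} (hZ : Z ∈ LOne P F d) {l : Ω → ℝ}
    (hl : Measurable[F] l) {C : ℝ} (hC : ∀ᵐ ω ∂P, |l ω| ≤ C) :
    (fun ω => l ω • Z ω) ∈ LOne P F d :=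
  ⟨hl.smul hZ.1, fun i => (hZ.2 i).bdd_mul (hl.mono hF le_rfl).aestronglyMeasurable
    (by simpa using hC)⟩

/-- The predual is a linear space; this is the hypothesis that lets the separating functional be one
pairing instead of a finite combination. -/
theorem pairing_combination (hG : G ≤ m0) (c : LOne P G d →₀ ℝ) : ∃ b ∈ LOne P G d,
    ∀ x ∈ LInf P G d, pairing P b x = c.sum fun b' r => r * pairing P b' x := by
  induction c using Finsupp.induction_linear with
  | zero => exact ⟨0, zero_mem_LOne, fun x _ => by simp [pairing]⟩
  | add f g hf hg =>
    obtain ⟨b, hb, h⟩ := hf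
    obtain ⟨b', hb', h'⟩ := hg
    refine ⟨b + b', add_mem_LOne hb hb', fun x hx => ?_⟩
    rw [Finsupp.sum_add_index' (by simp) (by intros; ring), ← h x hx, ← h' x hx]
    simp only [pairing, Pi.add_apply, add_dotProduct]
    exact integral_add (integrable_dot hG hb.2 hx) (integrable_dot hG hb'.2 hx)
  | single b r =>
    refine ⟨r • b, const_smul_mem_LOne b.2 r, fun x _ => ?_⟩
    rw [Finsupp.sum_single_index (by simp)]
    simp only [pairing, Pi.smul_apply, smul_dotProduct, smul_eq_mul]
    exact integral_const_mul _ _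

theorem pairing_congr {Z Z' X : Ω → Fin d → ℝ} (h : Z =ᵐ[P] Z') :
    pairing P Z X = pairing P Z' X :=
  integral_congr_ae (h.mono fun ω h => by simp only [h])

theorem pairing_indicator (hF : F ≤ m0) (Z X : Ω → Fin d → ℝ) {A : Set Ω}
    (hA : MeasurableSet[F] A) :
    pairing P Z (fun ω => A.indicator (fun _ => (1 : ℝ)) ω • X ω) = ∫ ω in A, Z ω ⬝ᵥ X ω ∂P := by
  rw [← integral_indicator (hF _ hA)]
  refine integral_congr_ae (Filter.Eventually.of_forall fun ω => ?_)
  by_cases h : ω ∈ A <;> simp [h]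

theorem mem_dualCone_MPos {w : Ω → Fin d → ℝ} (hw : w ∈ LOne P F d)
    (h0 : ∀ᵐ ω ∂P, ∀ i, 0 ≤ w ω i) : w ∈ dualCone P F (MPos P F d m) := by
  refine ⟨hw, fun c hc => integral_nonneg_of_ae ?_⟩
  filter_upwards [h0, hc.2] with ω h1 h2
  exact Finset.sum_nonneg fun i _ => mul_nonneg (h1 i) (h2 i)

/-! ### Sets that are finite at zero -/

/-- The points `u / (n + 1)` are selections of `K` outside countably many null sets, and they tend
to zero pointwise; closedness of the values of `K` puts zero in `K`. -/
theorem FiniteAtZero.zero_mem {D : Set (Ω → Fin d → ℝ)} (hD : FiniteAtZero P F m D)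
    (hs : ∀ c : ℝ, 0 < c → ∀ u ∈ D, c • u ∈ D) : 0 ∈ D := by
  obtain ⟨u, hu⟩ := hD.nonempty
  obtain ⟨K, hK, -, hDK, -⟩ := hD.randomSet
  have h1 : ∀ n : ℕ, ∀ᵐ ω ∂P, ((n : ℝ) + 1)⁻¹ • u ω ∈ K ω := fun n => by
    have := hs ((n : ℝ) + 1)⁻¹ (by positivity) u hu
    rw [hDK] at this
    exact this.2
  rw [hDK]
  refine ⟨zero_mem_LInf, (ae_all_iff.2 h1).mono fun ω h => ?_⟩
  refine (hK ω).1.mem_of_tendsto (b := Filter.atTop)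
    (f := fun n : ℕ => ((n : ℝ) + 1)⁻¹ • u ω) ?_
    (Filter.Eventually.of_forall h)
  have h2 : Filter.Tendsto (fun n : ℕ => ((n : ℝ) + 1)⁻¹) Filter.atTop (𝓝 0) := by
    simpa using tendsto_one_div_add_atTop_nhds_zero_nat (𝕜 := ℝ)
  simpa using h2.smul_const (u ω)

/-- If every eligible portfolio belonged to `D`, the constant rational ones would lie in `K` outside
one null set, and closedness would give `K = M` almost surely, which is excluded. -/
theorem FiniteAtZero.exists_notMem [IsProbabilityMeasure P] {D : Set (Ω → Fin d → ℝ)}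
    (hD : FiniteAtZero P F m D) : ∃ u ∈ MElig P F d m, u ∉ D := by
  by_contra! hall
  obtain ⟨K, hK, -, hDK, hne⟩ := hD.randomSet
  -- The coordinate projection onto `M`: it turns the countable dense set of rational vectors into
  -- one that is dense in `M`.
  let g : (Fin d → ℝ) → Fin d → ℝ := fun x i => if (i : ℕ) < m then x i else 0
  have hg : Continuous g := continuous_pi fun i => by
    by_cases h : (i : ℕ) < m
    · simpa [g, h] using continuous_apply i
    · simpa [g, h] using continuous_const
  have h1 : ∀ q : Fin d → ℚ, ∀ᵐ ω ∂P, g (fun i => (q i : ℝ)) ∈ K ω := fun q => by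
    have : (fun _ => g fun i => (q i : ℝ)) ∈ MElig P F d m := by
      refine ⟨⟨measurable_const, ∑ i, |g (fun i => (q i : ℝ)) i|,
        Filter.Eventually.of_forall fun _ i => ?_⟩, Filter.Eventually.of_forall fun _ i hi => ?_⟩
      · exact Finset.single_le_sum (f := fun i => |g (fun i => (q i : ℝ)) i|)
          (fun _ _ => abs_nonneg _) (Finset.mem_univ i)
      · simp [g, not_lt.2 hi]
    have := hall _ this
    rw [hDK] at this
    exact this.2
  have hdense : DenseRange fun q : Fin d → ℚ => fun i => (q i : ℝ) :=
    DenseRange.piMap fun _ => Rat.denseRange_cast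
  have h2 : ∀ᵐ _ ∂P, False := by
    filter_upwards [ae_all_iff.2 h1, hne] with ω h hn
    refine hn (Subset.antisymm (hK ω).2 fun x hx => ?_)
    have hcl : IsClosed (g ⁻¹' K ω) := (hK ω).1.preimage hg
    have : x ∈ g ⁻¹' K ω := by
      have hx' := hdense x
      exact (closure_minimal (s := range fun q : Fin d → ℚ => fun i => (q i : ℝ))
        (range_subset_iff.2 h) hcl) hx'
    have hgx : g x = x := funext fun i => by
      by_cases hi : (i : ℕ) < m
      · simp [g, hi]
      · simp [g, hi, hx i (not_lt.1 hi)]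
    rwa [mem_preimage, hgx] at this
  simp [IsProbabilityMeasure.ne_zero P] at h2

/-- For a set that is already upper, convex and weak* closed, the closed convex hull in the
definition changes nothing. -/
theorem mem_closedUpperSets {D : Set (Ω → Fin d → ℝ)} (hD : D ∈ upperSets P F d m)
    (hc : Convex ℝ D) (hcl : IsClosed[weakStar P F (MElig P F d m)] (Subtype.val ⁻¹' D)) :
    D ∈ closedUpperSets P F d m := by
  refine ⟨hD.1, ?_⟩
  rw [← hD.2, hc.convexHull_eq, closureM]
  let _ : TopologicalSpace (MElig P F d m) := weakStar P F (MElig P F d m)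
  rw [hcl.closure_eq, Subtype.image_preimage_coe, inter_eq_self_of_subset_right hD.1]

end VectorSpaces

/-! ### Acceptance sets of risk measures for vectors -/

section CoherentVec

variable {Ω : Type*} {F G m0 : MeasurableSpace Ω} {P : Measure Ω} {d m : ℕ}
  {R : (Ω → Fin d → ℝ) → Set (Ω → Fin d → ℝ)}

theorem IsVecRisk.upper_mem (hR : IsVecRisk P G F m R) {X : Ω → Fin d → ℝ} (hX : X ∈ LInf P G d)
    {u v : Ω → Fin d → ℝ} (hu : u ∈ R X) (hv : v ∈ MElig P F d m)
    (huv : ∀ᵐ ω ∂P, ∀ i, u ω i ≤ v ω i) : v ∈ R X := by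
  have h := hR.upper X hX
  rw [h.2]
  refine ⟨u, hu, v - u, ⟨sub_mem_MElig hv (h.1 hu), huv.mono fun ω h i => sub_nonneg.2 (h i)⟩, ?_⟩
  exact add_sub_cancel _ _

/-- Cash invariance makes the acceptance set determine the whole risk measure. -/
theorem IsVecRisk.mem_iff (hR : IsVecRisk P G F m R) (hFG : F ≤ G) {X : Ω → Fin d → ℝ}
    (hX : X ∈ LInf P G d) {u : Ω → Fin d → ℝ} (hu : u ∈ MElig P F d m) :
    u ∈ R X ↔ X + u ∈ accVec P G R := by
  simp only [accVec, mem_ofPred_eq, add_mem_LInf hX (mono_mem_LInf hFG hu.1), true_and,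
    hR.cashInvariant X hX u hu, mem_image, sub_eq_zero, exists_eq_right]

variable (hR : IsClosedCoherentVec P G F m R)
include hR

theorem IsClosedCoherentVec.zero_mem : (0 : Ω → Fin d → ℝ) ∈ R 0 := by
  refine hR.finiteAtZero.zero_mem fun c hc u hu => ?_
  have h := hR.condPosHom 0 zero_mem_LInf (fun _ => c) measurable_const
    (Filter.Eventually.of_forall fun _ => hc) ⟨c, Filter.Eventually.of_forall fun _ => le_rfl⟩
  have e : (fun ω : Ω => c • (0 : Ω → Fin d → ℝ) ω) = 0 := by ext; simp
  rw [e] at h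
  rw [h]
  exact ⟨smul_fun_mem_MElig ((hR.upper 0 zero_mem_LInf).1 hu) (l := fun _ => c) measurable_const
    (Filter.Eventually.of_forall fun _ => le_rfl), u, hu, Filter.Eventually.of_forall fun _ => rfl⟩

/-- Positive homogeneity covers only strictly positive multipliers, whereas localization needs
indicators. A convex combination of `X` and `0` with weight `l / D` handles the zeros of `l`, and
homogeneity with the constant `D` restores the scale. -/
theorem IsClosedCoherentVec.acc_smul_fun {X : Ω → Fin d → ℝ} (hX : X ∈ accVec P G R) {l : Ω → ℝ}
    (hl : Measurable[F] l) (hl0 : ∀ᵐ ω ∂P, 0 ≤ l ω) {C : ℝ} (hC : ∀ᵐ ω ∂P, l ω ≤ C) (hFG : F ≤ G) :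
    (fun ω => l ω • X ω) ∈ accVec P G R := by
  have hD : 0 < max C 1 := lt_max_of_lt_right one_pos
  set D := max C 1
  have h1 := hR.condConvex X hX.1 0 zero_mem_LInf (fun ω => l ω / D) (hl.div_const D) (by
    filter_upwards [hl0, hC] with ω h h'
    exact ⟨div_nonneg h hD.le, (div_le_one hD).2 (h'.trans (le_max_left _ _))⟩) 0 hX.2 0 hR.zero_mem
  have h2 := hR.condPosHom (fun ω => (l ω / D) • X ω)
    (smul_fun_mem_LInf hX.1 ((hl.div_const D).mono hFG le_rfl) (C := 1) (by
      filter_upwards [hl0, hC] with ω h h'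
      rw [abs_of_nonneg (div_nonneg h hD.le)]
      exact (div_le_one hD).2 (h'.trans (le_max_left _ _))))
    (fun _ => D) measurable_const
    (Filter.Eventually.of_forall fun _ => hD) ⟨D, Filter.Eventually.of_forall fun _ => le_rfl⟩
  refine ⟨smul_fun_mem_LInf hX.1 (hl.mono hFG le_rfl) (C := C) (by
    filter_upwards [hl0, hC] with ω h h'
    rwa [abs_of_nonneg h]), ?_⟩
  have e : (fun ω => D • (fun ω => (l ω / D) • X ω) ω) = fun ω => l ω • X ω := by
    ext ω i
    simp only [Pi.smul_apply, smul_eq_mul]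
    field_simp
  rw [e] at h2
  rw [h2]
  refine ⟨zero_mem_MElig, 0, ?_, Filter.Eventually.of_forall fun _ => by simp⟩
  convert h1 using 2 <;> simp

theorem IsClosedCoherentVec.zero_mem_acc : (0 : Ω → Fin d → ℝ) ∈ accVec P G R :=
  ⟨zero_mem_LInf, hR.zero_mem⟩

theorem IsClosedCoherentVec.acc_add {X Y : Ω → Fin d → ℝ} (hX : X ∈ accVec P G R)
    (hY : Y ∈ accVec P G R) (hFG : F ≤ G) : X + Y ∈ accVec P G R := by
  have h1 := hR.condConvex X hX.1 Y hY.1 (fun _ => 1 / 2) measurable_const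
    (Filter.Eventually.of_forall fun _ => by norm_num) 0 hX.2 0 hY.2
  have h2 : (fun ω => (1 / 2 : ℝ) • X ω + (1 - 1 / 2 : ℝ) • Y ω) ∈ accVec P G R :=
    ⟨add_mem_LInf (const_smul_mem_LInf hX.1 _) (const_smul_mem_LInf hY.1 _), by convert h1 using 2; simp⟩
  have h3 := hR.acc_smul_fun h2 (l := fun _ => 2) measurable_const
    (Filter.Eventually.of_forall fun _ => by norm_num) (Filter.Eventually.of_forall fun _ => le_rfl)
    hFG
  convert h3 using 1
  ext ω i
  simp only [Pi.add_apply, Pi.smul_apply, smul_eq_mul]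
  ring

theorem IsClosedCoherentVec.acc_of_nonneg {X : Ω → Fin d → ℝ} (hX : X ∈ LInf P G d)
    (h : ∀ᵐ ω ∂P, ∀ i, 0 ≤ X ω i) : X ∈ accVec P G R :=
  ⟨hX, hR.monotone 0 zero_mem_LInf X hX h hR.zero_mem⟩

/-- The acceptance set is the slice of the closed graph at the portfolio zero. -/
theorem IsClosedCoherentVec.isClosed_acc :
    IsClosed[weakStar P G (LInf P G d)] (Subtype.val ⁻¹' accVec P G R) := by
  let t1 : TopologicalSpace (LInf P G d) := weakStar P G (LInf P G d)
  let t2 : TopologicalSpace (MElig P F d m) := weakStar P F (MElig P F d m)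
  have hc : Continuous fun x : LInf P G d => (x, (⟨0, zero_mem_MElig⟩ : MElig P F d m)) :=
    Continuous.prodMk continuous_id continuous_const
  have h := hR.closedGraph.preimage hc
  convert h using 1
  ext x
  simp [accVec]

/-- Separation of a position that is not acceptable. -/
theorem IsClosedCoherentVec.exists_separating [IsProbabilityMeasure P] (hFG : F ≤ G) (hG : G ≤ m0)
    {Y : Ω → Fin d → ℝ} (hY : Y ∈ LInf P G d) (hYA : Y ∉ accVec P G R) :
    ∃ Z ∈ LOnePos P G d, Z ∈ dualCone P G (accVec P G R) ∧ pairing P Z Y < 0 ∧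
      ∃ u ∈ MElig P F d m, pairing P Z u ≠ 0 := by
  -- This non-acceptable portfolio is the second point of the separation lemma: the functional will
  -- not vanish on it, hence will not lie in `M^⊥`.
  obtain ⟨u, hu, hu0⟩ := hR.finiteAtZero.exists_notMem
  have huA : u ∉ accVec P G R := fun h => hu0 <|
    (hR.mem_iff hFG zero_mem_LInf hu).2 (by rwa [zero_add])
  obtain ⟨Z, hZ, hZA, hZY, hZu⟩ := exists_pair_separating_ne_zero (pair := pairing P)
    (fun X hX => hX.1) hR.isClosed_acc hR.zero_mem_acc (fun x hx y hy => hR.acc_add hx hy hFG)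
    (fun c hc x hx => hR.acc_smul_fun hx (l := fun _ => c) measurable_const
      (Filter.Eventually.of_forall fun _ => hc.le) (Filter.Eventually.of_forall fun _ => le_rfl)
      hFG)
    (fun Z hZ X hX Y hY => pairing_add hG hZ hX hY) (fun Z _ c X _ => pairing_smul Z X c)
    (pairing_combination hG) hY hYA (mono_mem_LInf hFG hu.1) huA
  refine ⟨Z, ⟨hZ, ?_⟩, ⟨hZ, hZA⟩, hZY, u, hu, hZu⟩
  refine ae_all_iff.2 fun i => ae_nonneg_of_setIntegral_nonneg hG (measurable_coord hZ.1 i)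
    (hZ.2 i) fun A hA => ?_
  -- A non-negative position is acceptable; pairing with an indicator times a unit vector tests the
  -- sign of one component of `Z` on one event.
  have h1 : (fun ω => A.indicator (fun _ => (1 : ℝ)) ω • Pi.single i (1 : ℝ)) ∈ accVec P G R := by
    refine hR.acc_of_nonneg ⟨(measurable_const.indicator hA).smul_const _, 1,
      Filter.Eventually.of_forall fun ω j => ?_⟩ (Filter.Eventually.of_forall fun ω j => ?_)
    · by_cases h : ω ∈ A <;> by_cases hj : j = i <;> simp [h, hj]
    · by_cases h : ω ∈ A <;> by_cases hj : j = i <;> simp [h, hj]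
  have h2 := hZA _ h1
  rw [pairing_indicator hG Z (fun _ => Pi.single i (1 : ℝ)) hA] at h2
  simpa using h2

/-- The acceptance set is stable under `1_A` for `A` in `F`, so non-negativity of the pairing holds
on every such event. This is the passage from scalar to conditional inequalities. -/
theorem IsClosedCoherentVec.setIntegral_nonneg (hFG : F ≤ G) (hG : G ≤ m0) {Z Y : Ω → Fin d → ℝ}
    (hZ : Z ∈ dualCone P G (accVec P G R)) (hY : Y ∈ accVec P G R) {A : Set Ω}
    (hA : MeasurableSet[F] A) : 0 ≤ ∫ ω in A, Z ω ⬝ᵥ Y ω ∂P := by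
  rw [← pairing_indicator (hFG.trans hG) Z Y hA]
  refine hZ.2 _ (hR.acc_smul_fun hY (measurable_const.indicator hA) (C := 1) ?_ ?_ hFG)
  · exact Filter.Eventually.of_forall fun ω => indicator_nonneg (fun _ _ => zero_le_one) _
  · exact Filter.Eventually.of_forall fun ω =>
      indicator_le_self' (f := fun _ => (1 : ℝ)) (fun _ _ => zero_le_one) _

/-- Dual representation of a closed coherent risk measure whose domain is `L^∞(F)`. -/
theorem repRestr_of_subset [IsProbabilityMeasure P] (hGF : G = F) (hF : F ≤ m0)
    {W : Set (Ω → Fin d → ℝ)} (hW : W ⊆ dualRestrMax P F m R)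
    (hW' : {w | w ∈ dualRestrMax P F m R ∧ w ∉ MPerp P F d m} ⊆ W) : RepRestr P F m R W := by
  subst hGF
  intro X hX
  ext u
  simp only [mem_inter_iff, mem_iInter]
  constructor
  · intro hu
    have huM := (hR.upper X hX).1 hu
    refine ⟨huM, fun w hw => ⟨⟨-X, rfl, X + u, ⟨add_mem_LInf hX huM.1, ?_⟩, neg_add_cancel_left _ _⟩, huM⟩⟩
    have hw' := hW hw
    refine ae_nonneg_of_setIntegral_nonneg hF ?_ (integrable_dot hF hw'.2.1.1.2
      (add_mem_LInf hX huM.1)) fun A hA => hR.setIntegral_nonneg le_rfl hF hw'.2.2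
        ((hR.mem_iff le_rfl hX huM).1 hu) hA
    exact Finset.measurable_sum _ fun i _ => (measurable_coord hw'.2.1.1.1 i).mul
      (measurable_coord (add_mem_LInf hX huM.1).1 i)
  · rintro ⟨huM, hall⟩
    by_contra huR
    obtain ⟨Z, hZ, hZA, hZY, v, hv, hZv⟩ := hR.exists_separating le_rfl hF (add_mem_LInf hX huM.1)
      (fun h => huR ((hR.mem_iff le_rfl hX huM).2 h))
    -- With equal σ-algebras no density is needed: the separating functional is itself the weight.
    have hZW : Z ∈ W := hW' ⟨⟨mem_dualCone_MPos hZ.1 hZ.2, hZ, hZA⟩, fun h => hZv (h.2 v hv)⟩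
    obtain ⟨⟨_, rfl, g, hg, he⟩, -⟩ := hall Z hZW
    have : X + u = g := by rw [← he]; simp
    rw [this] at hZY
    exact absurd (integral_nonneg_of_ae hg.2) (not_le.2 hZY)

end CoherentVec

/-! ### Vectors of measures and the dual representation on the full σ-algebra -/

section CondExpVec

variable {Ω : Type*} {F G m0 : MeasurableSpace Ω} {P : Measure Ω} [IsProbabilityMeasure P]
  {d m : ℕ} {Q : Fin d → Measure Ω}

theorem measurable_condQ {Q : Measure Ω} {y : Ω → ℝ} : Measurable[F] (condQ P F Q y) :=
  measurable_condExp'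

theorem measurable_dot_condQVec {w Y : Ω → Fin d → ℝ} (hw : Measurable[F] w) :
    Measurable[F] fun ω => w ω ⬝ᵥ condQVec P F Q Y ω :=
  Finset.measurable_sum _ fun i _ => (measurable_coord hw i).mul measurable_condQ

theorem integrable_dot_condQVec (hF : F ≤ m0) (hG : G ≤ m0) (hQ : ∀ i, Q i ∈ probOn P F)
    {w Y : Ω → Fin d → ℝ} (hw : ∀ i, Integrable (fun ω => w ω i) P) (hY : Y ∈ LInf P G d) :
    Integrable (fun ω => w ω ⬝ᵥ condQVec P F Q Y ω) P := by
  obtain ⟨C, hC⟩ := exists_bound_of_mem_LInf hY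
  exact integrable_finsetSum _ fun i _ => integrable_mul_condQ hF (hQ i) (hw i)
    ((measurable_coord hY.1 i).mono hG le_rfl) (hC i)

theorem setIntegral_dot_condQVec (hFG : F ≤ G) (hG : G ≤ m0) (hQ : ∀ i, Q i ∈ probOn P F)
    {w Y : Ω → Fin d → ℝ} (hw : w ∈ LOne P F d)
    (hwx : ∀ i, Integrable (fun ω => wTrans P F G Q w ω i) P) (hY : Y ∈ LInf P G d) {A : Set Ω}
    (hA : MeasurableSet[F] A) :
    ∫ ω in A, wTrans P F G Q w ω ⬝ᵥ Y ω ∂P = ∫ ω in A, w ω ⬝ᵥ condQVec P F Q Y ω ∂P := by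
  obtain ⟨C, hC⟩ := exists_bound_of_mem_LInf hY
  have hF := hFG.trans hG
  simp only [dotProduct, condQVec]
  rw [integral_finsetSum _ fun i _ => Integrable.integrableOn (integrable_mul_of_bound (hwx i)
      ((measurable_coord hY.1 i).mono hG le_rfl).aestronglyMeasurable (hC i)),
    integral_finsetSum _ fun i _ => Integrable.integrableOn (integrable_mul_condQ hF (hQ i) (hw.2 i)
      ((measurable_coord hY.1 i).mono hG le_rfl) (hC i))]
  exact Finset.sum_congr rfl fun i _ => setIntegral_mul_condQ hFG hG (hQ i)
    (measurable_coord hw.1 i) (hwx i) (measurable_coord hY.1 i) (hC i) hA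

theorem pairing_wTrans (hFG : F ≤ G) (hG : G ≤ m0) (hQ : ∀ i, Q i ∈ probOn P F)
    {w Y : Ω → Fin d → ℝ} (hw : w ∈ LOne P F d)
    (hwx : ∀ i, Integrable (fun ω => wTrans P F G Q w ω i) P) (hY : Y ∈ LInf P G d) :
    pairing P (wTrans P F G Q w) Y = pairing P w (condQVec P F Q Y) := by
  have := setIntegral_dot_condQVec hFG hG hQ hw hwx hY MeasurableSet.univ
  simpa only [pairing, setIntegral_univ] using this

theorem integrable_xi_mul (hF : F ≤ m0) {Q : Measure Ω} (hQ : Q ∈ probOn P F) {y : Ω → ℝ} {C : ℝ}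
    (hy : Measurable y) (hC : ∀ᵐ ω ∂P, |y ω| ≤ C) : Integrable (fun ω => xi P F m0 Q ω * y ω) P :=
  integrable_mul_of_bound ((integrable_dens hQ.1).congr (xi_self_ae_eq hF hQ).symm)
    hy.aestronglyMeasurable hC

theorem condQVec_neg (X : Ω → Fin d → ℝ) :
    ∀ᵐ ω ∂P, ∀ i, condQVec P F Q (-X) ω i = -condQVec P F Q X ω i := by
  refine ae_all_iff.2 fun i => ?_
  have h := condExp_neg (μ := P) (fun ω => xi P F m0 (Q i) ω * X ω i) F
  refine Filter.EventuallyEq.trans (condExp_congr_ae (Filter.Eventually.of_forall fun ω => ?_)) h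
  simp

/-- An `F`-measurable vector leaves the conditional expectation because the conditional density has
mean one given `F`. -/
theorem condQVec_add (hF : F ≤ m0) (hG : G ≤ m0) (hQ : ∀ i, Q i ∈ probOn P F)
    {X u : Ω → Fin d → ℝ} (hX : X ∈ LInf P G d) (hu : u ∈ LInf P F d) :
    ∀ᵐ ω ∂P, ∀ i, condQVec P F Q (X + u) ω i = condQVec P F Q X ω i + u ω i := by
  obtain ⟨C, hC⟩ := exists_bound_of_mem_LInf hX
  obtain ⟨D, hD⟩ := exists_bound_of_mem_LInf hu
  refine ae_all_iff.2 fun i => ?_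
  have hu' := integrable_xi_mul hF (hQ i) ((measurable_coord hu.1 i).mono hF le_rfl) (hD i)
  have h := condExp_add (integrable_xi_mul hF (hQ i)
    ((measurable_coord hX.1 i).mono hG le_rfl) (hC i)) hu' F
  have h2 := condExp_mul_of_stronglyMeasurable_right (m := F)
    (measurable_coord hu.1 i).stronglyMeasurable hu'
    ((integrable_dens (hQ i).1).congr (xi_self_ae_eq hF (hQ i)).symm)
  have h3 := (condExp_congr_ae (xi_self_ae_eq hF (hQ i))).trans (condExp_dens hF (hQ i))
  have h4 : condQ P F (Q i) (fun ω => (X + u) ω i) =ᵐ[P]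
      P[(fun ω => xi P F m0 (Q i) ω * X ω i) + fun ω => xi P F m0 (Q i) ω * u ω i | F] :=
    condExp_congr_ae (Filter.Eventually.of_forall fun ω => by simp [mul_add])
  filter_upwards [h, h2, h3, h4] with ω a b c e
  simp only [condQVec]
  rw [e, a, Pi.add_apply]
  congr 1
  refine b.trans ?_
  rw [Pi.mul_apply, c, one_mul]

theorem condQVec_of_measurable (hF : F ≤ m0) (hQ : ∀ i, Q i ∈ probOn P F)
    {u : Ω → Fin d → ℝ} (hu : u ∈ LInf P F d) :
    ∀ᵐ ω ∂P, ∀ i, condQVec P F Q u ω i = u ω i := by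
  filter_upwards [condQVec_add hF hF hQ zero_mem_LInf hu] with ω h i
  have h0 : condQVec P F Q (0 : Ω → Fin d → ℝ) ω i = 0 := by
    simp only [condQVec, condQ, Pi.zero_apply, mul_zero]
    exact congrFun (condExp_zero (μ := P) (E := ℝ) (m := F)) ω
  have := h i
  rwa [zero_add, h0, zero_add] at this

theorem pairing_wTrans_of_measurable (hFG : F ≤ G) (hG : G ≤ m0) (hQ : ∀ i, Q i ∈ probOn P F)
    {w u : Ω → Fin d → ℝ} (hw : w ∈ LOne P F d)
    (hwx : ∀ i, Integrable (fun ω => wTrans P F G Q w ω i) P) (hu : u ∈ LInf P F d) :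
    pairing P (wTrans P F G Q w) u = pairing P w u := by
  rw [pairing_wTrans hFG hG hQ hw hwx (mono_mem_LInf hFG hu)]
  refine integral_congr_ae ?_
  filter_upwards [condQVec_of_measurable (hFG.trans hG) hQ hu] with ω h
  rw [funext h]

theorem dot_condQVec_add (hF : F ≤ m0) (hG : G ≤ m0) (hQ : ∀ i, Q i ∈ probOn P F)
    {X u : Ω → Fin d → ℝ} (w : Ω → Fin d → ℝ) (hX : X ∈ LInf P G d) (hu : u ∈ LInf P F d) :
    ∀ᵐ ω ∂P, w ω ⬝ᵥ condQVec P F Q (X + u) ω = w ω ⬝ᵥ u ω - w ω ⬝ᵥ condQVec P F Q (-X) ω := by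
  filter_upwards [condQVec_add hF hG hQ hX hu, condQVec_neg (P := P) (F := F) (Q := Q) X]
    with ω h1 h2
  rw [show condQVec P F Q (X + u) ω = u ω - condQVec P F Q (-X) ω from funext fun i => by
    rw [h1 i, Pi.sub_apply, h2 i]; ring, dotProduct_sub]

/-- Factorizing each component separately shows that every non-negative integrable functional arises
from a vector of measures and a weight, so that separating functionals are dual variables. -/
theorem exists_wTrans_eq (hFG : F ≤ G) (hG : G ≤ m0) {Z : Ω → Fin d → ℝ}
    (hZ : Z ∈ LOnePos P G d) : ∃ (Q : Fin d → Measure Ω) (w : Ω → Fin d → ℝ),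
    (∀ i, Q i ∈ probOn P F) ∧ w ∈ LOnePos P F d ∧ wTrans P F G Q w =ᵐ[P] Z ∧
      wTrans P F G Q w ∈ LOnePos P G d := by
  have hZ0 := ae_all_iff.1 hZ.2
  choose Q hQ h using fun i => exists_mul_xi_eq (P := P) hFG hG (measurable_coord hZ.1.1 i)
    (hZ.1.2 i) (hZ0 i)
  have hw : (fun ω i => P[fun ω => Z ω i | F] ω) ∈ LOnePos P F d :=
    ⟨⟨@measurable_pi_lambda _ _ _ F _ _ fun i => measurable_condExp',
      fun i => integrable_condExp⟩, ae_all_iff.2 fun i => condExp_nonneg (hZ0 i)⟩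
  have he : wTrans P F G Q (fun ω i => P[fun ω => Z ω i | F] ω) =ᵐ[P] Z :=
    (ae_all_iff.2 h).mono fun ω h => funext h
  refine ⟨Q, _, hQ, hw, he, ⟨@measurable_pi_lambda _ _ _ G _ _ fun i =>
    ((measurable_coord hw.1.1 i).mono hFG le_rfl).mul (measurable_xi hFG),
    fun i => (hZ.1.2 i).congr (he.mono fun ω h => by simp only [h])⟩, ?_⟩
  filter_upwards [he, hZ.2] with ω h h' i
  rw [h]; exact h' i

/-- Dual representation of a closed coherent risk measure on `L^∞`. -/
theorem repVec_of_subset {R : (Ω → Fin d → ℝ) → Set (Ω → Fin d → ℝ)}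
    (hR : IsClosedCoherentVec P m0 F m R) (hF : F ≤ m0)
    {W : Set ((Fin d → Measure Ω) × (Ω → Fin d → ℝ))} (hW : W ⊆ dualVecMax P F m R)
    (hW' : {p | p ∈ dualVecMax P F m R ∧ p.2 ∉ MPerp P F d m} ⊆ W) : RepVec P F m R W := by
  intro X hX
  ext u
  simp only [mem_inter_iff, mem_iInter]
  constructor
  · intro hu
    have huM := (hR.upper X hX).1 hu
    refine ⟨huM, fun p hp => ⟨⟨condQVec P F p.1 (-X), rfl, u - condQVec P F p.1 (-X), ⟨?_, ?_⟩,
      add_sub_cancel _ _⟩, huM⟩⟩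
    · refine sub_mem_LInf huM.1 ⟨@measurable_pi_lambda _ _ _ F _ _ fun i => measurable_condQ, ?_⟩
      obtain ⟨C, hC⟩ := exists_bound_of_mem_LInf (neg_mem_LInf hX)
      exact ⟨C, ae_all_iff.2 fun i => condQ_bound hF ((hW hp).1.1 i)
        (measurable_coord (neg_mem_LInf hX).1 i) (hC i)⟩
    · have hp' := hW hp
      have hXu := add_mem_LInf hX (mono_mem_LInf hF huM.1)
      -- Sign on every event of `F` gives the conditional inequality for `X + u`; splitting off `u`
      -- then yields membership in the half-space.
      have h1 := ae_nonneg_of_setIntegral_nonneg hF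
        (measurable_dot_condQVec (P := P) (Q := p.1) (Y := X + u) hp'.1.2.1.1.1)
        (integrable_dot_condQVec hF le_rfl hp'.1.1 hp'.1.2.1.1.2 hXu) fun A hA => by
          rw [← setIntegral_dot_condQVec hF le_rfl hp'.1.1 hp'.1.2.1.1 hp'.1.2.2.1.2 hXu hA]
          exact hR.setIntegral_nonneg hF le_rfl hp'.2 ((hR.mem_iff hF hX huM).1 hu) hA
      filter_upwards [h1, dot_condQVec_add hF le_rfl hp'.1.1 p.2 hX huM.1] with ω a b
      rw [Pi.sub_apply, dotProduct_sub, ← b]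
      exact a
  · rintro ⟨huM, hall⟩
    by_contra huR
    have hXu := add_mem_LInf hX (mono_mem_LInf hF huM.1)
    obtain ⟨Z, hZ, hZA, hZY, v, hv, hZv⟩ := hR.exists_separating hF le_rfl hXu
      (fun h => huR ((hR.mem_iff hF hX huM).2 h))
    obtain ⟨Q, w, hQ, hw, he, hwT⟩ := exists_wTrans_eq (P := P) hF le_rfl hZ
    have hmem : (Q, w) ∈ W := by
      refine hW' ⟨⟨⟨hQ, mem_dualCone_MPos hw.1 hw.2, hwT⟩, hwT.1, fun c hc => ?_⟩, fun h => hZv ?_⟩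
      · rw [pairing_congr he]; exact hZA.2 c hc
      -- On `F`-measurable portfolios `Z` acts through its weight alone, so non-vanishing of `Z` at
      -- `v` is non-vanishing of `w`.
      · rw [← pairing_congr he, pairing_wTrans_of_measurable hF le_rfl hQ hw.1 hwT.1.2 hv.1]
        exact h.2 v hv
    obtain ⟨⟨_, rfl, g, hg, hge⟩, -⟩ := hall _ hmem
    rw [← pairing_congr he, pairing_wTrans hF le_rfl hQ hw.1 hwT.1.2 hXu] at hZY
    refine absurd (integral_nonneg_of_ae ?_) (not_le.2 hZY)
    filter_upwards [hg.2, dot_condQVec_add hF le_rfl hQ w hX huM.1] with ω a b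
    rw [b, ← dotProduct_sub]
    have : u ω - condQVec P F Q (-X) ω = g ω := by rw [← hge]; simp
    rw [this]; exact a

end CondExpVec

/-! ### Acceptance sets and dual representation of risk measures for processes -/

section CoherentProc

variable {Ω : Type*} {mΩ : MeasurableSpace Ω} {P : Measure Ω} {T d m : ℕ}
  {ℱ : Filtration (Fin (T + 1)) mΩ} {t : Fin (T + 1)}
  {ρ : (Fin (T + 1) → Ω → Fin d → ℝ) → Set (Ω → Fin d → ℝ)}

theorem sum_eq_sum_Ici {M : Type*} [AddCommMonoid M] {f : Fin (T + 1) → M}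
    (h : ∀ s < t, f s = 0) : ∑ s, f s = ∑ s : Ici t, f s := by
  rw [← Finset.sum_subtype (Finset.univ.filter (t ≤ ·)) (by simp) f, Finset.sum_filter]
  exact Finset.sum_congr rfl fun s _ => by
    split_ifs with hs
    · rfl
    · exact h s (not_le.1 hs)

theorem zero_mem_ProcInf : (0 : Fin (T + 1) → Ω → Fin d → ℝ) ∈ ProcInf P ℱ d t :=
  ⟨fun _ => zero_mem_LInf, fun _ _ => rfl⟩

theorem add_mem_ProcInf {X Y : Fin (T + 1) → Ω → Fin d → ℝ} (hX : X ∈ ProcInf P ℱ d t)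
    (hY : Y ∈ ProcInf P ℱ d t) : X + Y ∈ ProcInf P ℱ d t :=
  ⟨fun s => add_mem_LInf (hX.1 s) (hY.1 s), fun s hs => by simp [hX.2 s hs, hY.2 s hs]⟩

theorem smul_fun_mem_ProcInf {X : Fin (T + 1) → Ω → Fin d → ℝ} (hX : X ∈ ProcInf P ℱ d t)
    {l : Ω → ℝ} (hl : Measurable[ℱ t] l) {C : ℝ} (hC : ∀ᵐ ω ∂P, |l ω| ≤ C) :
    (fun s ω => l ω • X s ω) ∈ ProcInf P ℱ d t := by
  refine ⟨fun s => ?_, fun s hs => by simp [hX.2 s hs]; rfl⟩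
  by_cases hs : t ≤ s
  · exact smul_fun_mem_LInf (hX.1 s) (hl.mono (ℱ.mono hs) le_rfl) hC
  · have : (fun ω => l ω • X s ω) = 0 := by ext; simp [hX.2 s (not_le.1 hs)]
    exact mem_of_eq_of_mem this zero_mem_LInf

theorem constFrom_mem_ProcInf {u : Ω → Fin d → ℝ} (hu : u ∈ LInf P (ℱ t) d) :
    constFrom t u ∈ ProcInf P ℱ d t := by
  refine ⟨fun s => ?_, fun s hs => if_neg (not_le.2 hs)⟩
  simp only [constFrom]
  split_ifs with h
  · exact mono_mem_LInf (ℱ.mono h) hu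
  · exact zero_mem_LInf

theorem incr_mem_LOne {a : Fin (T + 1) → Ω → Fin d → ℝ} (ha : a ∈ ProcOne P ℱ d t)
    (s : Fin (T + 1)) : incr a s ∈ LOne P (ℱ s) d := by
  refine ⟨(ha.1 s).sub ?_, ha.2.1 s⟩
  split_ifs
  · exact measurable_const
  · exact (ha.1 _).mono (ℱ.mono (Fin.mk_le_of_le_val (by omega))) le_rfl

theorem procPairing_eq_sum {a X : Fin (T + 1) → Ω → Fin d → ℝ}
    (ha : ∀ s i, Integrable (fun ω => incr a s ω i) P) (hX : ∀ s, X s ∈ LInf P (ℱ s) d) :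
    procPairing P a X = ∑ s, pairing P (incr a s) (X s) :=
  integral_finsetSum _ fun s _ => integrable_dot (ℱ.le s) (ha s) (hX s)

/-- Partial sums invert the increment operator, so the dual space of processes is freely
parametrized by integrable adapted increments from `t` on. -/
theorem exists_incr_eq {Y : Fin (T + 1) → Ω → Fin d → ℝ} (hY : ∀ s, Y s ∈ LOne P (ℱ s) d)
    (hY0 : ∀ s < t, Y s = 0) : ∃ a ∈ ProcOne P ℱ d t, ∀ s, incr a s = Y s := by
  let a : Fin (T + 1) → Ω → Fin d → ℝ := fun s => ∑ r ∈ Finset.Iic s, Y r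
  have hinc : ∀ s, incr a s = Y s := by
    intro s
    simp only [incr, a]
    split_ifs with h
    · have hs : s = 0 := Fin.ext h
      subst hs
      have : Finset.Iic (0 : Fin (T + 1)) = {0} := by
        ext x; simp only [Finset.mem_Iic, Finset.mem_singleton]; exact Fin.le_zero_iff
      rw [this]; simp
    · have : Finset.Iic s = insert s (Finset.Iic (⟨s.val - 1, by omega⟩ : Fin (T + 1))) := by
        ext x
        simp only [Finset.mem_Iic, Finset.mem_insert, Fin.ext_iff, Fin.le_def]
        omega
      rw [this, Finset.sum_insert (by
        simp only [Finset.mem_Iic, Fin.le_def]; omega), add_sub_cancel_right]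
  refine ⟨a, ⟨fun s => ?_, fun s i => ?_, fun s hs => ?_⟩, hinc⟩
  · have : a s = fun ω => ∑ r ∈ Finset.Iic s, Y r ω := by ext; simp [a]
    rw [this]
    exact Finset.measurable_sum _ fun r hr =>
      (hY r).1.mono (ℱ.mono (Finset.mem_Iic.1 hr)) le_rfl
  · rw [hinc]; exact (hY s).2 i
  · exact Finset.sum_eq_zero fun r hr => hY0 r ((Finset.mem_Iic.1 hr).trans_lt hs)

theorem incr_combination (c : ProcOne P ℱ d t →₀ ℝ) : ∃ b ∈ ProcOne P ℱ d t,
    ∀ x ∈ ProcInf P ℱ d t, procPairing P b x = c.sum fun b' r => r * procPairing P b' x := by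
  induction c using Finsupp.induction_linear with
  | zero =>
    refine ⟨0, ⟨fun _ => measurable_const, fun s i => ?_, fun _ _ => rfl⟩, fun x _ => ?_⟩ <;>
    simp [incr, procPairing]
  | add f g hf hg =>
    obtain ⟨b, hb, h⟩ := hf
    obtain ⟨b', hb', h'⟩ := hg
    have hi : ∀ s, incr (b + b') s = incr b s + incr b' s := fun s => by
      simp only [incr, Pi.add_apply]
      split_ifs
      · simp
      · abel
    have hm : b + b' ∈ ProcOne P ℱ d t := ⟨fun s => (hb.1 s).add (hb'.1 s), fun s i => by
      rw [hi]; exact (hb.2.1 s i).add (hb'.2.1 s i), fun s hs => by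
        simp [hb.2.2 s hs, hb'.2.2 s hs]⟩
    refine ⟨b + b', hm, fun x hx => ?_⟩
    rw [Finsupp.sum_add_index' (by simp) (by intros; ring), ← h x hx, ← h' x hx,
      procPairing_eq_sum hm.2.1 hx.1, procPairing_eq_sum hb.2.1 hx.1,
      procPairing_eq_sum hb'.2.1 hx.1, ← Finset.sum_add_distrib]
    refine Finset.sum_congr rfl fun s _ => ?_
    simp only [pairing, hi, Pi.add_apply, add_dotProduct]
    exact integral_add (integrable_dot (ℱ.le s) (hb.2.1 s) (hx.1 s))
      (integrable_dot (ℱ.le s) (hb'.2.1 s) (hx.1 s))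
  | single b r =>
    have hi : ∀ s, incr (r • (b : Fin (T + 1) → Ω → Fin d → ℝ)) s = r • incr b s := fun s => by
      simp only [incr, Pi.smul_apply]
      split_ifs
      · simp
      · rw [smul_sub]
    have hm : r • (b : Fin (T + 1) → Ω → Fin d → ℝ) ∈ ProcOne P ℱ d t :=
      ⟨fun s => (b.2.1 s).const_smul r, fun s i => by
        rw [hi]; exact (b.2.2.1 s i).const_mul r, fun s hs => by simp [b.2.2.2 s hs]⟩
    refine ⟨_, hm, fun x _ => ?_⟩
    rw [Finsupp.sum_single_index (by simp)]
    simp only [procPairing, hi, Pi.smul_apply, smul_dotProduct, smul_eq_mul, ← Finset.mul_sum]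
    exact integral_const_mul _ _

theorem IsProcRisk.mem_iff (hρ : IsProcRisk P ℱ m t ρ) {X : Fin (T + 1) → Ω → Fin d → ℝ}
    (hX : X ∈ ProcInf P ℱ d t) {u : Ω → Fin d → ℝ} (hu : u ∈ MElig P (ℱ t) d m) :
    u ∈ ρ X ↔ X + constFrom t u ∈ accProc P ℱ t ρ := by
  simp only [accProc, mem_ofPred_eq, add_mem_ProcInf hX (constFrom_mem_ProcInf hu.1), true_and,
    hρ.cashInvariant X hX u hu, mem_image, sub_eq_zero, exists_eq_right]

variable (hρ : IsClosedCoherentProc P ℱ m t ρ)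
include hρ

theorem IsClosedCoherentProc.zero_mem : (0 : Ω → Fin d → ℝ) ∈ ρ 0 := by
  refine hρ.finiteAtZero.zero_mem fun c hc u hu => ?_
  have h := hρ.condPosHom 0 zero_mem_ProcInf (fun _ => c) measurable_const
    (Filter.Eventually.of_forall fun _ => hc) ⟨c, Filter.Eventually.of_forall fun _ => le_rfl⟩
  have e : (fun s (ω : Ω) => c • (0 : Fin (T + 1) → Ω → Fin d → ℝ) s ω) = 0 := by ext; simp
  rw [e] at h
  rw [h]
  exact ⟨smul_fun_mem_MElig ((hρ.upper 0 zero_mem_ProcInf).1 hu) (l := fun _ => c) measurable_const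
    (Filter.Eventually.of_forall fun _ => le_rfl), u, hu, Filter.Eventually.of_forall fun _ => rfl⟩

theorem IsClosedCoherentProc.acc_smul_fun {X : Fin (T + 1) → Ω → Fin d → ℝ}
    (hX : X ∈ accProc P ℱ t ρ) {l : Ω → ℝ} (hl : Measurable[ℱ t] l) (hl0 : ∀ᵐ ω ∂P, 0 ≤ l ω)
    {C : ℝ} (hC : ∀ᵐ ω ∂P, l ω ≤ C) : (fun s ω => l ω • X s ω) ∈ accProc P ℱ t ρ := by
  have hD : 0 < max C 1 := lt_max_of_lt_right one_pos
  set D := max C 1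
  have h1 := hρ.condConvex X hX.1 0 zero_mem_ProcInf (fun ω => l ω / D) (hl.div_const D) (by
    filter_upwards [hl0, hC] with ω h h'
    exact ⟨div_nonneg h hD.le, (div_le_one hD).2 (h'.trans (le_max_left _ _))⟩) 0 hX.2 0 hρ.zero_mem
  have h2 := hρ.condPosHom (fun s ω => (l ω / D) • X s ω)
    (smul_fun_mem_ProcInf hX.1 (hl.div_const D) (C := 1) (by
      filter_upwards [hl0, hC] with ω h h'
      rw [abs_of_nonneg (div_nonneg h hD.le)]
      exact (div_le_one hD).2 (h'.trans (le_max_left _ _))))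
    (fun _ => D) measurable_const
    (Filter.Eventually.of_forall fun _ => hD) ⟨D, Filter.Eventually.of_forall fun _ => le_rfl⟩
  refine ⟨smul_fun_mem_ProcInf hX.1 hl (C := C) (by
    filter_upwards [hl0, hC] with ω h h'
    rwa [abs_of_nonneg h]), ?_⟩
  have e : (fun s ω => D • (fun s ω => (l ω / D) • X s ω) s ω) = fun s ω => l ω • X s ω := by
    ext s ω i
    simp only [Pi.smul_apply, smul_eq_mul]
    field_simp
  rw [e] at h2
  rw [h2]
  refine ⟨zero_mem_MElig, 0, ?_, Filter.Eventually.of_forall fun _ => by simp⟩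
  convert h1 using 2 <;> simp

theorem IsClosedCoherentProc.zero_mem_acc :
    (0 : Fin (T + 1) → Ω → Fin d → ℝ) ∈ accProc P ℱ t ρ :=
  ⟨zero_mem_ProcInf, hρ.zero_mem⟩

theorem IsClosedCoherentProc.acc_const_smul {X : Fin (T + 1) → Ω → Fin d → ℝ}
    (hX : X ∈ accProc P ℱ t ρ) {c : ℝ} (hc : 0 ≤ c) : c • X ∈ accProc P ℱ t ρ :=
  hρ.acc_smul_fun hX (l := fun _ => c) measurable_const
    (Filter.Eventually.of_forall fun _ => hc) (Filter.Eventually.of_forall fun _ => le_rfl)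

theorem IsClosedCoherentProc.acc_add {X Y : Fin (T + 1) → Ω → Fin d → ℝ}
    (hX : X ∈ accProc P ℱ t ρ) (hY : Y ∈ accProc P ℱ t ρ) : X + Y ∈ accProc P ℱ t ρ := by
  have h1 := hρ.condConvex X hX.1 Y hY.1 (fun _ => 1 / 2) measurable_const
    (Filter.Eventually.of_forall fun _ => by norm_num) 0 hX.2 0 hY.2
  have h2 : (fun s ω => (1 / 2 : ℝ) • X s ω + (1 - 1 / 2 : ℝ) • Y s ω) ∈ accProc P ℱ t ρ := by
    refine ⟨add_mem_ProcInf (smul_fun_mem_ProcInf hX.1 (l := fun _ => 1 / 2) measurable_const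
      (Filter.Eventually.of_forall fun _ => le_rfl)) (smul_fun_mem_ProcInf hY.1
      (l := fun _ => 1 - 1 / 2) measurable_const
      (Filter.Eventually.of_forall fun _ => le_rfl)), by convert h1 using 2; simp⟩
  have h3 := hρ.acc_const_smul h2 (zero_le_two (α := ℝ))
  convert h3 using 1
  ext s ω i
  simp only [Pi.add_apply, Pi.smul_apply, smul_eq_mul]
  ring

theorem IsClosedCoherentProc.acc_of_nonneg {X : Fin (T + 1) → Ω → Fin d → ℝ}
    (hX : X ∈ ProcInf P ℱ d t) (h : ∀ s, ∀ᵐ ω ∂P, ∀ i, 0 ≤ X s ω i) : X ∈ accProc P ℱ t ρ :=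
  ⟨hX, hρ.monotone 0 zero_mem_ProcInf X hX h hρ.zero_mem⟩

theorem IsClosedCoherentProc.isClosed_acc :
    IsClosed[procTop P ℱ d t] (Subtype.val ⁻¹' accProc P ℱ t ρ) := by
  let t1 : TopologicalSpace (ProcInf P ℱ d t) := procTop P ℱ d t
  let t2 : TopologicalSpace (MElig P (ℱ t) d m) := weakStar P (ℱ t) (MElig P (ℱ t) d m)
  have hc : Continuous fun x : ProcInf P ℱ d t =>
      (x, (⟨0, zero_mem_MElig⟩ : MElig P (ℱ t) d m)) :=
    Continuous.prodMk continuous_id continuous_const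
  have h := hρ.closedGraph.preimage hc
  convert h using 1
  ext x
  simp [accProc]

/-- Separation of a process that is not acceptable. -/
theorem IsClosedCoherentProc.exists_separating [IsProbabilityMeasure P]
    {Y : Fin (T + 1) → Ω → Fin d → ℝ} (hY : Y ∈ ProcInf P ℱ d t) (hYA : Y ∉ accProc P ℱ t ρ) :
    ∃ Z : Ici t → Ω → Fin d → ℝ, (∀ s : Ici t, Z s ∈ LOnePos P (ℱ s) d) ∧
      (∀ X ∈ accProc P ℱ t ρ, 0 ≤ ∑ s : Ici t, pairing P (Z s) (X s)) ∧
      ∑ s : Ici t, pairing P (Z s) (Y s) < 0 ∧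
      ∃ u ∈ MElig P (ℱ t) d m, ∑ s : Ici t, pairing P (Z s) u ≠ 0 := by
  obtain ⟨u, hu, hu0⟩ := hρ.finiteAtZero.exists_notMem
  have huA : constFrom t u ∉ accProc P ℱ t ρ := fun h => hu0 <|
    (hρ.mem_iff zero_mem_ProcInf hu).2 (by rwa [zero_add])
  have padd : ∀ a ∈ ProcOne P ℱ d t, ∀ X ∈ ProcInf P ℱ d t, ∀ Y ∈ ProcInf P ℱ d t,
      procPairing P a (X + Y) = procPairing P a X + procPairing P a Y := by
    intro a ha X hX Y hY
    rw [procPairing_eq_sum ha.2.1 (add_mem_ProcInf hX hY).1, procPairing_eq_sum ha.2.1 hX.1,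
      procPairing_eq_sum ha.2.1 hY.1, ← Finset.sum_add_distrib]
    exact Finset.sum_congr rfl fun s _ =>
      pairing_add (ℱ.le s) (incr_mem_LOne ha s) (hX.1 s) (hY.1 s)
  have psmul : ∀ a ∈ ProcOne P ℱ d t, ∀ c : ℝ, ∀ X ∈ ProcInf P ℱ d t,
      procPairing P a (c • X) = c * procPairing P a X := by
    intro a _ c X _
    simp only [procPairing, Pi.smul_apply, dotProduct_smul, smul_eq_mul, ← Finset.mul_sum]
    exact integral_const_mul _ _
  obtain ⟨a, ha, haA, haY, hau⟩ := exists_pair_separating_ne_zero (pair := procPairing P)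
    (fun X hX => hX.1) hρ.isClosed_acc hρ.zero_mem_acc (fun x hx y hy => hρ.acc_add hx hy)
    (fun c hc x hx => hρ.acc_const_smul hx hc.le) padd psmul incr_combination hY hYA
    (constFrom_mem_ProcInf hu.1) huA
  -- Processes in the domain vanish before `t`, so only the increments from `t` on are seen.
  have key : ∀ X ∈ ProcInf P ℱ d t,
      procPairing P a X = ∑ s : Ici t, pairing P (incr a s) (X s) := fun X hX => by
    rw [procPairing_eq_sum ha.2.1 hX.1, sum_eq_sum_Ici]
    intro s hs
    simp [pairing, hX.2 s hs]
  refine ⟨fun s => incr a s, fun s => ⟨incr_mem_LOne ha s, ?_⟩, fun X hX => ?_, ?_, u, hu, ?_⟩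
  · refine ae_all_iff.2 fun i => ae_nonneg_of_setIntegral_nonneg (ℱ.le s)
      (measurable_coord (incr_mem_LOne ha s).1 i) (ha.2.1 s i) fun A hA => ?_
    -- A non-negative process living at the single time `s`; pairing with it tests the sign of one
    -- component of one increment.
    let X : Fin (T + 1) → Ω → Fin d → ℝ := Function.update 0 (s : Fin (T + 1))
      fun ω => A.indicator (fun _ => (1 : ℝ)) ω • Pi.single i (1 : ℝ)
    have hXn : ∀ r ω j, 0 ≤ X r ω j := fun r ω j => by
      by_cases hr : r = s
      · subst hr
        by_cases h : ω ∈ A <;> by_cases hj : j = i <;> simp [X, h, hj]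
      · simp [X, hr]
    have hX : X ∈ ProcInf P ℱ d t := by
      refine ⟨fun r => ?_, fun r hr => ?_⟩
      · by_cases hr : r = s
        · subst hr
          simp only [X, Function.update_self]
          refine ⟨(measurable_const.indicator hA).smul_const _, 1,
            Filter.Eventually.of_forall fun ω j => ?_⟩
          by_cases h : ω ∈ A <;> by_cases hj : j = i <;> simp [h, hj]
        · simp only [X, Function.update_of_ne hr]; exact zero_mem_LInf
      · have : r ≠ s := fun e => not_le.2 hr (e ▸ s.2)
        simp [X, this]
    have h2 := haA _ (hρ.acc_of_nonneg hX fun r => Filter.Eventually.of_forall (hXn r))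
    rw [procPairing_eq_sum ha.2.1 hX.1, Finset.sum_eq_single (s : Fin (T + 1))
      (fun r _ hr => by simp [X, hr, pairing]) (by simp)] at h2
    simp only [X, Function.update_self] at h2
    rw [pairing_indicator (ℱ.le s) (incr a s) (fun _ => Pi.single i (1 : ℝ)) hA] at h2
    simpa using h2
  · rw [← key X hX.1]; exact haA X hX
  · rw [← key Y hY]; exact haY
  · rw [key _ (constFrom_mem_ProcInf hu.1)] at hau
    convert hau using 4 with s
    exact (if_pos s.2).symm

omit hρ in
theorem integral_sum_dot_condQVec [IsProbabilityMeasure P] {p : (Ici t → Fin d → Measure Ω) × (Ici t → Ω → Fin d → ℝ)}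
    (hp : p ∈ dualProc P ℱ d m t) {X : Ici t → Ω → Fin d → ℝ}
    (hX : ∀ s : Ici t, X s ∈ LInf P (ℱ s) d) {A : Set Ω} (hA : MeasurableSet[ℱ t] A) :
    ∫ ω in A, ∑ s : Ici t, p.2 s ω ⬝ᵥ condQVec P (ℱ t) (p.1 s) (X s) ω ∂P =
      ∑ s : Ici t, ∫ ω in A, wTrans P (ℱ t) (ℱ s) (p.1 s) (p.2 s) ω ⬝ᵥ X s ω ∂P := by
  rw [integral_finsetSum _ fun (s : Ici t) _ => Integrable.integrableOn (integrable_dot_condQVec (ℱ.le t)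
    (ℱ.le s) (hp.1 s) (hp.2.1 s).1.2 (hX s))]
  exact Finset.sum_congr rfl fun s _ => (setIntegral_dot_condQVec (ℱ.mono s.2) (ℱ.le s) (hp.1 s)
    (hp.2.1 s).1 (hp.2.2 s).1.2 (hX s) hA).symm

/-- The defining condition is almost sure and conditional on time `t`. Stability of the acceptance
set under indicators of events known at time `t` makes it equivalent to its expectation, which is a
pairing with the transported weights. -/
theorem IsClosedCoherentProc.mem_dualProcMax_iff [IsProbabilityMeasure P]
    {p : (Ici t → Fin d → Measure Ω) × (Ici t → Ω → Fin d → ℝ)} (hp : p ∈ dualProc P ℱ d m t) :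
    p ∈ dualProcMax P ℱ m t ρ ↔ ∀ X ∈ accProc P ℱ t ρ,
      0 ≤ ∑ s : Ici t, pairing P (wTrans P (ℱ t) (ℱ s) (p.1 s) (p.2 s)) (X s) := by
  refine ⟨fun h X hX => ?_, fun h => ⟨hp, fun X hX => ?_⟩⟩
  · have e := integral_sum_dot_condQVec hp (X := fun s => X s) (fun s => hX.1.1 s) MeasurableSet.univ
    simp only [setIntegral_univ] at e
    exact e ▸ integral_nonneg_of_ae (h.2 X hX)
  · refine ae_nonneg_of_setIntegral_nonneg (ℱ.le t)
      (Finset.measurable_sum _ fun s _ => measurable_dot_condQVec (hp.2.1 s).1.1)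
      (integrable_finsetSum _ fun s _ => integrable_dot_condQVec (ℱ.le t)
        (ℱ.le s) (hp.1 s) (hp.2.1 s).1.2 (hX.1.1 s)) fun A hA => ?_
    rw [integral_sum_dot_condQVec hp (X := fun s => X s) (fun s => hX.1.1 s) hA]
    have h1 := h _ (hρ.acc_smul_fun hX (measurable_const.indicator hA)
      (l := A.indicator fun _ => (1 : ℝ)) (C := 1) (Filter.Eventually.of_forall fun ω =>
        indicator_nonneg (fun _ _ => zero_le_one) _) (Filter.Eventually.of_forall fun ω =>
        indicator_le_self' (f := fun _ => (1 : ℝ)) (fun _ _ => zero_le_one) _))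
    refine h1.trans_eq (Finset.sum_congr rfl fun s _ => ?_)
    exact pairing_indicator (ℱ.le t) _ _ hA

/-- Dual representation of a closed coherent risk measure for processes. -/
theorem repProc_of_subset [IsProbabilityMeasure P]
    {W : Set ((Ici t → Fin d → Measure Ω) × (Ici t → Ω → Fin d → ℝ))}
    (hW : W ⊆ dualProcMax P ℱ m t ρ)
    (hW' : {p | p ∈ dualProcMax P ℱ m t ρ ∧ ∃ s, p.2 s ∉ MPerp P (ℱ t) d m} ⊆ W) :
    RepProc P ℱ m t ρ W := by
  intro X hX
  ext u
  simp only [mem_inter_iff, mem_iInter]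
  have key : ∀ p ∈ dualProc P ℱ d m t, u ∈ MElig P (ℱ t) d m → ∀ᵐ ω ∂P,
      ∑ s : Ici t, p.2 s ω ⬝ᵥ condQVec P (ℱ t) (p.1 s) ((X + constFrom t u) s) ω =
      ∑ s : Ici t, p.2 s ω ⬝ᵥ u ω - ∑ s : Ici t, p.2 s ω ⬝ᵥ condQVec P (ℱ t) (p.1 s) (-X s) ω := by
    intro p hp hu
    filter_upwards [ae_all_iff.2 fun s : Ici t => dot_condQVec_add (ℱ.le t) (ℱ.le s) (hp.1 s)
      (p.2 s) (hX.1 s) hu.1] with ω h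
    rw [← Finset.sum_sub_distrib]
    refine Finset.sum_congr rfl fun s _ => ?_
    have : (X + constFrom t u) s = X s + u := by
      rw [Pi.add_apply, constFrom, if_pos (show t ≤ s from s.2)]
    rw [this]; exact h s
  constructor
  · intro hu
    have huM := (hρ.upper X hX).1 hu
    refine ⟨huM, fun p hp => ⟨huM, ?_⟩⟩
    filter_upwards [key p (hW hp).1 huM, (hW hp).2 _ ((hρ.mem_iff hX huM).1 hu)] with ω a b
    rw [a] at b
    linarith
  · rintro ⟨huM, hall⟩
    by_contra huR
    have hXu := add_mem_ProcInf hX (constFrom_mem_ProcInf huM.1)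
    obtain ⟨Z, hZ, hZA, hZY, v, hv, hZv⟩ := hρ.exists_separating hXu
      (fun h => huR ((hρ.mem_iff hX huM).2 h))
    choose Q w hQ hw he hwT using fun s : Ici t => exists_wTrans_eq (P := P) (ℱ.mono s.2)
      (ℱ.le s) (hZ s)
    have hp : (Q, w) ∈ dualProc P ℱ d m t :=
      ⟨hQ, fun s => mem_dualCone_MPos (hw s).1 (hw s).2, hwT⟩
    have hmem : (Q, w) ∈ W := by
      refine hW' ⟨(hρ.mem_dualProcMax_iff hp).2 fun Y hY => ?_, ?_⟩
      · simp only [pairing_congr (he _)]; exact hZA Y hY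
      -- The separating functional does not vanish on the constant process `v`, so some single time
      -- must contribute; the weight at that time is not orthogonal to `M`.
      · obtain ⟨s, -, hs⟩ := Finset.exists_ne_zero_of_sum_ne_zero hZv
        refine ⟨s, fun h => hs ?_⟩
        rw [← pairing_congr (he s), pairing_wTrans_of_measurable (ℱ.mono s.2) (ℱ.le s) (hQ s)
          (hw s).1 (hwT s).1.2 hv.1]
        exact h.2 v hv
    have e := integral_sum_dot_condQVec hp (X := fun s => (X + constFrom t u) s)
      (fun s => hXu.1 s) MeasurableSet.univ
    simp only [setIntegral_univ] at e
    simp only [← pairing_congr (he _)] at hZY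
    simp only [pairing] at hZY
    rw [← e] at hZY
    refine absurd (integral_nonneg_of_ae ?_) (not_le.2 hZY)
    filter_upwards [key _ hp huM, (hall _ hmem).2] with ω a b
    rw [a]
    exact sub_nonneg.2 b

end CoherentProc

/-! ### Integrals against images of measures with densities -/

section MapWithDensity

variable {Ω Ω' : Type*} {mΩ : MeasurableSpace Ω} {m' : MeasurableSpace Ω'} {P : Measure Ω}
  {e : Ω → Ω'} {g : Ω → ℝ}

theorem lintegral_map_withDensity (he : Measurable e) (hg : Measurable g) {f : Ω' → ENNReal}
    (hf : Measurable f) :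
    ∫⁻ x, f x ∂((P.withDensity fun ω => ENNReal.ofReal (g ω)).map e) =
      ∫⁻ ω, ENNReal.ofReal (g ω) * f (e ω) ∂P := by
  rw [lintegral_map hf he, lintegral_withDensity_eq_lintegral_mul _ hg.ennreal_ofReal
    (show Measurable fun ω => f (e ω) from hf.comp he)]
  rfl

theorem integrable_map_withDensity_iff (he : Measurable e) (hg : Measurable g)
    (hg0 : ∀ᵐ ω ∂P, 0 ≤ g ω) {f : Ω' → ℝ} (hf : Measurable f) :
    Integrable f ((P.withDensity fun ω => ENNReal.ofReal (g ω)).map e) ↔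
      Integrable (fun ω => g ω * f (e ω)) P := by
  rw [integrable_map_measure hf.aestronglyMeasurable he.aemeasurable,
    integrable_withDensity_iff_integrable_smul' hg.ennreal_ofReal
      (Filter.Eventually.of_forall fun _ => ENNReal.ofReal_lt_top)]
  refine integrable_congr (hg0.mono fun ω h => ?_)
  simp only [ENNReal.toReal_ofReal h, smul_eq_mul, Function.comp]

theorem integral_map_withDensity (he : Measurable e) (hg : Measurable g)
    (hg0 : ∀ᵐ ω ∂P, 0 ≤ g ω) {f : Ω' → ℝ} (hf : Measurable f) :
    ∫ x, f x ∂((P.withDensity fun ω => ENNReal.ofReal (g ω)).map e) =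
      ∫ ω, g ω * f (e ω) ∂P := by
  rw [integral_map he.aemeasurable hf.aestronglyMeasurable,
    integral_withDensity_eq_integral_toReal_smul hg.ennreal_ofReal
      (Filter.Eventually.of_forall fun _ => ENNReal.ofReal_lt_top)]
  refine integral_congr_ae (hg0.mono fun ω h => ?_)
  simp only [ENNReal.toReal_ofReal h, smul_eq_mul]

end MapWithDensity

/-! ### The optional space described by its sections -/

section Optional

variable {Ω : Type*} {mΩ : MeasurableSpace Ω} {P : Measure Ω} {T d m : ℕ}
  {ℱ : Filtration (Fin (T + 1)) mΩ} {t : Fin (T + 1)} {μ : Fin (T + 1) → Ω → ℝ}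

/-! ### Measurability by sections -/

theorem measurable_mk_optSigma (s : Fin (T + 1)) :
    @Measurable Ω (Ω × Fin (T + 1)) (ℱ s) (optSigma ℱ) fun ω => (ω, s) := by
  refine @measurable_generateFrom _ _ (ℱ s) _ _ ?_
  rintro _ ⟨r, A, hA, rfl⟩
  by_cases h : s = r
  · subst h; simpa [preimage] using hA
  · simp [preimage, h]

theorem measurableSet_optSigma_iff {B : Set (Ω × Fin (T + 1))} :
    MeasurableSet[optSigma ℱ] B ↔ ∀ s, MeasurableSet[ℱ s] {ω | (ω, s) ∈ B} := by
  refine ⟨fun h s => measurable_mk_optSigma s h, fun h => ?_⟩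
  have : B = ⋃ s, {ω | (ω, s) ∈ B} ×ˢ {s} := by ext ⟨ω, s⟩; simp
  rw [this]
  exact @MeasurableSet.iUnion _ _ (optSigma ℱ) _ _ fun s =>
    MeasurableSpace.measurableSet_generateFrom ⟨s, _, h s, rfl⟩

theorem measurable_optSigma_iff {E : Type*} [MeasurableSpace E] {f : Ω × Fin (T + 1) → E} :
    Measurable[optSigma ℱ] f ↔ ∀ s, Measurable[ℱ s] (sect f s) :=
  ⟨fun h s _ hA => measurableSet_optSigma_iff.1 (h hA) s,
    fun h _ hA => measurableSet_optSigma_iff.2 fun s => h s hA⟩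

theorem measurable_mk_optFilt_of_lt {s : Fin (T + 1)} (hs : s < t) :
    @Measurable Ω (Ω × Fin (T + 1)) (ℱ s) (optFilt ℱ t) fun ω => (ω, s) := by
  refine @measurable_generateFrom _ _ (ℱ s) _ _ ?_
  rintro _ (⟨r, -, A, hA, rfl⟩ | ⟨A, -, rfl⟩)
  · by_cases h : s = r
    · subst h; simpa [preimage] using hA
    · simp [preimage, h]
  · simp [preimage, not_le.2 hs]

theorem measurable_mk_optFilt_of_le {s : Fin (T + 1)} (hs : t ≤ s) :
    @Measurable Ω (Ω × Fin (T + 1)) (ℱ t) (optFilt ℱ t) fun ω => (ω, s) := by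
  refine @measurable_generateFrom _ _ (ℱ t) _ _ ?_
  rintro _ (⟨r, hr, A, -, rfl⟩ | ⟨A, hA, rfl⟩)
  · simp [preimage, (hr.trans_le hs).ne']
  · simpa [preimage, hs] using hA

/-- Independence of time from `t` on holds for the generators and survives complements and countable
unions. It is a pointwise identity, not merely an almost sure one. -/
theorem mem_optFilt_iff_of_le {B : Set (Ω × Fin (T + 1))} (hB : MeasurableSet[optFilt ℱ t] B)
    {s : Fin (T + 1)} (hs : t ≤ s) (ω : Ω) : (ω, s) ∈ B ↔ (ω, t) ∈ B := by
  induction B, hB using MeasurableSpace.generateFrom_induction with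
  | hC B hB _ =>
    obtain ⟨r, hr, A, -, rfl⟩ | ⟨A, -, rfl⟩ := hB
    · simp [hr.ne', (hr.trans_le hs).ne']
    · simp [hs]
  | empty => simp
  | compl B _ h => simp [h]
  | iUnion f _ h => simp [h]

theorem measurableSet_optFilt_iff {B : Set (Ω × Fin (T + 1))} :
    MeasurableSet[optFilt ℱ t] B ↔ (∀ s < t, MeasurableSet[ℱ s] {ω | (ω, s) ∈ B}) ∧
      MeasurableSet[ℱ t] {ω | (ω, t) ∈ B} ∧ ∀ s, t ≤ s → ∀ ω, (ω, s) ∈ B ↔ (ω, t) ∈ B := by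
  refine ⟨fun h => ⟨fun s hs => measurable_mk_optFilt_of_lt hs h,
    measurable_mk_optFilt_of_le le_rfl h, fun s hs => mem_optFilt_iff_of_le h hs⟩, ?_⟩
  rintro ⟨h1, h2, h3⟩
  have : B = (⋃ s : Iio t, {ω | (ω, (s : Fin (T + 1))) ∈ B} ×ˢ {(s : Fin (T + 1))}) ∪
      {ω | (ω, t) ∈ B} ×ˢ Ici t := by
    ext ⟨ω, s⟩
    rcases lt_or_ge s t with hs | hs
    · simp [hs, not_le.2 hs]
    · simp [hs, h3 s hs, not_lt.2 hs]
  rw [this]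
  refine @MeasurableSet.union _ (optFilt ℱ t) _ _ ?_ ?_
  · exact @MeasurableSet.iUnion _ _ (optFilt ℱ t) _ _ fun s =>
      MeasurableSpace.measurableSet_generateFrom (Or.inl ⟨s, s.2, _, h1 s s.2, rfl⟩)
  · exact MeasurableSpace.measurableSet_generateFrom (Or.inr ⟨_, h2, rfl⟩)

/-- The preimage of the singleton `{f (ω, t)}` does not distinguish times after `t`, so constancy in
time follows from measurability alone. -/
theorem measurable_optFilt_iff {E : Type*} [MeasurableSpace E] [MeasurableSingletonClass E]
    {f : Ω × Fin (T + 1) → E} :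
    Measurable[optFilt ℱ t] f ↔ (∀ s < t, Measurable[ℱ s] (sect f s)) ∧
      Measurable[ℱ t] (sect f t) ∧ ∀ s, t ≤ s → sect f s = sect f t := by
  refine ⟨fun h => ⟨fun s hs A hA => (measurableSet_optFilt_iff.1 (h hA)).1 s hs,
    fun A hA => (measurableSet_optFilt_iff.1 (h hA)).2.1, fun s hs => funext fun ω => ?_⟩,
    fun h A hA => measurableSet_optFilt_iff.2 ⟨fun s hs => h.1 s hs hA, h.2.1 hA,
      fun s hs ω => ?_⟩⟩
  · exact ((measurableSet_optFilt_iff.1 (h (measurableSet_singleton (f (ω, t))))).2.2 s hs ω).2 rfl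
  · have := congrFun (h.2.2 s hs) ω
    simp only [sect] at this
    simp [this]

theorem optFilt_le_optSigma : optFilt ℱ t ≤ optSigma ℱ := fun B hB => by
  have h := measurableSet_optFilt_iff.1 hB
  refine measurableSet_optSigma_iff.2 fun s => ?_
  rcases lt_or_ge s t with hs | hs
  · exact h.1 s hs
  · simp only [h.2.2 s hs]
    exact ℱ.mono hs _ h.2.1

/-! ### The reference process -/

theorem IsReference.measurable (hμ : IsReference P ℱ μ) (s : Fin (T + 1)) : Measurable (μ s) :=
  (hμ.adapted s).mono (ℱ.le s) le_rfl

theorem IsReference.pos (hμ : IsReference P ℱ μ) : ∀ᵐ ω ∂P, ∀ s, 0 < μ s ω := by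
  obtain ⟨ε, hε, h⟩ := hμ.bounded_below
  exact h.mono fun ω h s => hε.trans (h s)

theorem IsReference.le_one (hμ : IsReference P ℱ μ) : ∀ᵐ ω ∂P, ∀ s, μ s ω ≤ 1 := by
  filter_upwards [hμ.pos, hμ.sum_eq_one] with ω h h1 s
  rw [← h1]
  exact Finset.single_le_sum (f := fun s => μ s ω) (fun s _ => (h s).le) (Finset.mem_univ s)

theorem IsReference.abs_le_one (hμ : IsReference P ℱ μ) (s : Fin (T + 1)) :
    ∀ᵐ ω ∂P, |μ s ω| ≤ 1 := by
  filter_upwards [hμ.pos, hμ.le_one] with ω h h1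
  rw [abs_of_pos (h s)]
  exact h1 s

theorem IsReference.exists_abs_inv_le (hμ : IsReference P ℱ μ) :
    ∃ C : ℝ, 0 < C ∧ ∀ s, ∀ᵐ ω ∂P, |(μ s ω)⁻¹| ≤ C := by
  obtain ⟨ε, hε, h⟩ := hμ.bounded_below
  refine ⟨ε⁻¹, inv_pos.2 hε, fun s => h.mono fun ω h => ?_⟩
  rw [abs_of_pos (inv_pos.2 (hε.trans (h s)))]
  exact inv_anti₀ hε (h s).le

/-- The remaining mass `1 - ∑_{r<t} μ_r`. -/
noncomputable abbrev mass (μ : Fin (T + 1) → Ω → ℝ) (t : Fin (T + 1)) : Ω → ℝ :=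
  fun ω => 1 - ∑ r ∈ Finset.Iio t, μ r ω

theorem measurable_mass (hμ : IsReference P ℱ μ) : Measurable[ℱ t] (mass μ t) :=
  measurable_const.sub (Finset.measurable_sum _ fun r hr =>
    (hμ.adapted r).mono (ℱ.mono (Finset.mem_Iio.1 hr).le) le_rfl)

theorem sum_Ici_eq_sub {f : Fin (T + 1) → ℝ} (h : ∑ s, f s = 1) :
    ∑ s : Ici t, f s = 1 - ∑ r ∈ Finset.Iio t, f r := by
  rw [← h, ← Finset.sum_subtype (Finset.univ.filter (t ≤ ·)) (by simp) f,
    ← Finset.sum_filter_add_sum_filter_not Finset.univ (t ≤ ·)]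
  have : Finset.univ.filter (fun s => ¬ t ≤ s) = Finset.Iio t := by ext; simp
  rw [this, add_sub_cancel_right]

theorem sum_Ici_eq_mass (hμ : IsReference P ℱ μ) :
    ∀ᵐ ω ∂P, ∑ s : Ici t, μ s ω = mass μ t ω :=
  hμ.sum_eq_one.mono fun _ h => sum_Ici_eq_sub h

theorem mass_pos (hμ : IsReference P ℱ μ) : ∀ᵐ ω ∂P, μ t ω ≤ mass μ t ω ∧ 0 < mass μ t ω := by
  filter_upwards [hμ.pos, sum_Ici_eq_mass (t := t) hμ] with ω h h1
  rw [← h1]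
  have : μ t ω ≤ ∑ s : Ici t, μ s ω :=
    Finset.single_le_sum (f := fun s : Ici t => μ s ω) (fun s _ => (h s).le)
      (Finset.mem_univ ⟨t, le_refl t⟩)
  exact ⟨this, (h t).trans_le this⟩

theorem mass_le_one (hμ : IsReference P ℱ μ) : ∀ᵐ ω ∂P, |mass μ t ω| ≤ 1 := by
  filter_upwards [hμ.pos, mass_pos (t := t) hμ] with ω h h1
  rw [abs_of_pos h1.2]
  exact sub_le_self _ (Finset.sum_nonneg fun r _ => (h r).le)

theorem exists_abs_inv_mass_le (hμ : IsReference P ℱ μ) :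
    ∃ C : ℝ, 0 < C ∧ ∀ᵐ ω ∂P, |(mass μ t ω)⁻¹| ≤ C := by
  obtain ⟨C, hC0, hC⟩ := hμ.exists_abs_inv_le
  refine ⟨C, hC0, ?_⟩
  filter_upwards [hC t, hμ.pos, mass_pos (t := t) hμ] with ω h h0 h1
  refine le_trans ?_ h
  rw [abs_of_pos (inv_pos.2 h1.2), abs_of_pos (inv_pos.2 (h0 t))]
  exact inv_anti₀ (h0 t) h1.1

/-! ### Integration with respect to `P ⊗ μ` -/

theorem measurable_mk_optSigma' (s : Fin (T + 1)) :
    @Measurable Ω (Ω × Fin (T + 1)) mΩ (optSigma ℱ) fun ω => (ω, s) :=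
  (measurable_mk_optSigma s).mono (ℱ.le s) le_rfl

theorem measurableSet_section {B : Set (Ω × Fin (T + 1))} (hB : MeasurableSet[optSigma ℱ] B)
    (s : Fin (T + 1)) : MeasurableSet {ω | (ω, s) ∈ B} :=
  ℱ.le s _ (measurableSet_optSigma_iff.1 hB s)

theorem lintegral_optMeasure (hμ : IsReference P ℱ μ) {f : Ω × Fin (T + 1) → ENNReal}
    (hf : Measurable[optSigma ℱ] f) :
    ∫⁻ x, f x ∂(optMeasure P ℱ μ) = ∑ s, ∫⁻ ω, ENNReal.ofReal (μ s ω) * f (ω, s) ∂P := by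
  rw [optMeasure, lintegral_finsetSum_measure]
  exact Finset.sum_congr rfl fun s _ =>
    lintegral_map_withDensity (measurable_mk_optSigma' s) (hμ.measurable s) hf

theorem optMeasure_apply (hμ : IsReference P ℱ μ) {B : Set (Ω × Fin (T + 1))}
    (hB : MeasurableSet[optSigma ℱ] B) :
    optMeasure P ℱ μ B = ∑ s, ∫⁻ ω in {ω | (ω, s) ∈ B}, ENNReal.ofReal (μ s ω) ∂P := by
  rw [← @lintegral_indicator_one _ (optSigma ℱ) _ _ hB,
    lintegral_optMeasure hμ (f := B.indicator 1) 
      (Measurable.indicator (f := fun _ => 1) measurable_const hB)]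
  refine Finset.sum_congr rfl fun s _ => ?_
  rw [← lintegral_indicator (measurableSet_section hB s)]
  refine lintegral_congr fun ω => ?_
  by_cases h : (ω, s) ∈ B <;> simp [h]

theorem setLIntegral_optMeasure (hμ : IsReference P ℱ μ) {f : Ω × Fin (T + 1) → ENNReal}
    (hf : Measurable[optSigma ℱ] f) {B : Set (Ω × Fin (T + 1))}
    (hB : MeasurableSet[optSigma ℱ] B) :
    ∫⁻ x in B, f x ∂(optMeasure P ℱ μ) =
      ∑ s, ∫⁻ ω in {ω | (ω, s) ∈ B}, ENNReal.ofReal (μ s ω) * f (ω, s) ∂P := by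
  rw [← @lintegral_indicator _ (optSigma ℱ) _ _ hB, lintegral_optMeasure hμ (hf.indicator hB)]
  refine Finset.sum_congr rfl fun s _ => ?_
  rw [← lintegral_indicator (measurableSet_section hB s)]
  refine lintegral_congr fun ω => ?_
  by_cases h : (ω, s) ∈ B <;> simp [h]

theorem isProbabilityMeasure_optMeasure [IsProbabilityMeasure P] (hμ : IsReference P ℱ μ) :
    IsProbabilityMeasure (optMeasure P ℱ μ) := by
  refine ⟨?_⟩
  rw [optMeasure_apply hμ MeasurableSet.univ]
  simp only [mem_univ, ofPred_true, Measure.restrict_univ]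
  rw [← lintegral_finsetSum _ fun s _ => (hμ.measurable s).ennreal_ofReal]
  rw [← measure_univ (μ := P), ← lintegral_one]
  refine lintegral_congr_ae ?_
  filter_upwards [hμ.pos, hμ.sum_eq_one] with ω h h1
  rw [← ENNReal.ofReal_sum_of_nonneg fun s _ => (h s).le, h1, ENNReal.ofReal_one]

/-- Null sets on the product are null in each section because every `μ s` is positive. In the
converse direction the exceptional set must be optional: its sections are null, hence measurable
already at time zero by completeness. -/
theorem ae_optMeasure_iff (hcomplete : ∀ A : Set Ω, P A = 0 → MeasurableSet[ℱ 0] A)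
    (hμ : IsReference P ℱ μ) {p : Ω × Fin (T + 1) → Prop} :
    (∀ᵐ x ∂(optMeasure P ℱ μ), p x) ↔ ∀ s, ∀ᵐ ω ∂P, p (ω, s) := by
  constructor
  · intro h s
    obtain ⟨B, hB, hBm, hB0⟩ :=
      @exists_measurable_superset_of_null _ (optSigma ℱ) _ _ h
    rw [optMeasure_apply hμ hBm, Finset.sum_eq_zero_iff] at hB0
    have h1 := hB0 s (Finset.mem_univ s)
    rw [setLIntegral_eq_zero_iff (measurableSet_section hBm s)
      (hμ.measurable s).ennreal_ofReal] at h1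
    filter_upwards [h1, hμ.pos] with ω h2 h3
    by_contra hp
    have := h2 (hB hp)
    exact absurd (h3 s) (not_lt.2 (ENNReal.ofReal_eq_zero.1 this))
  · intro h
    rw [ae_iff]
    have hm : MeasurableSet[optSigma ℱ] {x | ¬p x} := measurableSet_optSigma_iff.2 fun s =>
      ℱ.mono (Fin.zero_le s) _ (hcomplete _ (ae_iff.1 (h s)))
    rw [optMeasure_apply hμ hm]
    refine Finset.sum_eq_zero fun s _ => setLIntegral_measure_zero _ _ (ae_iff.1 (h s))

/-- The factor `μ s` may be inserted or removed because both it and its inverse are bounded. -/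
theorem integrable_optMeasure_iff (hμ : IsReference P ℱ μ) {f : Ω × Fin (T + 1) → ℝ}
    (hf : Measurable[optSigma ℱ] f) :
    Integrable f (optMeasure P ℱ μ) ↔ ∀ s, Integrable (sect f s) P := by
  rw [optMeasure, integrable_finsetSum_measure]
  simp only [Finset.mem_univ, true_imp_iff]
  refine forall_congr' fun s => ?_
  rw [integrable_map_withDensity_iff (measurable_mk_optSigma' s) (hμ.measurable s)
    (hμ.pos.mono fun ω h => (h s).le) hf]
  constructor
  · intro h
    obtain ⟨C, -, hC⟩ := hμ.exists_abs_inv_le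
    refine (h.bdd_mul (c := C) (hμ.measurable s).inv.aestronglyMeasurable
      (by simpa using hC s)).congr ?_
    filter_upwards [hμ.pos] with ω h
    exact inv_mul_cancel_left₀ (h s).ne' _
  · intro h
    exact h.bdd_mul (c := 1) (hμ.measurable s).aestronglyMeasurable (by simpa using hμ.abs_le_one s)

theorem integral_optMeasure (hμ : IsReference P ℱ μ) {f : Ω × Fin (T + 1) → ℝ}
    (hf : Measurable[optSigma ℱ] f) (hfi : Integrable f (optMeasure P ℱ μ)) :
    ∫ x, f x ∂(optMeasure P ℱ μ) = ∑ s, ∫ ω, μ s ω * f (ω, s) ∂P := by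
  rw [optMeasure, integrable_finsetSum_measure] at hfi
  rw [optMeasure, integral_finsetSum_measure fun s hs => hfi s hs]
  exact Finset.sum_congr rfl fun s _ => integral_map_withDensity (measurable_mk_optSigma' s)
    (hμ.measurable s) (hμ.pos.mono fun ω h => (h s).le) hf

/-! ### Spaces of random vectors on the optional space -/

variable (hcomplete : ∀ A : Set Ω, P A = 0 → MeasurableSet[ℱ 0] A) (hμ : IsReference P ℱ μ)

include hcomplete hμ in
theorem exists_bound_optMeasure_iff {X : Ω × Fin (T + 1) → Fin d → ℝ} :
    (∃ C : ℝ, ∀ᵐ x ∂(optMeasure P ℱ μ), ∀ i, |X x i| ≤ C) ↔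
      ∀ s, ∃ C : ℝ, ∀ᵐ ω ∂P, ∀ i, |sect X s ω i| ≤ C := by
  constructor
  · rintro ⟨C, hC⟩ s
    exact ⟨C, (ae_optMeasure_iff hcomplete hμ).1 hC s⟩
  · intro h
    choose C hC using h
    refine ⟨∑ s, |C s|, (ae_optMeasure_iff hcomplete hμ).2 fun s => (hC s).mono fun ω h i => ?_⟩
    exact (h i).trans ((le_abs_self _).trans (Finset.single_le_sum (f := fun s => |C s|)
      (fun _ _ => abs_nonneg _) (Finset.mem_univ s)))

include hcomplete hμ in
theorem mem_LInf_optSigma_iff {X : Ω × Fin (T + 1) → Fin d → ℝ} :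
    X ∈ LInf (optMeasure P ℱ μ) (optSigma ℱ) d ↔ ∀ s, sect X s ∈ LInf P (ℱ s) d := by
  simp only [LInf, mem_ofPred_eq, measurable_optSigma_iff,
    exists_bound_optMeasure_iff hcomplete hμ, forall_and]

include hcomplete hμ in
theorem mem_LInf_optFilt_iff {X : Ω × Fin (T + 1) → Fin d → ℝ} :
    X ∈ LInf (optMeasure P ℱ μ) (optFilt ℱ t) d ↔ (∀ s < t, sect X s ∈ LInf P (ℱ s) d) ∧
      sect X t ∈ LInf P (ℱ t) d ∧ ∀ s, t ≤ s → sect X s = sect X t := by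
  simp only [LInf, mem_ofPred_eq, measurable_optFilt_iff, exists_bound_optMeasure_iff hcomplete hμ]
  constructor
  · rintro ⟨⟨h1, h2, h3⟩, h4⟩
    exact ⟨fun s hs => ⟨h1 s hs, h4 s⟩, ⟨h2, h4 t⟩, h3⟩
  · rintro ⟨h1, h2, h3⟩
    refine ⟨⟨fun s hs => (h1 s hs).1, h2.1, h3⟩, fun s => ?_⟩
    rcases lt_or_ge s t with hs | hs
    · exact (h1 s hs).2
    · rw [h3 s hs]; exact h2.2

include hcomplete hμ in
theorem mem_MElig_optFilt_iff {X : Ω × Fin (T + 1) → Fin d → ℝ} :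
    X ∈ MElig (optMeasure P ℱ μ) (optFilt ℱ t) d m ↔ (∀ s < t, sect X s ∈ MElig P (ℱ s) d m) ∧
      sect X t ∈ MElig P (ℱ t) d m ∧ ∀ s, t ≤ s → sect X s = sect X t := by
  simp only [MElig, mem_ofPred_eq, mem_LInf_optFilt_iff hcomplete hμ,
    ae_optMeasure_iff hcomplete hμ]
  constructor
  · rintro ⟨⟨h1, h2, h3⟩, h4⟩
    exact ⟨fun s hs => ⟨h1 s hs, h4 s⟩, ⟨h2, h4 t⟩, h3⟩
  · rintro ⟨h1, h2, h3⟩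
    refine ⟨⟨fun s hs => (h1 s hs).1, h2.1, h3⟩, fun s => ?_⟩
    rcases lt_or_ge s t with hs | hs
    · exact (h1 s hs).2
    · have := h2.2
      rw [← h3 s hs] at this
      exact this

include hcomplete hμ in
theorem mem_MPos_optFilt_iff {X : Ω × Fin (T + 1) → Fin d → ℝ} :
    X ∈ MPos (optMeasure P ℱ μ) (optFilt ℱ t) d m ↔ (∀ s < t, sect X s ∈ MPos P (ℱ s) d m) ∧
      sect X t ∈ MPos P (ℱ t) d m ∧ ∀ s, t ≤ s → sect X s = sect X t := by
  simp only [MPos, mem_ofPred_eq, mem_MElig_optFilt_iff hcomplete hμ,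
    ae_optMeasure_iff hcomplete hμ]
  constructor
  · rintro ⟨⟨h1, h2, h3⟩, h4⟩
    exact ⟨fun s hs => ⟨h1 s hs, h4 s⟩, ⟨h2, h4 t⟩, h3⟩
  · rintro ⟨h1, h2, h3⟩
    refine ⟨⟨fun s hs => (h1 s hs).1, h2.1, h3⟩, fun s => ?_⟩
    rcases lt_or_ge s t with hs | hs
    · exact (h1 s hs).2
    · have := h2.2
      rw [← h3 s hs] at this
      exact this

include hμ in
theorem mem_LOne_optSigma_iff {Z : Ω × Fin (T + 1) → Fin d → ℝ} :
    Z ∈ LOne (optMeasure P ℱ μ) (optSigma ℱ) d ↔ ∀ s, sect Z s ∈ LOne P (ℱ s) d := by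
  simp only [LOne, mem_ofPred_eq, measurable_optSigma_iff, forall_and]
  refine and_congr_right fun h => ?_
  rw [forall_comm]
  exact forall_congr' fun i => integrable_optMeasure_iff hμ
    (measurable_coord (measurable_optSigma_iff.2 h) i)

include hμ in
theorem mem_LOne_optFilt_iff {Z : Ω × Fin (T + 1) → Fin d → ℝ} :
    Z ∈ LOne (optMeasure P ℱ μ) (optFilt ℱ t) d ↔ (∀ s < t, sect Z s ∈ LOne P (ℱ s) d) ∧
      sect Z t ∈ LOne P (ℱ t) d ∧ ∀ s, t ≤ s → sect Z s = sect Z t := by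
  constructor
  · intro h
    have h1 := measurable_optFilt_iff.1 h.1
    have h2 := (mem_LOne_optSigma_iff hμ).1 ⟨h.1.mono optFilt_le_optSigma le_rfl, h.2⟩
    exact ⟨fun s _ => h2 s, ⟨h1.2.1, (h2 t).2⟩, h1.2.2⟩
  · rintro ⟨h1, h2, h3⟩
    have h4 : Z ∈ LOne (optMeasure P ℱ μ) (optSigma ℱ) d :=
      (mem_LOne_optSigma_iff hμ).2 fun s => by
        rcases lt_or_ge s t with hs | hs
        · exact h1 s hs
        · rw [h3 s hs]; exact ⟨h2.1.mono (ℱ.mono hs) le_rfl, h2.2⟩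
    exact ⟨measurable_optFilt_iff.2 ⟨fun s hs => (h1 s hs).1, h2.1, h3⟩, h4.2⟩

include hcomplete hμ in
theorem pairing_optMeasure [IsProbabilityMeasure P] {Z X : Ω × Fin (T + 1) → Fin d → ℝ}
    (hZ : Z ∈ LOne (optMeasure P ℱ μ) (optSigma ℱ) d)
    (hX : X ∈ LInf (optMeasure P ℱ μ) (optSigma ℱ) d) :
    pairing (optMeasure P ℱ μ) Z X =
      ∑ s, pairing P (fun ω => μ s ω • sect Z s ω) (sect X s) := by
  have hm : Measurable[optSigma ℱ] fun x => Z x ⬝ᵥ X x :=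
    Finset.measurable_sum _ fun i _ => (measurable_coord hZ.1 i).mul (measurable_coord hX.1 i)
  rw [pairing, integral_optMeasure hμ hm (integrable_dot le_rfl hZ.2 hX)]
  refine Finset.sum_congr rfl fun s _ => integral_congr_ae (Filter.Eventually.of_forall fun ω => ?_)
  simp only [smul_dotProduct, smul_eq_mul]
  rfl

end Optional

/-! ### Embedding one-time vectors and processes into the optional space -/

section Embeddings

variable {Ω : Type*} {mΩ : MeasurableSpace Ω} {P : Measure Ω} {T d m : ℕ}
  {ℱ : Filtration (Fin (T + 1)) mΩ} {s t : Fin (T + 1)} {μ : Fin (T + 1) → Ω → ℝ}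

/-- The function `z 1_{s}` on the optional space. -/
def spike (s : Fin (T + 1)) (z : Ω → Fin d → ℝ) : Ω × Fin (T + 1) → Fin d → ℝ :=
  fun x => if x.2 = s then z x.1 else 0

/-- The function `z 1_{𝕋_t}` on the optional space. -/
def stepFrom (t : Fin (T + 1)) (z : Ω → Fin d → ℝ) : Ω × Fin (T + 1) → Fin d → ℝ :=
  fun x => if t ≤ x.2 then z x.1 else 0

/-- The function `X 1_{𝕋_t}` on the optional space, for a process `X`. -/
def embed (t : Fin (T + 1)) (X : Fin (T + 1) → Ω → Fin d → ℝ) : Ω × Fin (T + 1) → Fin d → ℝ :=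
  fun x => if t ≤ x.2 then X x.2 x.1 else 0

theorem sect_spike_self (z : Ω → Fin d → ℝ) : sect (spike s z) s = z := by
  ext; simp [sect, spike]

theorem sect_spike_of_ne {r : Fin (T + 1)} (h : r ≠ s) (z : Ω → Fin d → ℝ) :
    sect (spike s z) r = 0 := by
  ext; simp [sect, spike, h]

theorem sect_stepFrom_of_le {r : Fin (T + 1)} (h : t ≤ r) (z : Ω → Fin d → ℝ) :
    sect (stepFrom t z) r = z := by
  ext; simp [sect, stepFrom, h]

theorem sect_stepFrom_of_lt {r : Fin (T + 1)} (h : r < t) (z : Ω → Fin d → ℝ) :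
    sect (stepFrom t z) r = 0 := by
  ext; simp [sect, stepFrom, not_le.2 h]

theorem sect_embed_of_le {r : Fin (T + 1)} (h : t ≤ r) (X : Fin (T + 1) → Ω → Fin d → ℝ) :
    sect (embed t X) r = X r := by
  ext; simp [sect, embed, h]

theorem sect_embed_of_lt {r : Fin (T + 1)} (h : r < t) (X : Fin (T + 1) → Ω → Fin d → ℝ) :
    sect (embed t X) r = 0 := by
  ext; simp [sect, embed, not_le.2 h]

theorem sect_embed {X : Fin (T + 1) → Ω → Fin d → ℝ} (hX : X ∈ ProcInf P ℱ d t)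
    (r : Fin (T + 1)) : sect (embed t X) r = X r := by
  rcases lt_or_ge r t with h | h
  · rw [sect_embed_of_lt h, hX.2 r h]
  · exact sect_embed_of_le h X

theorem integrable_mul_dot {Z X : Ω → Fin d → ℝ} (hZ : Z ∈ LOne P (ℱ s) d)
    (hX : X ∈ LInf P (ℱ s) d) {l : Ω → ℝ} (hl : Measurable l) {C : ℝ} (hC : ∀ᵐ ω ∂P, |l ω| ≤ C) :
    Integrable (fun ω => l ω * (Z ω ⬝ᵥ X ω)) P :=
  (integrable_dot (ℱ.le s) hZ.2 hX).bdd_mul hl.aestronglyMeasurable (by simpa using hC)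

theorem projFrom_mem_ProcInf {X : Fin (T + 1) → Ω → Fin d → ℝ} (hX : ∀ s, X s ∈ LInf P (ℱ s) d) :
    projFrom t X ∈ ProcInf P ℱ d t := by
  refine ⟨fun s => ?_, fun s hs => if_neg (not_le.2 hs)⟩
  simp only [projFrom]
  split_ifs
  · exact hX s
  · exact zero_mem_LInf

variable [IsProbabilityMeasure P]
  (hcomplete : ∀ A : Set Ω, P A = 0 → MeasurableSet[ℱ 0] A) (hμ : IsReference P ℱ μ)

include hμ in
theorem smul_inv_mem_LOne {Z : Ω → Fin d → ℝ} (hZ : Z ∈ LOne P (ℱ s) d) :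
    (fun ω => (μ s ω)⁻¹ • Z ω) ∈ LOne P (ℱ s) d := by
  obtain ⟨C, -, hC⟩ := hμ.exists_abs_inv_le
  exact smul_fun_mem_LOne (ℱ.le s) hZ (hμ.adapted s).inv (hC s)

include hμ in
theorem smul_mem_LOne {Z : Ω → Fin d → ℝ} (hZ : Z ∈ LOne P (ℱ s) d) :
    (fun ω => μ s ω • Z ω) ∈ LOne P (ℱ s) d :=
  smul_fun_mem_LOne (ℱ.le s) hZ (hμ.adapted s) (hμ.abs_le_one s)

include hμ in
theorem pairing_smul_inv (Z X : Ω → Fin d → ℝ) :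
    pairing P (fun ω => μ s ω • (μ s ω)⁻¹ • Z ω) X = pairing P Z X :=
  pairing_congr (hμ.pos.mono fun _ h => smul_inv_smul₀ (h s).ne' _)

include hμ in
theorem spike_mem_LOne_optSigma {Z : Ω → Fin d → ℝ} (hZ : Z ∈ LOne P (ℱ s) d) :
    spike s Z ∈ LOne (optMeasure P ℱ μ) (optSigma ℱ) d := by
  refine (mem_LOne_optSigma_iff hμ).2 fun r => ?_
  by_cases h : r = s
  · subst h; rwa [sect_spike_self]
  · rw [sect_spike_of_ne h]; exact zero_mem_LOne

include hμ in
theorem spike_mem_LOne_optFilt (hs : s < t) {Z : Ω → Fin d → ℝ} (hZ : Z ∈ LOne P (ℱ s) d) :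
    spike s Z ∈ LOne (optMeasure P ℱ μ) (optFilt ℱ t) d := by
  refine (mem_LOne_optFilt_iff hμ).2 ⟨fun r _ => ?_, ?_, fun r hr => ?_⟩
  · exact (mem_LOne_optSigma_iff hμ).1 (spike_mem_LOne_optSigma hμ hZ) r
  · rw [sect_spike_of_ne hs.ne']; exact zero_mem_LOne
  · rw [sect_spike_of_ne hs.ne', sect_spike_of_ne (hs.trans_le hr).ne']

include hcomplete hμ in
theorem spike_mem_LInf {Z : Ω → Fin d → ℝ} (hZ : Z ∈ LInf P (ℱ s) d) :
    spike s Z ∈ LInf (optMeasure P ℱ μ) (optSigma ℱ) d := by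
  refine (mem_LInf_optSigma_iff hcomplete hμ).2 fun r => ?_
  by_cases h : r = s
  · subst h; rwa [sect_spike_self]
  · rw [sect_spike_of_ne h]; exact zero_mem_LInf

include hcomplete hμ in
theorem spike_mem_MElig_iff (hs : s < t) {Z : Ω → Fin d → ℝ} :
    spike s Z ∈ MElig (optMeasure P ℱ μ) (optFilt ℱ t) d m ↔ Z ∈ MElig P (ℱ s) d m := by
  rw [mem_MElig_optFilt_iff hcomplete hμ]
  constructor
  · intro h; simpa only [sect_spike_self] using h.1 s hs
  · intro h
    refine ⟨fun r _ => ?_, ?_, fun r hr => ?_⟩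
    · by_cases h : r = s
      · subst h; rwa [sect_spike_self]
      · rw [sect_spike_of_ne h]; exact zero_mem_MElig
    · rw [sect_spike_of_ne hs.ne']; exact zero_mem_MElig
    · rw [sect_spike_of_ne hs.ne', sect_spike_of_ne (hs.trans_le hr).ne']

include hcomplete hμ in
theorem stepFrom_mem_MElig_iff {Z : Ω → Fin d → ℝ} :
    stepFrom t Z ∈ MElig (optMeasure P ℱ μ) (optFilt ℱ t) d m ↔ Z ∈ MElig P (ℱ t) d m := by
  rw [mem_MElig_optFilt_iff hcomplete hμ]
  constructor
  · intro h; simpa only [sect_stepFrom_of_le le_rfl] using h.2.1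
  · intro h
    refine ⟨fun r hr => ?_, ?_, fun r hr => ?_⟩
    · rw [sect_stepFrom_of_lt hr]; exact zero_mem_MElig
    · rwa [sect_stepFrom_of_le le_rfl]
    · rw [sect_stepFrom_of_le le_rfl, sect_stepFrom_of_le hr]

include hμ in
theorem stepFrom_mem_LOne {Z : Ω → Fin d → ℝ} (hZ : Z ∈ LOne P (ℱ t) d) :
    stepFrom t Z ∈ LOne (optMeasure P ℱ μ) (optFilt ℱ t) d := by
  refine (mem_LOne_optFilt_iff hμ).2 ⟨fun r hr => ?_, ?_, fun r hr => ?_⟩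
  · rw [sect_stepFrom_of_lt hr]; exact zero_mem_LOne
  · rwa [sect_stepFrom_of_le le_rfl]
  · rw [sect_stepFrom_of_le le_rfl, sect_stepFrom_of_le hr]

include hcomplete hμ in
theorem embed_mem_LInf {X : Fin (T + 1) → Ω → Fin d → ℝ} (hX : X ∈ ProcInf P ℱ d t) :
    embed t X ∈ LInf (optMeasure P ℱ μ) (optSigma ℱ) d :=
  (mem_LInf_optSigma_iff hcomplete hμ).2 fun s => by rw [sect_embed hX]; exact hX.1 s

theorem mono_mem_LOne {Z : Ω × Fin (T + 1) → Fin d → ℝ}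
    (h : Z ∈ LOne (optMeasure P ℱ μ) (optFilt ℱ t) d) :
    Z ∈ LOne (optMeasure P ℱ μ) (optSigma ℱ) d :=
  ⟨h.1.mono optFilt_le_optSigma le_rfl, h.2⟩

include hcomplete hμ in
theorem pairing_spike_left {Z : Ω → Fin d → ℝ} (hZ : Z ∈ LOne P (ℱ s) d)
    {X : Ω × Fin (T + 1) → Fin d → ℝ} (hX : X ∈ LInf (optMeasure P ℱ μ) (optSigma ℱ) d) :
    pairing (optMeasure P ℱ μ) (spike s Z) X =
      pairing P (fun ω => μ s ω • Z ω) (sect X s) := by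
  rw [pairing_optMeasure hcomplete hμ (spike_mem_LOne_optSigma hμ hZ) hX,
    Finset.sum_eq_single s (fun r _ hr => by simp [sect_spike_of_ne hr, pairing]) (by simp),
    sect_spike_self]

include hcomplete hμ in
theorem pairing_spike_right {X : Ω → Fin d → ℝ} (hX : X ∈ LInf P (ℱ s) d)
    {Z : Ω × Fin (T + 1) → Fin d → ℝ} (hZ : Z ∈ LOne (optMeasure P ℱ μ) (optSigma ℱ) d) :
    pairing (optMeasure P ℱ μ) Z (spike s X) =
      pairing P (fun ω => μ s ω • sect Z s ω) X := by
  rw [pairing_optMeasure hcomplete hμ hZ (spike_mem_LInf hcomplete hμ hX),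
    Finset.sum_eq_single s (fun r _ hr => by simp [sect_spike_of_ne hr, pairing]) (by simp),
    sect_spike_self]

include hcomplete hμ in
/-- The pairing of functions that are constant on `𝕋_t` and one of which vanishes before `t`. -/
theorem pairing_optFilt {Z X : Ω × Fin (T + 1) → Fin d → ℝ}
    (hZ : Z ∈ LOne (optMeasure P ℱ μ) (optFilt ℱ t) d)
    (hX : X ∈ LInf (optMeasure P ℱ μ) (optFilt ℱ t) d)
    (h : ∀ s < t, sect Z s = 0 ∨ sect X s = 0) :
    pairing (optMeasure P ℱ μ) Z X = pairing P (fun ω => mass μ t ω • sect Z t ω) (sect X t) := by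
  have hZ' := (mem_LOne_optFilt_iff hμ).1 hZ
  have hX' := (mem_LInf_optFilt_iff hcomplete hμ).1 hX
  rw [pairing_optMeasure hcomplete hμ (mono_mem_LOne hZ) (mono_mem_LInf optFilt_le_optSigma hX),
    sum_eq_sum_Ici (t := t) (fun s hs => by
      rcases h s hs with h | h <;> simp [pairing, h])]
  have e : ∀ s : Ici t, pairing P (fun ω => μ s ω • sect Z s ω) (sect X s) =
      ∫ ω, μ s ω * (sect Z t ω ⬝ᵥ sect X t ω) ∂P := fun s => by
    rw [hZ'.2.2 s s.2, hX'.2.2 s s.2]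
    simp only [pairing, smul_dotProduct, smul_eq_mul]
  simp only [e]
  rw [← integral_finsetSum _ fun (s : Ici t) _ =>
    integrable_mul_dot hZ'.2.1 hX'.2.1 (hμ.measurable s) (hμ.abs_le_one s)]
  refine integral_congr_ae ((sum_Ici_eq_mass (t := t) hμ).mono fun ω h => ?_)
  simp only [← Finset.sum_mul, h, smul_dotProduct, smul_eq_mul]

/-! ### Continuity -/

include hcomplete hμ in
-- The adjoint of taking the section at `s` is `b ↦ (b / μ_s) 1_{s}`, which stays integrable because
-- `1 / μ_s` is bounded. The other continuity statements follow the same pattern with their own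
-- adjoints.
theorem continuous_sect :
    @Continuous _ _ (weakStar (optMeasure P ℱ μ) (optSigma ℱ)
        (LInf (optMeasure P ℱ μ) (optSigma ℱ) d)) (weakStar P (ℱ s) (LInf P (ℱ s) d))
      fun X => (⟨sect X.1 s, (mem_LInf_optSigma_iff hcomplete hμ).1 X.2 s⟩ :
        LInf P (ℱ s) d) := by
  refine continuous_dualTop _ fun b hb => ⟨spike s fun ω => (μ s ω)⁻¹ • b ω,
    spike_mem_LOne_optSigma hμ (smul_inv_mem_LOne hμ hb), fun X => ?_⟩
  rw [pairing_spike_left hcomplete hμ (smul_inv_mem_LOne hμ hb) X.2, pairing_smul_inv hμ]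

include hcomplete hμ in
theorem continuous_sect_MElig (hs : s < t) :
    @Continuous _ _ (weakStar (optMeasure P ℱ μ) (optFilt ℱ t)
        (MElig (optMeasure P ℱ μ) (optFilt ℱ t) d m)) (weakStar P (ℱ s) (MElig P (ℱ s) d m))
      fun X => (⟨sect X.1 s, ((mem_MElig_optFilt_iff hcomplete hμ).1 X.2).1 s hs⟩ :
        MElig P (ℱ s) d m) := by
  refine continuous_dualTop _ fun b hb => ⟨spike s fun ω => (μ s ω)⁻¹ • b ω,
    spike_mem_LOne_optFilt hμ hs (smul_inv_mem_LOne hμ hb), fun X => ?_⟩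
  rw [pairing_spike_left hcomplete hμ (smul_inv_mem_LOne hμ hb)
    (mono_mem_LInf optFilt_le_optSigma X.2.1), pairing_smul_inv hμ]

include hcomplete hμ in
theorem continuous_sect_self :
    @Continuous _ _ (weakStar (optMeasure P ℱ μ) (optFilt ℱ t)
        (MElig (optMeasure P ℱ μ) (optFilt ℱ t) d m)) (weakStar P (ℱ t) (MElig P (ℱ t) d m))
      fun X => (⟨sect X.1 t, ((mem_MElig_optFilt_iff hcomplete hμ).1 X.2).2.1⟩ :
        MElig P (ℱ t) d m) := by
  -- The portfolio is constant on `𝕋_t`, where the weights `μ` sum to the remaining mass; the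
  -- adjoint therefore divides by that mass.
  obtain ⟨C, -, hC⟩ := exists_abs_inv_mass_le (t := t) hμ
  refine continuous_dualTop _ fun b hb => ?_
  have hb' : (fun ω => (mass μ t ω)⁻¹ • b ω) ∈ LOne P (ℱ t) d :=
    smul_fun_mem_LOne (ℱ.le t) hb (measurable_mass hμ).inv hC
  refine ⟨stepFrom t fun ω => (mass μ t ω)⁻¹ • b ω, stepFrom_mem_LOne hμ hb', fun X => ?_⟩
  rw [pairing_optFilt hcomplete hμ (stepFrom_mem_LOne hμ hb') X.2.1
    (fun s hs => Or.inl (sect_stepFrom_of_lt hs _)), sect_stepFrom_of_le le_rfl]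
  exact (pairing_congr ((mass_pos (t := t) hμ).mono fun ω h => smul_inv_smul₀ h.2.ne' _)).symm

include hcomplete hμ in
theorem continuous_projFrom :
    @Continuous _ _ (weakStar (optMeasure P ℱ μ) (optSigma ℱ)
        (LInf (optMeasure P ℱ μ) (optSigma ℱ) d)) (procTop P ℱ d t)
      fun X => (⟨projFrom t (sect X.1),
        projFrom_mem_ProcInf ((mem_LInf_optSigma_iff hcomplete hμ).1 X.2)⟩ :
        ProcInf P ℱ d t) := by
  refine continuous_dualTop _ fun b hb => ?_
  have hb' : (fun x : Ω × Fin (T + 1) => (μ x.2 x.1)⁻¹ • incr b x.2 x.1) ∈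
      LOne (optMeasure P ℱ μ) (optSigma ℱ) d :=
    (mem_LOne_optSigma_iff hμ).2 fun s => smul_inv_mem_LOne hμ (incr_mem_LOne hb s)
  refine ⟨_, hb', fun X => ?_⟩
  have hX := (mem_LInf_optSigma_iff hcomplete hμ).1 X.2
  rw [pairing_optMeasure hcomplete hμ hb' X.2, procPairing_eq_sum hb.2.1
    (projFrom_mem_ProcInf (t := t) hX).1]
  refine Finset.sum_congr rfl fun s _ => ?_
  refine Eq.trans ?_ (pairing_smul_inv hμ _ _).symm
  by_cases hs : t ≤ s
  · simp only [projFrom, if_pos hs]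
  -- Before `t` the increment involves the times `s` and `s - 1`, both of which precede `t`, so the
  -- dual process contributes nothing there.
  · have : incr b s = 0 := by
      simp only [incr, hb.2.2 s (not_le.1 hs)]
      split_ifs with h
      · simp
      · rw [hb.2.2 _ ((Fin.mk_le_of_le_val (by omega)).trans_lt (not_le.1 hs))]; simp
    simp [this, pairing]

include hcomplete hμ in
theorem continuous_spike :
    @Continuous _ _ (weakStar P (ℱ s) (LInf P (ℱ s) d)) (weakStar (optMeasure P ℱ μ) (optSigma ℱ)
        (LInf (optMeasure P ℱ μ) (optSigma ℱ) d))
      fun X => (⟨spike s X.1, spike_mem_LInf hcomplete hμ X.2⟩ :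
        LInf (optMeasure P ℱ μ) (optSigma ℱ) d) :=
  continuous_dualTop _ fun b hb => ⟨fun ω => μ s ω • sect b s ω,
    smul_mem_LOne hμ ((mem_LOne_optSigma_iff hμ).1 hb s), fun X =>
    pairing_spike_right hcomplete hμ X.2 hb⟩

include hcomplete hμ in
theorem continuous_spike_MElig (hs : s < t) :
    @Continuous _ _ (weakStar P (ℱ s) (MElig P (ℱ s) d m)) (weakStar (optMeasure P ℱ μ)
        (optFilt ℱ t) (MElig (optMeasure P ℱ μ) (optFilt ℱ t) d m))
      fun X => (⟨spike s X.1, (spike_mem_MElig_iff hcomplete hμ hs).2 X.2⟩ :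
        MElig (optMeasure P ℱ μ) (optFilt ℱ t) d m) :=
  continuous_dualTop _ fun b hb => ⟨fun ω => μ s ω • sect b s ω,
    smul_mem_LOne hμ ((mem_LOne_optSigma_iff hμ).1 (mono_mem_LOne hb) s), fun X =>
    pairing_spike_right hcomplete hμ X.2.1 (mono_mem_LOne hb)⟩

include hcomplete hμ in
theorem continuous_stepFrom :
    @Continuous _ _ (weakStar P (ℱ t) (MElig P (ℱ t) d m)) (weakStar (optMeasure P ℱ μ)
        (optFilt ℱ t) (MElig (optMeasure P ℱ μ) (optFilt ℱ t) d m))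
      fun X => (⟨stepFrom t X.1, (stepFrom_mem_MElig_iff hcomplete hμ).2 X.2⟩ :
        MElig (optMeasure P ℱ μ) (optFilt ℱ t) d m) := by
  refine continuous_dualTop _ fun b hb => ⟨fun ω => mass μ t ω • sect b t ω,
    smul_fun_mem_LOne (ℱ.le t) ((mem_LOne_optFilt_iff hμ).1 hb).2.1 (measurable_mass hμ)
      (mass_le_one hμ), fun X => ?_⟩
  rw [pairing_optFilt hcomplete hμ hb ((stepFrom_mem_MElig_iff hcomplete hμ).2 X.2).1
    (fun s hs => Or.inr (sect_stepFrom_of_lt hs _)), sect_stepFrom_of_le le_rfl]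

include hcomplete hμ in
theorem pairing_embed {X : Fin (T + 1) → Ω → Fin d → ℝ} (hX : X ∈ ProcInf P ℱ d t)
    {Z : Ω × Fin (T + 1) → Fin d → ℝ} (hZ : Z ∈ LOne (optMeasure P ℱ μ) (optSigma ℱ) d) :
    pairing (optMeasure P ℱ μ) Z (embed t X) =
      ∑ s : Ici t, pairing P (fun ω => μ s ω • sect Z s ω) (X s) := by
  rw [pairing_optMeasure hcomplete hμ hZ (embed_mem_LInf hcomplete hμ hX)]
  simp only [sect_embed hX]
  exact sum_eq_sum_Ici fun s hs => by simp [pairing, hX.2 s hs]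

include hcomplete hμ in
theorem continuous_embed :
    @Continuous _ _ (procTop P ℱ d t) (weakStar (optMeasure P ℱ μ) (optSigma ℱ)
        (LInf (optMeasure P ℱ μ) (optSigma ℱ) d))
      fun X => (⟨embed t X.1, embed_mem_LInf hcomplete hμ X.2⟩ :
        LInf (optMeasure P ℱ μ) (optSigma ℱ) d) := by
  refine continuous_dualTop _ fun b hb => ?_
  -- The adjoint is the process of integrable variation whose increments from `t` on are `μ_s b_s`.
  obtain ⟨a, ha, hai⟩ := exists_incr_eq (P := P) (ℱ := ℱ) (t := t)
    (Y := fun s => if t ≤ s then fun ω => μ s ω • sect b s ω else 0)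
    (fun s => by
      split_ifs
      · exact smul_mem_LOne hμ ((mem_LOne_optSigma_iff hμ).1 hb s)
      · exact zero_mem_LOne) (fun s hs => if_neg (not_le.2 hs))
  refine ⟨a, ha, fun X => ?_⟩
  rw [pairing_embed hcomplete hμ X.2 hb, procPairing_eq_sum ha.2.1 X.2.1,
    sum_eq_sum_Ici (t := t) fun s hs => by simp [pairing, X.2.2 s hs]]
  refine Finset.sum_congr rfl fun s _ => ?_
  rw [hai, if_pos (show t ≤ s from s.2)]

end Embeddings

/-! ### Closed values from a closed graph -/

section Builder

variable {Ω : Type*} {F G m0 : MeasurableSpace Ω} {P : Measure Ω} {d m : ℕ}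
  {R : (Ω → Fin d → ℝ) → Set (Ω → Fin d → ℝ)}

theorem isClosed_value_of_closedGraph (h : IsClosed[@instTopologicalSpaceProd _ _
      (weakStar P G (LInf P G d)) (weakStar P F (MElig P F d m))]
    {p : (LInf P G d) × (MElig P F d m) | (p.2 : Ω → Fin d → ℝ) ∈ R p.1})
    {X : Ω → Fin d → ℝ} (hX : X ∈ LInf P G d) :
    IsClosed[weakStar P F (MElig P F d m)] (Subtype.val ⁻¹' R X) := by
  let t1 : TopologicalSpace (LInf P G d) := weakStar P G (LInf P G d)
  let t2 : TopologicalSpace (MElig P F d m) := weakStar P F (MElig P F d m)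
  have hc : Continuous fun x : MElig P F d m => ((⟨X, hX⟩ : LInf P G d), x) :=
    Continuous.prodMk continuous_const continuous_id
  exact h.preimage hc

/-- Membership of the values in `𝓖(M; M_+)` is automatic: conditional convexity with constant
weights gives convexity, and slices of a closed graph are closed. -/
theorem closedUpper_of_closedGraph
    (hu : ∀ X ∈ LInf P G d, R X ∈ upperSets P F d m)
    (hconv : ∀ X ∈ LInf P G d, ∀ Y ∈ LInf P G d, ∀ l : Ω → ℝ, Measurable[F] l →
    (∀ᵐ ω ∂P, 0 ≤ l ω ∧ l ω ≤ 1) → ∀ u ∈ R X, ∀ v ∈ R Y,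
      (fun ω => l ω • u ω + (1 - l ω) • v ω) ∈ R (fun ω => l ω • X ω + (1 - l ω) • Y ω))
    (h : IsClosed[@instTopologicalSpaceProd _ _
      (weakStar P G (LInf P G d)) (weakStar P F (MElig P F d m))]
    {p : (LInf P G d) × (MElig P F d m) | (p.2 : Ω → Fin d → ℝ) ∈ R p.1})
    {X : Ω → Fin d → ℝ} (hX : X ∈ LInf P G d) : R X ∈ closedUpperSets P F d m := by
  refine mem_closedUpperSets (hu X hX) (fun u hu v hv a b ha hb hab => ?_)
    (isClosed_value_of_closedGraph h hX)
  obtain rfl : b = 1 - a := by linarith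
  have := hconv X hX X hX (fun _ => a) measurable_const
    (Filter.Eventually.of_forall fun _ => ⟨ha, by linarith⟩) u hu v hv
  have e : (fun ω => a • X ω + (1 - a) • X ω) = X := by
    ext ω i
    simp only [Pi.add_apply, Pi.smul_apply, smul_eq_mul]
    ring
  rw [e] at this
  exact this

theorem mem_image_sub_iff {D : Set (Ω → Fin d → ℝ)} {u v : Ω → Fin d → ℝ} :
    v ∈ (fun v => v - u) '' D ↔ v + u ∈ D :=
  ⟨by rintro ⟨w, hw, rfl⟩; simpa using hw, fun h => ⟨v + u, h, by simp⟩⟩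

end Builder

/-! ### The risk measure on the optional filtration built from its time components -/

section ToOptional

variable {Ω : Type*} {mΩ : MeasurableSpace Ω} {P : Measure Ω} {T d m : ℕ}
  {ℱ : Filtration (Fin (T + 1)) mΩ} {s t : Fin (T + 1)} {μ : Fin (T + 1) → Ω → ℝ}
  {ρ : (Fin (T + 1) → Ω → Fin d → ℝ) → Set (Ω → Fin d → ℝ)}
  {R : Fin (T + 1) → (Ω → Fin d → ℝ) → Set (Ω → Fin d → ℝ)}

theorem mem_toOptional_iff {X u : Ω × Fin (T + 1) → Fin d → ℝ} :
    u ∈ toOptional t ρ R X ↔ (∀ s < t, sect u s ∈ R s (sect X s)) ∧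
      sect u t ∈ ρ (projFrom t (sect X)) ∧ ∀ s, t ≤ s → sect u s = sect u t := by
  constructor
  · rintro ⟨v, z, hv, hz, rfl⟩
    have h1 : ∀ s, t ≤ s → sect (fun x : Ω × Fin (T + 1) => if x.2 < t then v x.2 x.1 else z x.1) s
        = z := fun s hs => by ext; simp [sect, not_lt.2 hs]
    refine ⟨fun s hs => ?_, by rwa [h1 t le_rfl], fun s hs => by rw [h1 s hs, h1 t le_rfl]⟩
    have : sect (fun x : Ω × Fin (T + 1) => if x.2 < t then v x.2 x.1 else z x.1) s = v s := by
      ext; simp [sect, hs]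
    rw [this]; exact hv s hs
  · rintro ⟨h1, h2, h3⟩
    refine ⟨sect u, sect u t, h1, h2, funext fun ⟨ω, s⟩ => ?_⟩
    by_cases hs : s < t
    · simp [hs, sect]
    · simp only [hs, if_false]
      exact congrFun (h3 s (not_lt.1 hs)) ω

/-- A set over a product with a stratum of the optional space. -/
theorem measurableSet_stratum {E : Type*} [mE : MeasurableSpace E] {F : MeasurableSpace Ω}
    {H : MeasurableSpace (Ω × Fin (T + 1))} {N : Set (Fin (T + 1))}
    (hN : ∀ D, MeasurableSet[F] D → MeasurableSet[H] (D ×ˢ N)) {S : Set (Ω × E)}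
    (hS : MeasurableSet[F.prod mE] S) :
    MeasurableSet[H.prod mE] {p : (Ω × Fin (T + 1)) × E | p.1.2 ∈ N ∧ (p.1.1, p.2) ∈ S} := by
  have hfst : @Measurable _ _ (H.prod mE) H (Prod.fst : (Ω × Fin (T + 1)) × E → _) :=
    @measurable_fst _ _ H mE
  have hsnd : @Measurable _ _ (H.prod mE) mE (Prod.snd : (Ω × Fin (T + 1)) × E → _) :=
    @measurable_snd _ _ H mE
  have huniv : MeasurableSet[H.prod mE] {p : (Ω × Fin (T + 1)) × E | p.1.2 ∈ N} := by
    have := hfst (hN univ MeasurableSet.univ)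
    convert this using 1
    ext; simp
  have hgen : F.prod mE = MeasurableSpace.generateFrom
      (image2 (· ×ˢ ·) {s : Set Ω | MeasurableSet[F] s} {t : Set E | MeasurableSet t}) :=
    (@generateFrom_prod _ _ F mE).symm
  rw [hgen] at hS
  induction S, hS using MeasurableSpace.generateFrom_induction with
  | hC B hB _ =>
    obtain ⟨D, hD, A, hA, rfl⟩ := hB
    convert (hfst (hN D hD)).inter (hsnd hA) using 1
    ext p
    simp only [mem_ofPred_eq, mem_prod, mem_inter_iff, mem_preimage]
    tauto
  | empty => simp
  | compl B _ h =>
    convert huniv.diff h using 1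
    ext p
    simp only [mem_ofPred_eq, mem_compl_iff, mem_sdiff]
    tauto
  | iUnion f _ h =>
    convert MeasurableSet.iUnion h using 1
    ext p
    simp

variable [IsProbabilityMeasure P]
  (hcomplete : ∀ A : Set Ω, P A = 0 → MeasurableSet[ℱ 0] A) (hμ : IsReference P ℱ μ)
  (hρ : IsClosedCoherentProc P ℱ m t ρ)
  (hR : ∀ s < t, IsClosedCoherentVec P (ℱ s) (ℱ s) m (R s))

include hρ hR in
theorem zero_mem_toOptional : (0 : Ω × Fin (T + 1) → Fin d → ℝ) ∈ toOptional t ρ R 0 := by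
  refine mem_toOptional_iff.2 ⟨fun s hs => (hR s hs).zero_mem, ?_, fun _ _ => rfl⟩
  have : projFrom t (sect (0 : Ω × Fin (T + 1) → Fin d → ℝ)) = 0 := by
    ext s ω i
    by_cases h : t ≤ s <;> simp [projFrom, sect, h]
  rw [this]; exact hρ.zero_mem

include hcomplete hμ hρ hR in
theorem toOptional_upper {X : Ω × Fin (T + 1) → Fin d → ℝ}
    (hX : X ∈ LInf (optMeasure P ℱ μ) (optSigma ℱ) d) :
    toOptional t ρ R X ∈ upperSets (optMeasure P ℱ μ) (optFilt ℱ t) d m := by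
  have hX' := (mem_LInf_optSigma_iff hcomplete hμ).1 hX
  have hpX := projFrom_mem_ProcInf (t := t) hX'
  refine ⟨fun u hu => ?_, Subset.antisymm (fun u hu => ⟨u, hu, 0, zero_mem_MPos, add_zero u⟩) ?_⟩
  · have hu' := mem_toOptional_iff.1 hu
    exact (mem_MElig_optFilt_iff hcomplete hμ).2 ⟨fun s hs =>
      ((hR s hs).upper _ (hX' s)).1 (hu'.1 s hs), (hρ.upper _ hpX).1 hu'.2.1, hu'.2.2⟩
  · rintro _ ⟨u, hu, c, hc, rfl⟩
    have hu' := mem_toOptional_iff.1 hu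
    have hc' := (mem_MPos_optFilt_iff hcomplete hμ).1 hc
    refine mem_toOptional_iff.2 ⟨fun s hs => ?_, ?_, fun s hs => ?_⟩
    · rw [((hR s hs).upper _ (hX' s)).2]
      exact add_mem_add (hu'.1 s hs) (hc'.1 s hs)
    · rw [(hρ.upper _ hpX).2]
      exact add_mem_add hu'.2.1 hc'.2.1
    · exact congrArg₂ (· + ·) (hu'.2.2 s hs) (hc'.2.2 s hs)

include hcomplete hμ hρ hR in
theorem toOptional_cashInvariant {X u : Ω × Fin (T + 1) → Fin d → ℝ}
    (hX : X ∈ LInf (optMeasure P ℱ μ) (optSigma ℱ) d)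
    (hu : u ∈ MElig (optMeasure P ℱ μ) (optFilt ℱ t) d m) :
    toOptional t ρ R (X + u) = (fun v => v - u) '' toOptional t ρ R X := by
  have hX' := (mem_LInf_optSigma_iff hcomplete hμ).1 hX
  have hpX := projFrom_mem_ProcInf (t := t) hX'
  have hu' := (mem_MElig_optFilt_iff hcomplete hμ).1 hu
  ext v
  rw [mem_image_sub_iff, mem_toOptional_iff, mem_toOptional_iff]
  have e1 : ∀ s < t, sect v s ∈ R s (sect (X + u) s) ↔ sect (v + u) s ∈ R s (sect X s) :=
    fun s hs => by
      rw [show sect (X + u) s = sect X s + sect u s from rfl,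
        (hR s hs).cashInvariant _ (hX' s) _ (hu'.1 s hs), mem_image_sub_iff]
      rfl
  have e2 : projFrom t (sect (X + u)) = projFrom t (sect X) + constFrom t (sect u t) := by
    ext s ω i
    by_cases hs : t ≤ s
    · simp only [projFrom, hs, if_true, Pi.add_apply, constFrom]
      rw [← hu'.2.2 s hs]; rfl
    · simp [projFrom, hs, constFrom]
  have e3 : sect v t ∈ ρ (projFrom t (sect (X + u))) ↔
      sect (v + u) t ∈ ρ (projFrom t (sect X)) := by
    rw [e2, hρ.cashInvariant _ hpX _ hu'.2.1, mem_image_sub_iff]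
    rfl
  have e4 : (∀ s, t ≤ s → sect v s = sect v t) ↔ ∀ s, t ≤ s → sect (v + u) s = sect (v + u) t := by
    refine forall_congr' fun s => forall_congr' fun hs => ?_
    rw [show sect (v + u) s = sect v s + sect u s from rfl,
      show sect (v + u) t = sect v t + sect u t from rfl, hu'.2.2 s hs, add_left_inj]
  rw [e3, e4]
  exact and_congr_left' (forall_congr' fun s => forall_congr' (e1 s))

include hcomplete hμ hρ hR in
-- The graph is a finite intersection of preimages of closed graphs under the continuous section
-- maps; the remaining condition, constancy from `t` on, holds for every element of `M̄_t`.
theorem toOptional_closedGraph : IsClosed[@instTopologicalSpaceProd _ _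
      (weakStar (optMeasure P ℱ μ) (optSigma ℱ) (LInf (optMeasure P ℱ μ) (optSigma ℱ) d))
      (weakStar (optMeasure P ℱ μ) (optFilt ℱ t) (MElig (optMeasure P ℱ μ) (optFilt ℱ t) d m))]
    {p : (LInf (optMeasure P ℱ μ) (optSigma ℱ) d) × (MElig (optMeasure P ℱ μ) (optFilt ℱ t) d m) |
      (p.2 : Ω × Fin (T + 1) → Fin d → ℝ) ∈ toOptional t ρ R p.1} := by
  let t1 := weakStar (optMeasure P ℱ μ) (optSigma ℱ) (LInf (optMeasure P ℱ μ) (optSigma ℱ) d)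
  let t2 := weakStar (optMeasure P ℱ μ) (optFilt ℱ t)
    (MElig (optMeasure P ℱ μ) (optFilt ℱ t) d m)
  let t3 := fun s => weakStar P (ℱ s) (LInf P (ℱ s) d)
  let t4 := fun s => weakStar P (ℱ s) (MElig P (ℱ s) d m)
  let t5 := procTop P ℱ d t
  have h1 : ∀ s : Iio t, IsClosed {p : (LInf (optMeasure P ℱ μ) (optSigma ℱ) d) ×
      (MElig (optMeasure P ℱ μ) (optFilt ℱ t) d m) | sect p.2.1 s ∈ R s (sect p.1.1 s)} :=
    fun s => IsClosed.preimage (((continuous_sect (s := s.1) hcomplete hμ).comp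
      continuous_fst).prodMk ((continuous_sect_MElig hcomplete hμ s.2).comp continuous_snd))
      (hR s.1 s.2).closedGraph
  have h2 : IsClosed {p : (LInf (optMeasure P ℱ μ) (optSigma ℱ) d) ×
      (MElig (optMeasure P ℱ μ) (optFilt ℱ t) d m) |
      sect p.2.1 t ∈ ρ (projFrom t (sect p.1.1))} :=
    hρ.closedGraph.preimage (((continuous_projFrom hcomplete hμ).comp continuous_fst).prodMk
        ((continuous_sect_self hcomplete hμ).comp continuous_snd))
  convert (isClosed_iInter h1).inter h2 using 1
  ext p
  simp only [mem_ofPred_eq, mem_toOptional_iff, mem_inter_iff, mem_iInter, Subtype.forall, mem_Iio]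
  exact and_congr_right fun _ =>
    and_iff_left ((mem_MElig_optFilt_iff hcomplete hμ).1 p.2.2).2.2

include hcomplete hμ hρ hR in
theorem toOptional_condConvex {X Y : Ω × Fin (T + 1) → Fin d → ℝ}
    (hX : X ∈ LInf (optMeasure P ℱ μ) (optSigma ℱ) d)
    (hY : Y ∈ LInf (optMeasure P ℱ μ) (optSigma ℱ) d) {l : Ω × Fin (T + 1) → ℝ}
    (hl : Measurable[optFilt ℱ t] l) (hl01 : ∀ᵐ x ∂(optMeasure P ℱ μ), 0 ≤ l x ∧ l x ≤ 1)
    {u v : Ω × Fin (T + 1) → Fin d → ℝ} (hu : u ∈ toOptional t ρ R X)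
    (hv : v ∈ toOptional t ρ R Y) :
    (fun x => l x • u x + (1 - l x) • v x) ∈
      toOptional t ρ R (fun x => l x • X x + (1 - l x) • Y x) := by
  have hX' := (mem_LInf_optSigma_iff hcomplete hμ).1 hX
  have hY' := (mem_LInf_optSigma_iff hcomplete hμ).1 hY
  have hl' := measurable_optFilt_iff.1 hl
  have hl1 := (ae_optMeasure_iff hcomplete hμ).1 hl01
  have hu' := mem_toOptional_iff.1 hu
  have hv' := mem_toOptional_iff.1 hv
  refine mem_toOptional_iff.2 ⟨fun s hs => ?_, ?_, fun s hs => ?_⟩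
  · exact (hR s hs).condConvex _ (hX' s) _ (hY' s) _ (hl'.1 s hs) (hl1 s) _ (hu'.1 s hs) _
      (hv'.1 s hs)
  · have h := hρ.condConvex _ (projFrom_mem_ProcInf (t := t) hX') _
      (projFrom_mem_ProcInf (t := t) hY') _ hl'.2.1 (hl1 t) _ hu'.2.1 _ hv'.2.1
    have e : (fun s ω => sect l t ω • projFrom t (sect X) s ω +
        (1 - sect l t ω) • projFrom t (sect Y) s ω) =
        projFrom t (sect fun x => l x • X x + (1 - l x) • Y x) := by
      ext s ω i
      by_cases hs : t ≤ s
      · simp only [projFrom, hs, if_true]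
        rw [← hl'.2.2 s hs]; rfl
      · simp [projFrom, hs]
    rw [e] at h
    exact h
  · ext ω i
    have h1 := congrFun (hl'.2.2 s hs) ω
    have h2 := congrFun (congrFun (hu'.2.2 s hs) ω) i
    have h3 := congrFun (congrFun (hv'.2.2 s hs) ω) i
    simp only [sect] at h1 h2 h3 ⊢
    simp [h1, h2, h3]

include hcomplete hμ hρ hR in
theorem toOptional_condPosHom {X : Ω × Fin (T + 1) → Fin d → ℝ}
    (hX : X ∈ LInf (optMeasure P ℱ μ) (optSigma ℱ) d) {l : Ω × Fin (T + 1) → ℝ}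
    (hl : Measurable[optFilt ℱ t] l) (hl0 : ∀ᵐ x ∂(optMeasure P ℱ μ), 0 < l x)
    (hlC : ∃ C : ℝ, ∀ᵐ x ∂(optMeasure P ℱ μ), l x ≤ C) :
    toOptional t ρ R (fun x => l x • X x) =
        {v | v ∈ MElig (optMeasure P ℱ μ) (optFilt ℱ t) d m ∧
          ∃ u ∈ toOptional t ρ R X, ∀ᵐ x ∂(optMeasure P ℱ μ), v x = l x • u x} := by
  have hX' := (mem_LInf_optSigma_iff hcomplete hμ).1 hX
  have hl' := measurable_optFilt_iff.1 hl
  have hl1 := (ae_optMeasure_iff hcomplete hμ).1 hl0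
  obtain ⟨C, hC⟩ := hlC
  have hC1 := (ae_optMeasure_iff hcomplete hμ).1 hC
  have e1 : ∀ s (hs : s < t), _ := fun s hs => (hR s hs).condPosHom _ (hX' s) (sect l s)
    (hl'.1 s hs) (hl1 s) ⟨C, hC1 s⟩
  have e2 := hρ.condPosHom _ (projFrom_mem_ProcInf (t := t) hX') _ hl'.2.1 (hl1 t) ⟨C, hC1 t⟩
  have e3 : projFrom t (sect fun x => l x • X x) =
      fun s ω => sect l t ω • projFrom t (sect X) s ω := by
    ext s ω i
    by_cases hs : t ≤ s
    · simp only [projFrom, hs, if_true]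
      rw [← hl'.2.2 s hs]; rfl
    · simp [projFrom, hs]
  ext v
  simp only [mem_ofPred_eq]
  rw [mem_toOptional_iff, e3, e2, mem_MElig_optFilt_iff hcomplete hμ]
  constructor
  · rintro ⟨h1, ⟨h2, z, hz, hvz⟩, h3⟩
    have h1' : ∀ s, ∃ y, (s < t → sect v s ∈ MElig P (ℱ s) d m ∧ y ∈ R s (sect X s) ∧
        ∀ᵐ ω ∂P, sect v s ω = sect l s ω • y ω) := fun s => by
      by_cases hs : s < t
      · have h4 : sect v s ∈ _ := h1 s hs
        rw [show sect (fun x => l x • X x) s = fun ω => sect l s ω • sect X s ω from rfl,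
          e1 s hs] at h4
        obtain ⟨a, y, hy, hy'⟩ := h4
        exact ⟨y, fun _ => ⟨a, hy, hy'⟩⟩
      · exact ⟨0, fun h => absurd h hs⟩
    choose y hy using h1'
    refine ⟨⟨fun s hs => (hy s hs).1, h2, h3⟩, fun x => if x.2 < t then y x.2 x.1 else z x.1,
      ⟨y, z, fun s hs => (hy s hs).2.1, hz, rfl⟩, (ae_optMeasure_iff hcomplete hμ).2 fun s => ?_⟩
    by_cases hs : s < t
    · simp only [hs, if_true]
      exact (hy s hs).2.2
    · simp only [hs, if_false]
      filter_upwards [hvz] with ω h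
      have a := congrFun (h3 s (not_lt.1 hs)) ω
      have b := congrFun (hl'.2.2 s (not_lt.1 hs)) ω
      simp only [sect] at a b h
      rw [a, b, h]
  · rintro ⟨⟨h1, h2, h3⟩, u, hu, huv⟩
    have hu' := mem_toOptional_iff.1 hu
    have huv' := (ae_optMeasure_iff hcomplete hμ).1 huv
    refine ⟨fun s hs => ?_, ⟨h2, _, hu'.2.1, huv' t⟩, h3⟩
    rw [show sect (fun x => l x • X x) s = fun ω => sect l s ω • sect X s ω from rfl, e1 s hs]
    exact ⟨h1 s hs, _, hu'.1 s hs, huv' s⟩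

include hcomplete hμ hρ hR in
theorem toOptional_finiteAtZero :
    FiniteAtZero (optMeasure P ℱ μ) (optFilt ℱ t) m (toOptional t ρ R 0) := by
  have hp0 : projFrom t (sect (0 : Ω × Fin (T + 1) → Fin d → ℝ)) = 0 := by
    ext s ω i
    by_cases h : t ≤ s <;> simp [projFrom, sect, h]
  refine ⟨⟨0, zero_mem_toOptional hρ hR⟩, isClosed_value_of_closedGraph
    (toOptional_closedGraph hcomplete hμ hρ hR) zero_mem_LInf, fun A hA u hu v hv => ?_, ?_⟩
  · have hA' := measurableSet_optFilt_iff.1 hA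
    have hu' := mem_toOptional_iff.1 hu
    have hv' := mem_toOptional_iff.1 hv
    have key : ∀ s, sect (A.indicator u + Aᶜ.indicator v) s =
        {ω | (ω, s) ∈ A}.indicator (sect u s) + {ω | (ω, s) ∈ A}ᶜ.indicator (sect v s) :=
      fun s => by
        ext ω i
        by_cases h : (ω, s) ∈ A <;> simp [sect, h]
    refine mem_toOptional_iff.2 ⟨fun s hs => ?_, ?_, fun s hs => ?_⟩
    · rw [key]
      exact (hR s hs).finiteAtZero.decomposable _ (hA'.1 s hs) _ (hu'.1 s hs) _ (hv'.1 s hs)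
    · rw [key, hp0]
      rw [hp0] at hu' hv'
      exact hρ.finiteAtZero.decomposable _ hA'.2.1 _ hu'.2.1 _ hv'.2.1
    · rw [key, key, hu'.2.2 s hs, hv'.2.2 s hs]
      simp only [hA'.2.2 s hs]
  · have hK : ∀ s, ∃ K : Ω → Set (Fin d → ℝ), s < t →
        (∀ ω, IsClosed (K ω) ∧ K ω ⊆ eligible d m) ∧
        MeasurableSet[(ℱ s).prod inferInstance] {p : Ω × (Fin d → ℝ) | p.2 ∈ K p.1} ∧
        R s 0 = {u | u ∈ LInf P (ℱ s) d ∧ ∀ᵐ ω ∂P, u ω ∈ K ω} ∧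
        ∀ᵐ ω ∂P, K ω ≠ eligible d m := fun s => by
      by_cases hs : s < t
      · obtain ⟨K, hK⟩ := (hR s hs).finiteAtZero.randomSet
        exact ⟨K, fun _ => hK⟩
      · exact ⟨fun _ => ∅, fun h => absurd h hs⟩
    choose K hK using hK
    obtain ⟨L, hL1, hL2, hL3, hL4⟩ := hρ.finiteAtZero.randomSet
    refine ⟨fun x => if x.2 < t then K x.2 x.1 else L x.1, fun x => ?_, ?_, ?_, ?_⟩
    · by_cases hs : x.2 < t
      · simp only [hs, if_true]; exact (hK _ hs).1 x.1
      · simp only [hs, if_false]; exact hL1 x.1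
    · have : {p : (Ω × Fin (T + 1)) × (Fin d → ℝ) |
          p.2 ∈ if p.1.2 < t then K p.1.2 p.1.1 else L p.1.1} =
          (⋃ s : Iio t, {p : (Ω × Fin (T + 1)) × (Fin d → ℝ) | p.1.2 ∈ ({s.1} : Set (Fin (T + 1))) ∧
            (p.1.1, p.2) ∈ {p : Ω × (Fin d → ℝ) | p.2 ∈ K s p.1}}) ∪
          {p : (Ω × Fin (T + 1)) × (Fin d → ℝ) | p.1.2 ∈ Ici t ∧
            (p.1.1, p.2) ∈ {p : Ω × (Fin d → ℝ) | p.2 ∈ L p.1}} := by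
        ext ⟨⟨ω, s⟩, x⟩
        by_cases hs : s < t
        · simp [hs, not_le.2 hs]
        · simp [hs, not_lt.1 hs]
      rw [this]
      refine @MeasurableSet.union _ ((optFilt ℱ t).prod inferInstance) _ _ ?_ ?_
      · refine @MeasurableSet.iUnion _ _ ((optFilt ℱ t).prod inferInstance) _ _ fun s => ?_
        exact measurableSet_stratum (fun D hD => MeasurableSpace.measurableSet_generateFrom
          (Or.inl ⟨s, s.2, D, hD, rfl⟩)) (hK s s.2).2.1
      · exact measurableSet_stratum (fun D hD => MeasurableSpace.measurableSet_generateFrom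
          (Or.inr ⟨D, hD, rfl⟩)) hL2
    · ext u
      rw [mem_toOptional_iff, hp0, hL3]
      simp only [mem_ofPred_eq, mem_LInf_optFilt_iff hcomplete hμ, ae_optMeasure_iff hcomplete hμ]
      constructor
      · rintro ⟨h1, h2, h3⟩
        have h1' : ∀ s < t, _ := fun s hs => by
          have h := h1 s hs
          rw [show sect (0 : Ω × Fin (T + 1) → Fin d → ℝ) s = 0 from rfl, (hK s hs).2.2.1] at h
          exact h
        refine ⟨⟨fun s hs => (h1' s hs).1, h2.1, h3⟩, fun s => ?_⟩
        by_cases hs : s < t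
        · simp only [hs, if_true]; exact (h1' s hs).2
        · simp only [hs, if_false]
          have h4 := h2.2
          rw [← h3 s (not_lt.1 hs)] at h4
          exact h4
      · rintro ⟨⟨h1, h2, h3⟩, h4⟩
        refine ⟨fun s hs => ?_, ⟨h2, ?_⟩, h3⟩
        · rw [show sect (0 : Ω × Fin (T + 1) → Fin d → ℝ) s = 0 from rfl, (hK s hs).2.2.1]
          refine ⟨h1 s hs, ?_⟩
          have := h4 s
          simp only [hs, if_true] at this
          exact this
        · have := h4 t
          simp only [lt_irrefl, if_false] at this
          exact this
    · refine (ae_optMeasure_iff hcomplete hμ).2 fun s => ?_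
      by_cases hs : s < t
      · simp only [hs, if_true]; exact (hK s hs).2.2.2
      · simp only [hs, if_false]; exact hL4

include hcomplete hμ hρ hR in
theorem isClosedCoherentVec_toOptional :
    IsClosedCoherentVec (optMeasure P ℱ μ) (optSigma ℱ) (optFilt ℱ t) m (toOptional t ρ R) where
  upper X hX := toOptional_upper hcomplete hμ hρ hR hX
  cashInvariant X hX u hu := toOptional_cashInvariant hcomplete hμ hρ hR hX hu
  monotone X hX Y hY hXY u hu := by
    have hX' := (mem_LInf_optSigma_iff hcomplete hμ).1 hX
    have hY' := (mem_LInf_optSigma_iff hcomplete hμ).1 hY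
    have h := (ae_optMeasure_iff hcomplete hμ).1 hXY
    have hu' := mem_toOptional_iff.1 hu
    refine mem_toOptional_iff.2 ⟨fun s hs => (hR s hs).monotone _ (hX' s) _ (hY' s) (h s)
      (hu'.1 s hs), hρ.monotone _ (projFrom_mem_ProcInf hX') _ (projFrom_mem_ProcInf hY')
      (fun s => ?_) hu'.2.1, hu'.2.2⟩
    by_cases hs : t ≤ s
    · simp only [projFrom, hs, if_true]; exact h s
    · simp [projFrom, hs]
  finiteAtZero := toOptional_finiteAtZero hcomplete hμ hρ hR
  closedUpper _ hX := closedUpper_of_closedGraph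
    (fun _ hX => toOptional_upper hcomplete hμ hρ hR hX)
    (fun _ hX _ hY _ hl hl01 _ hu _ hv =>
      toOptional_condConvex hcomplete hμ hρ hR hX hY hl hl01 hu hv)
    (toOptional_closedGraph hcomplete hμ hρ hR) hX
  condConvex X hX Y hY l hl hl01 u hu v hv :=
    toOptional_condConvex hcomplete hμ hρ hR hX hY hl hl01 hu hv
  condPosHom X hX l hl hl0 hC := toOptional_condPosHom hcomplete hμ hρ hR hX hl hl0 hC
  closedGraph := toOptional_closedGraph hcomplete hμ hρ hR

end ToOptional

/-! ### Processes and one-time vectors extracted from the optional filtration -/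

section FromOptional

variable {Ω : Type*} {mΩ : MeasurableSpace Ω} {P : Measure Ω} {T d m : ℕ}
  {ℱ : Filtration (Fin (T + 1)) mΩ} {s t : Fin (T + 1)} {μ : Fin (T + 1) → Ω → ℝ}
  {Rbar : (Ω × Fin (T + 1) → Fin d → ℝ) → Set (Ω × Fin (T + 1) → Fin d → ℝ)}
  {ρ : (Fin (T + 1) → Ω → Fin d → ℝ) → Set (Ω → Fin d → ℝ)}

theorem closedUpper_of_closedGraph_proc
    (hu : ∀ X ∈ ProcInf P ℱ d t, ρ X ∈ upperSets P (ℱ t) d m)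
    (hconv : ∀ X ∈ ProcInf P ℱ d t, ∀ Y ∈ ProcInf P ℱ d t, ∀ l : Ω → ℝ, Measurable[ℱ t] l →
    (∀ᵐ ω ∂P, 0 ≤ l ω ∧ l ω ≤ 1) → ∀ u ∈ ρ X, ∀ v ∈ ρ Y,
      (fun ω => l ω • u ω + (1 - l ω) • v ω) ∈ ρ (fun s ω => l ω • X s ω + (1 - l ω) • Y s ω))
    (h : IsClosed[@instTopologicalSpaceProd _ _
      (procTop P ℱ d t) (weakStar P (ℱ t) (MElig P (ℱ t) d m))]
    {p : (ProcInf P ℱ d t) × (MElig P (ℱ t) d m) | (p.2 : Ω → Fin d → ℝ) ∈ ρ p.1})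
    {X : Fin (T + 1) → Ω → Fin d → ℝ} (hX : X ∈ ProcInf P ℱ d t) :
    IsClosed[weakStar P (ℱ t) (MElig P (ℱ t) d m)] (Subtype.val ⁻¹' ρ X) ∧
      ρ X ∈ closedUpperSets P (ℱ t) d m := by
  have hcl : IsClosed[weakStar P (ℱ t) (MElig P (ℱ t) d m)] (Subtype.val ⁻¹' ρ X) := by
    let t1 : TopologicalSpace (ProcInf P ℱ d t) := procTop P ℱ d t
    let t2 := weakStar P (ℱ t) (MElig P (ℱ t) d m)
    have hc : Continuous fun x : MElig P (ℱ t) d m => ((⟨X, hX⟩ : ProcInf P ℱ d t), x) :=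
      Continuous.prodMk continuous_const continuous_id
    exact h.preimage hc
  refine ⟨hcl, mem_closedUpperSets (hu X hX) (fun u hu v hv a b ha hb hab => ?_) hcl⟩
  obtain rfl : b = 1 - a := by linarith
  have := hconv X hX X hX (fun _ => a) measurable_const
    (Filter.Eventually.of_forall fun _ => ⟨ha, by linarith⟩) u hu v hv
  have e : (fun s ω => a • X s ω + (1 - a) • X s ω) = X := by
    ext s ω i
    simp only [Pi.add_apply, Pi.smul_apply, smul_eq_mul]
    ring
  rw [e] at this
  exact this

/-- The slices of the graph of a random set over the optional filtration do not depend on the time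
after `t`. -/
theorem mem_randomSet_iff_of_le {K : Ω × Fin (T + 1) → Set (Fin d → ℝ)}
    (hK : MeasurableSet[(optFilt ℱ t).prod inferInstance]
      {p : (Ω × Fin (T + 1)) × (Fin d → ℝ) | p.2 ∈ K p.1}) {r : Fin (T + 1)} (hr : t ≤ r) (ω : Ω)
    (x : Fin d → ℝ) : x ∈ K (ω, r) ↔ x ∈ K (ω, t) := by
  have : @Measurable _ _ (optFilt ℱ t) ((optFilt ℱ t).prod inferInstance)
      fun y : Ω × Fin (T + 1) => (y, x) := @measurable_prodMk_right _ _ (optFilt ℱ t) _ x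
  exact mem_optFilt_iff_of_le (this hK) hr ω

theorem measurableSet_randomSet_slice {K : Ω × Fin (T + 1) → Set (Fin d → ℝ)}
    (hK : MeasurableSet[(optFilt ℱ t).prod inferInstance]
      {p : (Ω × Fin (T + 1)) × (Fin d → ℝ) | p.2 ∈ K p.1}) {F : MeasurableSpace Ω}
    (hs : @Measurable Ω (Ω × Fin (T + 1)) F (optFilt ℱ t) fun ω => (ω, s)) :
    MeasurableSet[F.prod inferInstance] {p : Ω × (Fin d → ℝ) | p.2 ∈ K (p.1, s)} := by
  have : @Measurable _ _ (F.prod inferInstance) ((optFilt ℱ t).prod inferInstance)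
      fun p : Ω × (Fin d → ℝ) => ((p.1, s), p.2) :=
    @Measurable.prodMk _ (F.prod inferInstance) _ _ (optFilt ℱ t) _ _ _
      (hs.comp (@measurable_fst _ _ F _)) (@measurable_snd _ _ F _)
  exact this hK

variable [IsProbabilityMeasure P]
  (hcomplete : ∀ A : Set Ω, P A = 0 → MeasurableSet[ℱ 0] A) (hμ : IsReference P ℱ μ)
  (hR : IsClosedCoherentVec (optMeasure P ℱ μ) (optSigma ℱ) (optFilt ℱ t) m Rbar)

include hcomplete hμ in
theorem ae_iff_of_stepFrom {l : Ω → ℝ} {c : ℝ} {p : ℝ → Prop} (hc : p c) :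
    (∀ᵐ x ∂(optMeasure P ℱ μ), p (if t ≤ x.2 then l x.1 else c)) ↔ ∀ᵐ ω ∂P, p (l ω) := by
  rw [ae_optMeasure_iff hcomplete hμ]
  constructor
  · intro h; simpa using h t
  · intro h s
    by_cases hs : t ≤ s
    · simpa [hs] using h
    · simp [hs, hc]

theorem measurable_stepFrom {l : Ω → ℝ} (hl : Measurable[ℱ t] l) (c : ℝ) :
    Measurable[optFilt ℱ t] fun x : Ω × Fin (T + 1) => if t ≤ x.2 then l x.1 else c := by
  refine measurable_optFilt_iff.2 ⟨fun s hs => ?_, ?_, fun s hs => ?_⟩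
  · rw [show sect (fun x : Ω × Fin (T + 1) => if t ≤ x.2 then l x.1 else c) s = fun _ => c by
      ext; simp [sect, not_le.2 hs]]
    exact measurable_const
  · rw [show sect (fun x : Ω × Fin (T + 1) => if t ≤ x.2 then l x.1 else c) t = l by
      ext; simp [sect]]
    exact hl
  · ext; simp [sect, hs]

theorem measurable_spike (hs : s < t) {l : Ω → ℝ} (hl : Measurable[ℱ s] l) (c : ℝ) :
    Measurable[optFilt ℱ t] fun x : Ω × Fin (T + 1) => if x.2 = s then l x.1 else c := by
  refine measurable_optFilt_iff.2 ⟨fun r _ => ?_, ?_, fun r hr => ?_⟩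
  · by_cases h : r = s
    · subst h
      rw [show sect (fun x : Ω × Fin (T + 1) => if x.2 = r then l x.1 else c) r = l by
        ext; simp [sect]]
      exact hl
    · rw [show sect (fun x : Ω × Fin (T + 1) => if x.2 = s then l x.1 else c) r = fun _ => c by
        ext; simp [sect, h]]
      exact measurable_const
  · rw [show sect (fun x : Ω × Fin (T + 1) => if x.2 = s then l x.1 else c) t = fun _ => c by
      ext; simp [sect, hs.ne']]
    exact measurable_const
  · ext; simp [sect, hs.ne', (hs.trans_le hr).ne']

include hcomplete hμ in
theorem ae_iff_of_spike {l : Ω → ℝ} {c : ℝ} {p : ℝ → Prop} (hc : p c) :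
    (∀ᵐ x ∂(optMeasure P ℱ μ), p (if x.2 = s then l x.1 else c)) ↔ ∀ᵐ ω ∂P, p (l ω) := by
  rw [ae_optMeasure_iff hcomplete hμ]
  constructor
  · intro h; simpa using h s
  · intro h r
    by_cases hs : r = s
    · simpa [hs] using h
    · simp [hs, hc]

include hcomplete hμ hR in
-- The definition allows any optional portfolio with section `z` at `t`. Multiplying the accepted
-- position by `1_{𝕋_t}`, which is measurable at time `t`, removes whatever the portfolio does
-- before `t`, so the one vanishing there may be used.
theorem mem_toProc_iff {X : Fin (T + 1) → Ω → Fin d → ℝ} (hX : X ∈ ProcInf P ℱ d t)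
    {z : Ω → Fin d → ℝ} : z ∈ toProc t Rbar X ↔ stepFrom t z ∈ Rbar (embed t X) := by
  constructor
  · rintro ⟨u, hu, rfl⟩
    have hY := embed_mem_LInf hcomplete hμ hX
    change u ∈ Rbar (embed t X) at hu
    have huM := (hR.upper _ hY).1 hu
    have huM' := (mem_MElig_optFilt_iff hcomplete hμ).1 huM
    have h := hR.acc_smul_fun ((hR.mem_iff optFilt_le_optSigma hY huM).1 hu)
      (measurable_stepFrom (t := t) (l := fun _ => 1) measurable_const 0)
      ((ae_iff_of_stepFrom hcomplete hμ (p := fun x => 0 ≤ x) le_rfl).2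
        (Filter.Eventually.of_forall fun _ => zero_le_one))
      ((ae_iff_of_stepFrom hcomplete hμ (p := fun x => x ≤ 1) zero_le_one).2
        (Filter.Eventually.of_forall fun _ => le_rfl))
      optFilt_le_optSigma
    refine (hR.mem_iff optFilt_le_optSigma hY
      ((stepFrom_mem_MElig_iff hcomplete hμ).2 huM'.2.1)).2 ?_
    convert h using 1
    ext ⟨ω, s⟩ i
    by_cases hs : t ≤ s
    · have := congrFun (huM'.2.2 s hs) ω
      simp only [sect] at this
      simp [embed, stepFrom, hs, this, sect]
    · simp [embed, stepFrom, hs]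
  · exact fun h => ⟨_, h, sect_stepFrom_of_le le_rfl z⟩

include hcomplete hμ hR in
-- For `s < t` the set `Ω × {s}` belongs to the optional filtration at time `t`; localizing to it
-- discards all other times of the portfolio.
theorem mem_toRestr_iff (hs : s < t) {Z : Ω → Fin d → ℝ} (hZ : Z ∈ LInf P (ℱ s) d)
    {z : Ω → Fin d → ℝ} : z ∈ toRestr Rbar s Z ↔ spike s z ∈ Rbar (spike s Z) := by
  constructor
  · rintro ⟨u, hu, rfl⟩
    have hY := spike_mem_LInf hcomplete hμ hZ
    change u ∈ Rbar (spike s Z) at hu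
    have huM := (hR.upper _ hY).1 hu
    have huM' := (mem_MElig_optFilt_iff hcomplete hμ).1 huM
    have h := hR.acc_smul_fun ((hR.mem_iff optFilt_le_optSigma hY huM).1 hu)
      (measurable_spike hs (l := fun _ => 1) measurable_const 0)
      ((ae_iff_of_spike hcomplete hμ (p := fun x => 0 ≤ x) le_rfl).2
        (Filter.Eventually.of_forall fun _ => zero_le_one))
      ((ae_iff_of_spike hcomplete hμ (p := fun x => x ≤ 1) zero_le_one).2
        (Filter.Eventually.of_forall fun _ => le_rfl))
      optFilt_le_optSigma
    refine (hR.mem_iff optFilt_le_optSigma hY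
      ((spike_mem_MElig_iff hcomplete hμ hs).2 (huM'.1 s hs))).2 ?_
    convert h using 1
    ext ⟨ω, r⟩ i
    by_cases hr : r = s
    · subst hr; simp [spike, sect]
    · simp [spike, hr]
  · exact fun h => ⟨_, h, sect_spike_self z⟩

theorem embed_smul_add (l k : Ω → ℝ) (c e : ℝ) (X Y : Fin (T + 1) → Ω → Fin d → ℝ) :
    embed t (fun s ω => l ω • X s ω + k ω • Y s ω) =
      fun x => (if t ≤ x.2 then l x.1 else c) • embed t X x +
        (if t ≤ x.2 then k x.1 else e) • embed t Y x := by
  ext ⟨ω, s⟩ i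
  by_cases hs : t ≤ s <;> simp [embed, hs]

include hcomplete hμ hR in
theorem toProc_upper {X : Fin (T + 1) → Ω → Fin d → ℝ} (hX : X ∈ ProcInf P ℱ d t) :
    toProc t Rbar X ∈ upperSets P (ℱ t) d m := by
  have hY := embed_mem_LInf hcomplete hμ hX
  have hsub : toProc t Rbar X ⊆ MElig P (ℱ t) d m := fun z hz =>
    (stepFrom_mem_MElig_iff hcomplete hμ).1
      ((hR.upper _ hY).1 ((mem_toProc_iff hcomplete hμ hR hX).1 hz))
  refine ⟨hsub, Subset.antisymm (fun u hu => ⟨u, hu, 0, zero_mem_MPos, add_zero u⟩) ?_⟩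
  rintro _ ⟨u, hu, c, hc, rfl⟩
  refine (mem_toProc_iff hcomplete hμ hR hX).2 <| hR.upper_mem hY
    ((mem_toProc_iff hcomplete hμ hR hX).1 hu)
    ((stepFrom_mem_MElig_iff hcomplete hμ).2 (add_mem_MElig (hsub hu) hc.1))
    ((ae_optMeasure_iff hcomplete hμ).2 fun s => hc.2.mono fun ω h i => ?_)
  by_cases hs : t ≤ s <;> simp [stepFrom, hs, h i]

include hcomplete hμ hR in
theorem toProc_closedGraph : IsClosed[@instTopologicalSpaceProd _ _
      (procTop P ℱ d t) (weakStar P (ℱ t) (MElig P (ℱ t) d m))]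
    {p : (ProcInf P ℱ d t) × (MElig P (ℱ t) d m) |
      (p.2 : Ω → Fin d → ℝ) ∈ toProc t Rbar p.1} := by
  let t1 := weakStar (optMeasure P ℱ μ) (optSigma ℱ) (LInf (optMeasure P ℱ μ) (optSigma ℱ) d)
  let t2 := weakStar (optMeasure P ℱ μ) (optFilt ℱ t)
    (MElig (optMeasure P ℱ μ) (optFilt ℱ t) d m)
  let t4 := weakStar P (ℱ t) (MElig P (ℱ t) d m)
  let t5 := procTop P ℱ d t
  have h := IsClosed.preimage (((continuous_embed (d := d) (t := t) hcomplete hμ).comp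
    continuous_fst).prodMk ((continuous_stepFrom (m := m) hcomplete hμ).comp continuous_snd))
    hR.closedGraph
  convert h using 1
  ext p
  exact mem_toProc_iff hcomplete hμ hR p.1.2

include hcomplete hμ hR in
theorem toProc_condConvex {X Y : Fin (T + 1) → Ω → Fin d → ℝ} (hX : X ∈ ProcInf P ℱ d t)
    (hY : Y ∈ ProcInf P ℱ d t) {l : Ω → ℝ} (hl : Measurable[ℱ t] l)
    (hl01 : ∀ᵐ ω ∂P, 0 ≤ l ω ∧ l ω ≤ 1) {u v : Ω → Fin d → ℝ} (hu : u ∈ toProc t Rbar X)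
    (hv : v ∈ toProc t Rbar Y) : (fun ω => l ω • u ω + (1 - l ω) • v ω) ∈
      toProc t Rbar (fun s ω => l ω • X s ω + (1 - l ω) • Y s ω) := by
  -- Before `t` the convex weight may be any number in `[0, 1]`, since both positions vanish there;
  -- it is taken to be zero.
  refine ⟨fun x => (if t ≤ x.2 then l x.1 else 0) • stepFrom t u x +
      (1 - if t ≤ x.2 then l x.1 else 0) • stepFrom t v x, ?_, ?_⟩
  · have := hR.condConvex _ (embed_mem_LInf hcomplete hμ hX) _ (embed_mem_LInf hcomplete hμ hY)
      _ (measurable_stepFrom hl 0)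
      ((ae_iff_of_stepFrom hcomplete hμ (p := fun x => 0 ≤ x ∧ x ≤ 1) (by simp)).2 hl01)
      _ ((mem_toProc_iff hcomplete hμ hR hX).1 hu) _ ((mem_toProc_iff hcomplete hμ hR hY).1 hv)
    convert this using 2
    refine (embed_smul_add l (fun ω => 1 - l ω) 0 1 X Y).trans (funext fun x => ?_)
    by_cases h : t ≤ x.2 <;> simp [h]
  · ext; simp [sect, stepFrom]

include hcomplete hμ hR in
theorem toProc_condPosHom {X : Fin (T + 1) → Ω → Fin d → ℝ} (hX : X ∈ ProcInf P ℱ d t)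
    {l : Ω → ℝ} (hl : Measurable[ℱ t] l) (hl0 : ∀ᵐ ω ∂P, 0 < l ω)
    (hC : ∃ C : ℝ, ∀ᵐ ω ∂P, l ω ≤ C) :
    toProc t Rbar (fun s ω => l ω • X s ω) =
      {v | v ∈ MElig P (ℱ t) d m ∧ ∃ u ∈ toProc t Rbar X, ∀ᵐ ω ∂P, v ω = l ω • u ω} := by
  obtain ⟨C, hC⟩ := hC
  -- Here the multiplier is extended by one before `t`, because homogeneity requires it to be
  -- strictly positive everywhere.
  have h := hR.condPosHom _ (embed_mem_LInf hcomplete hμ hX) _ (measurable_stepFrom hl 1)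
    ((ae_iff_of_stepFrom hcomplete hμ (p := fun x => 0 < x) one_pos).2 hl0)
    ⟨max C 1, (ae_iff_of_stepFrom hcomplete hμ (p := fun x => x ≤ max C 1) (le_max_right _ _)).2
      (hC.mono fun _ h => h.trans (le_max_left _ _))⟩
  have e : embed t (fun s ω => l ω • X s ω) =
      fun x => (if t ≤ x.2 then l x.1 else 1) • embed t X x := by
    ext ⟨ω, s⟩ i
    by_cases hs : t ≤ s <;> simp [embed, hs]
  rw [← e] at h
  change (fun u => sect u t) '' Rbar (embed t fun s ω => l ω • X s ω) = _
  rw [h]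
  ext v
  constructor
  · rintro ⟨v, ⟨hv, u, hu, huv⟩, rfl⟩
    refine ⟨((mem_MElig_optFilt_iff hcomplete hμ).1 hv).2.1, sect u t, ⟨u, hu, rfl⟩, ?_⟩
    simpa [sect] using (ae_optMeasure_iff hcomplete hμ).1 huv t
  · rintro ⟨hv, u, hu, huv⟩
    refine ⟨stepFrom t v, ⟨(stepFrom_mem_MElig_iff hcomplete hμ).2 hv, stepFrom t u,
      (mem_toProc_iff hcomplete hμ hR hX).1 hu, (ae_optMeasure_iff hcomplete hμ).2 fun s => ?_⟩,
      sect_stepFrom_of_le le_rfl v⟩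
    filter_upwards [huv] with ω h
    by_cases hs : t ≤ s <;> simp [stepFrom, hs, h]

include hcomplete hμ hR in
theorem isClosedCoherentProc_toProc : IsClosedCoherentProc P ℱ m t (toProc t Rbar) := by
  have hup := fun X (hX : X ∈ ProcInf P ℱ d t) => toProc_upper hcomplete hμ hR hX
  have hconv : ∀ X ∈ ProcInf P ℱ d t, ∀ Y ∈ ProcInf P ℱ d t, _ := fun X hX Y hY l hl hl01 u hu v hv =>
    toProc_condConvex hcomplete hμ hR hX hY (l := l) hl hl01 (u := u) (v := v) hu hv
  have hgraph := toProc_closedGraph hcomplete hμ hR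
  have hz : (0 : Fin (T + 1) → Ω → Fin d → ℝ) ∈ ProcInf P ℱ d t :=
    ⟨fun _ => zero_mem_LInf, fun _ _ => rfl⟩
  have e0 : embed t (0 : Fin (T + 1) → Ω → Fin d → ℝ) = 0 := by
    ext; simp [embed]
  have s0 : stepFrom (T := T) t (0 : Ω → Fin d → ℝ) = 0 := by
    ext; simp [stepFrom]
  have hmem := fun X hX => @mem_toProc_iff _ _ P T d m ℱ t μ Rbar _ hcomplete hμ hR X hX
  refine ⟨⟨hup, fun X hX u hu => ?_, fun X hX Y hY hXY u hu => ?_, ⟨⟨0, ?_⟩, ?_, ?_, ?_⟩⟩,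
    fun X hX => (closedUpper_of_closedGraph_proc hup hconv hgraph hX).2, hconv,
    fun X hX l hl hl0 hC => toProc_condPosHom hcomplete hμ hR hX hl hl0 hC, hgraph⟩
  · have e : embed t (X + constFrom t u) = embed t X + stepFrom t u := by
      ext ⟨ω, s⟩ i
      by_cases hs : t ≤ s <;> simp [embed, stepFrom, constFrom, hs]
    have hXu : X + constFrom t u ∈ ProcInf P ℱ d t :=
      ⟨fun s => add_mem_LInf (hX.1 s) ((constFrom_mem_ProcInf hu.1).1 s),
        fun s hs => by
          rw [Pi.add_apply, hX.2 s hs, (constFrom_mem_ProcInf (P := P) (ℱ := ℱ) hu.1).2 s hs,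
            add_zero]⟩
    ext v
    rw [mem_image_sub_iff, hmem _ hXu, hmem _ hX, e, hR.cashInvariant _
      (embed_mem_LInf hcomplete hμ hX) _ ((stepFrom_mem_MElig_iff hcomplete hμ).2 hu),
      mem_image_sub_iff]
    have : stepFrom (T := T) t v + stepFrom t u = stepFrom t (v + u) := by
      ext ⟨ω, s⟩ i
      by_cases hs : t ≤ s <;> simp [stepFrom, hs]
    rw [this]
  · rw [hmem _ hY]
    refine hR.monotone _ (embed_mem_LInf hcomplete hμ hX) _ (embed_mem_LInf hcomplete hμ hY)
      ((ae_optMeasure_iff hcomplete hμ).2 fun s => (hXY s).mono fun ω h i => ?_) ((hmem _ hX).1 hu)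
    by_cases hs : t ≤ s <;> simp [embed, hs, h i]
  · rw [hmem _ hz, e0, s0]; exact hR.zero_mem
  · exact (closedUpper_of_closedGraph_proc hup hconv hgraph hz).1
  · intro A hA u hu v hv
    rw [hmem _ hz, e0] at hu hv ⊢
    have := hR.finiteAtZero.decomposable (A ×ˢ Ici t)
      (MeasurableSpace.measurableSet_generateFrom (Or.inr ⟨A, hA, rfl⟩)) _ hu _ hv
    convert this using 1
    ext ⟨ω, s⟩ i
    by_cases hs : t ≤ s <;> by_cases h : ω ∈ A <;> simp [stepFrom, hs, h]
  · obtain ⟨K, hK1, hK2, hK3, hK4⟩ := hR.finiteAtZero.randomSet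
    -- A selection at time `t` is extended by zero before `t`; it remains a selection of `K` because
    -- zero is one.
    have hK0 := hR.zero_mem
    rw [hK3] at hK0
    have hK0' := (ae_optMeasure_iff hcomplete hμ).1 hK0.2
    refine ⟨fun ω => K (ω, t), fun ω => hK1 _, measurableSet_randomSet_slice hK2
      (measurable_mk_optFilt_of_le le_rfl), ?_, (ae_optMeasure_iff hcomplete hμ).1 hK4 t⟩
    ext u
    rw [hmem _ hz, e0, hK3]
    simp only [mem_ofPred_eq, mem_LInf_optFilt_iff hcomplete hμ, ae_optMeasure_iff hcomplete hμ]
    constructor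
    · rintro ⟨⟨-, h, -⟩, h2⟩
      rw [sect_stepFrom_of_le le_rfl] at h
      exact ⟨h, by simpa [stepFrom] using h2 t⟩
    · rintro ⟨h1, h2⟩
      refine ⟨⟨fun s hs => ?_, ?_, fun s hs => ?_⟩, fun s => ?_⟩
      · rw [sect_stepFrom_of_lt hs]; exact zero_mem_LInf
      · rwa [sect_stepFrom_of_le le_rfl]
      · rw [sect_stepFrom_of_le le_rfl, sect_stepFrom_of_le hs]
      · by_cases hs : t ≤ s
        · filter_upwards [h2] with ω h
          simp only [stepFrom, hs, if_true]
          exact (mem_randomSet_iff_of_le hK2 hs ω _).2 h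
        · filter_upwards [hK0' s] with ω h
          simp only [stepFrom, hs, if_false]
          exact h

include hcomplete hμ hR in
theorem toRestr_upper (hs : s < t) {X : Ω → Fin d → ℝ} (hX : X ∈ LInf P (ℱ s) d) :
    toRestr Rbar s X ∈ upperSets P (ℱ s) d m := by
  have hY := spike_mem_LInf hcomplete hμ hX
  have hsub : toRestr Rbar s X ⊆ MElig P (ℱ s) d m := fun z hz =>
    (spike_mem_MElig_iff hcomplete hμ hs).1
      ((hR.upper _ hY).1 ((mem_toRestr_iff hcomplete hμ hR hs hX).1 hz))
  refine ⟨hsub, Subset.antisymm (fun u hu => ⟨u, hu, 0, zero_mem_MPos, add_zero u⟩) ?_⟩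
  rintro _ ⟨u, hu, c, hc, rfl⟩
  refine (mem_toRestr_iff hcomplete hμ hR hs hX).2 <| hR.upper_mem hY
    ((mem_toRestr_iff hcomplete hμ hR hs hX).1 hu)
    ((spike_mem_MElig_iff hcomplete hμ hs).2 (add_mem_MElig (hsub hu) hc.1))
    ((ae_optMeasure_iff hcomplete hμ).2 fun r => hc.2.mono fun ω h i => ?_)
  by_cases hr : r = s <;> simp [spike, hr, h i]

include hcomplete hμ hR in
theorem toRestr_closedGraph (hs : s < t) : IsClosed[@instTopologicalSpaceProd _ _
      (weakStar P (ℱ s) (LInf P (ℱ s) d)) (weakStar P (ℱ s) (MElig P (ℱ s) d m))]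
    {p : (LInf P (ℱ s) d) × (MElig P (ℱ s) d m) |
      (p.2 : Ω → Fin d → ℝ) ∈ toRestr Rbar s p.1} := by
  let t1 := weakStar (optMeasure P ℱ μ) (optSigma ℱ) (LInf (optMeasure P ℱ μ) (optSigma ℱ) d)
  let t2 := weakStar (optMeasure P ℱ μ) (optFilt ℱ t)
    (MElig (optMeasure P ℱ μ) (optFilt ℱ t) d m)
  let t4 := weakStar P (ℱ s) (MElig P (ℱ s) d m)
  let t5 := weakStar P (ℱ s) (LInf P (ℱ s) d)
  have h := IsClosed.preimage (((continuous_spike (d := d) (s := s) hcomplete hμ).comp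
    continuous_fst).prodMk ((continuous_spike_MElig (m := m) hcomplete hμ hs).comp continuous_snd))
    hR.closedGraph
  convert h using 1
  ext p
  exact mem_toRestr_iff hcomplete hμ hR hs p.1.2

include hcomplete hμ hR in
theorem toRestr_condConvex (hs : s < t) {X Y : Ω → Fin d → ℝ} (hX : X ∈ LInf P (ℱ s) d)
    (hY : Y ∈ LInf P (ℱ s) d) {l : Ω → ℝ} (hl : Measurable[ℱ s] l)
    (hl01 : ∀ᵐ ω ∂P, 0 ≤ l ω ∧ l ω ≤ 1) {u v : Ω → Fin d → ℝ} (hu : u ∈ toRestr Rbar s X)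
    (hv : v ∈ toRestr Rbar s Y) : (fun ω => l ω • u ω + (1 - l ω) • v ω) ∈
      toRestr Rbar s (fun ω => l ω • X ω + (1 - l ω) • Y ω) := by
  refine ⟨fun x => (if x.2 = s then l x.1 else 0) • spike s u x +
      (1 - if x.2 = s then l x.1 else 0) • spike s v x, ?_, ?_⟩
  · have := hR.condConvex _ (spike_mem_LInf hcomplete hμ hX) _ (spike_mem_LInf hcomplete hμ hY)
      _ (measurable_spike hs hl 0)
      ((ae_iff_of_spike hcomplete hμ (p := fun x => 0 ≤ x ∧ x ≤ 1) (by simp)).2 hl01)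
      _ ((mem_toRestr_iff hcomplete hμ hR hs hX).1 hu) _
      ((mem_toRestr_iff hcomplete hμ hR hs hY).1 hv)
    convert this using 2
    funext x
    by_cases h : x.2 = s <;> simp [h, spike]
  · ext; simp [sect, spike]

include hcomplete hμ hR in
theorem toRestr_condPosHom (hs : s < t) {X : Ω → Fin d → ℝ} (hX : X ∈ LInf P (ℱ s) d)
    {l : Ω → ℝ} (hl : Measurable[ℱ s] l) (hl0 : ∀ᵐ ω ∂P, 0 < l ω)
    (hC : ∃ C : ℝ, ∀ᵐ ω ∂P, l ω ≤ C) :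
    toRestr Rbar s (fun ω => l ω • X ω) =
      {v | v ∈ MElig P (ℱ s) d m ∧ ∃ u ∈ toRestr Rbar s X, ∀ᵐ ω ∂P, v ω = l ω • u ω} := by
  obtain ⟨C, hC⟩ := hC
  have h := hR.condPosHom _ (spike_mem_LInf hcomplete hμ hX) _ (measurable_spike hs hl 1)
    ((ae_iff_of_spike hcomplete hμ (p := fun x => 0 < x) one_pos).2 hl0)
    ⟨max C 1, (ae_iff_of_spike hcomplete hμ (p := fun x => x ≤ max C 1) (le_max_right _ _)).2
      (hC.mono fun _ h => h.trans (le_max_left _ _))⟩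
  have e : spike s (fun ω => l ω • X ω) =
      fun x => (if x.2 = s then l x.1 else 1) • spike s X x := by
    ext ⟨ω, r⟩ i
    by_cases hs : r = s <;> simp [spike, hs]
  rw [← e] at h
  change (fun u => sect u s) '' Rbar (spike s fun ω => l ω • X ω) = _
  rw [h]
  ext v
  constructor
  · rintro ⟨v, ⟨hv, u, hu, huv⟩, rfl⟩
    refine ⟨((mem_MElig_optFilt_iff hcomplete hμ).1 hv).1 s hs, sect u s, ⟨u, hu, rfl⟩, ?_⟩
    simpa [sect] using (ae_optMeasure_iff hcomplete hμ).1 huv s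
  · rintro ⟨hv, u, hu, huv⟩
    refine ⟨spike s v, ⟨(spike_mem_MElig_iff hcomplete hμ hs).2 hv, spike s u,
      (mem_toRestr_iff hcomplete hμ hR hs hX).1 hu, (ae_optMeasure_iff hcomplete hμ).2 fun r => ?_⟩,
      sect_spike_self v⟩
    filter_upwards [huv] with ω h
    by_cases hr : r = s <;> simp [spike, hr, h]

include hcomplete hμ hR in
theorem isClosedCoherentVec_toRestr (hs : s < t) :
    IsClosedCoherentVec P (ℱ s) (ℱ s) m (toRestr Rbar s) := by
  have hup := fun X (hX : X ∈ LInf P (ℱ s) d) => toRestr_upper hcomplete hμ hR hs hX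
  have hconv : ∀ X ∈ LInf P (ℱ s) d, ∀ Y ∈ LInf P (ℱ s) d, _ := fun X hX Y hY l hl hl01 u hu v hv =>
    toRestr_condConvex hcomplete hμ hR hs hX hY (l := l) hl hl01 (u := u) (v := v) hu hv
  have hgraph := toRestr_closedGraph hcomplete hμ hR hs
  have hz : (0 : Ω → Fin d → ℝ) ∈ LInf P (ℱ s) d := zero_mem_LInf
  have e0 : spike (T := T) s (0 : Ω → Fin d → ℝ) = 0 := by
    ext; simp [spike]
  have hmem := fun X hX => @mem_toRestr_iff _ _ P T d m ℱ s t μ Rbar _ hcomplete hμ hR hs X hX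
  have hadd : ∀ u v : Ω → Fin d → ℝ, spike (T := T) s u + spike s v = spike s (u + v) := by
    intro u v
    ext ⟨ω, r⟩ i
    by_cases hr : r = s <;> simp [spike, hr]
  refine ⟨⟨hup, fun X hX u hu => ?_, fun X hX Y hY hXY u hu => ?_, ⟨⟨0, ?_⟩, ?_, ?_, ?_⟩⟩,
    fun X hX => closedUpper_of_closedGraph hup hconv hgraph hX, hconv,
    fun X hX l hl hl0 hC => toRestr_condPosHom hcomplete hμ hR hs hX hl hl0 hC, hgraph⟩
  · ext v
    rw [mem_image_sub_iff, hmem _ (add_mem_LInf hX hu.1), hmem _ hX, ← hadd, hR.cashInvariant _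
      (spike_mem_LInf hcomplete hμ hX) _ ((spike_mem_MElig_iff hcomplete hμ hs).2 hu),
      mem_image_sub_iff, hadd]
  · rw [hmem _ hY]
    refine hR.monotone _ (spike_mem_LInf hcomplete hμ hX) _ (spike_mem_LInf hcomplete hμ hY)
      ((ae_optMeasure_iff hcomplete hμ).2 fun r => hXY.mono fun ω h i => ?_) ((hmem _ hX).1 hu)
    by_cases hr : r = s <;> simp [spike, hr, h i]
  · rw [hmem _ hz, e0]; exact hR.zero_mem
  · exact isClosed_value_of_closedGraph hgraph hz
  · intro A hA u hu v hv
    rw [hmem _ hz, e0] at hu hv ⊢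
    have := hR.finiteAtZero.decomposable (A ×ˢ {s})
      (MeasurableSpace.measurableSet_generateFrom (Or.inl ⟨s, hs, A, hA, rfl⟩)) _ hu _ hv
    convert this using 1
    ext ⟨ω, r⟩ i
    by_cases hr : r = s <;> by_cases h : ω ∈ A <;> simp [spike, hr, h]
  · obtain ⟨K, hK1, hK2, hK3, hK4⟩ := hR.finiteAtZero.randomSet
    -- As for processes, zero is a selection of `K` and fills the times other than `s`.
    have hK0 := hR.zero_mem
    rw [hK3] at hK0
    have hK0' := (ae_optMeasure_iff hcomplete hμ).1 hK0.2
    refine ⟨fun ω => K (ω, s), fun ω => hK1 _, measurableSet_randomSet_slice hK2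
      (measurable_mk_optFilt_of_lt hs), ?_, (ae_optMeasure_iff hcomplete hμ).1 hK4 s⟩
    ext u
    rw [hmem _ hz, e0, hK3]
    simp only [mem_ofPred_eq, mem_LInf_optFilt_iff hcomplete hμ, ae_optMeasure_iff hcomplete hμ]
    constructor
    · rintro ⟨⟨h, -, -⟩, h2⟩
      have h' := h s hs
      rw [sect_spike_self] at h'
      exact ⟨h', by simpa [spike] using h2 s⟩
    · rintro ⟨h1, h2⟩
      refine ⟨⟨fun r _ => ?_, ?_, fun r hr => ?_⟩, fun r => ?_⟩
      · by_cases hr : r = s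
        · subst hr; rwa [sect_spike_self]
        · rw [sect_spike_of_ne hr]; exact zero_mem_LInf
      · rw [sect_spike_of_ne hs.ne']; exact zero_mem_LInf
      · rw [sect_spike_of_ne hs.ne', sect_spike_of_ne (hs.trans_le hr).ne']
      · by_cases hr : r = s
        · subst hr
          filter_upwards [h2] with ω h
          simp only [spike, if_true]
          exact h
        · filter_upwards [hK0' r] with ω h
          simp only [spike, hr, if_false]
          exact h

end FromOptional

/-! ### Disintegrating measures on the optional space as `Q ⊗ ψ` -/

section Decomposition

variable {Ω : Type*} {mΩ : MeasurableSpace Ω} {P : Measure Ω} {T d m : ℕ}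
  {ℱ : Filtration (Fin (T + 1)) mΩ} {s t : Fin (T + 1)} {μ : Fin (T + 1) → Ω → ℝ}

theorem integral_eq_integral_dens_mul [IsProbabilityMeasure P] {Q : Measure Ω} (hQ : Q ∈ probAC P)
    (f : Ω → ℝ) : ∫ ω, f ω ∂Q = ∫ ω, dens P Q ω * f ω ∂P := by
  have := hQ.1
  exact (integral_rnDeriv_smul hQ.2).symm

/-- Multiplicative decomposition: a non-negative adapted process `A` from `s` on is of the form
`A r = E[L | ℱ r] ψ r`, where `L` is non-negative and `ψ` is an adapted process of probability
weights. -/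
theorem exists_multiplicative_decomposition [IsProbabilityMeasure P] {A : Fin (T + 1) → Ω → ℝ}
    (hA : ∀ r, Measurable[ℱ r] (A r)) (hAi : ∀ r, Integrable (A r) P)
    (hA0 : ∀ r, ∀ᵐ ω ∂P, 0 ≤ A r ω) (s : Fin (T + 1)) :
    ∃ (L : Ω → ℝ) (ψ : Fin (T + 1) → Ω → ℝ), Measurable L ∧ Integrable L P ∧ (∀ᵐ ω ∂P, 0 ≤ L ω) ∧
      ψ ∈ optRandomMeasures P ℱ ∧ (∀ r < s, ψ r = 0) ∧
      ∀ r, s ≤ r → ∀ᵐ ω ∂P, P[L | ℱ r] ω * ψ r ω = A r ω := by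
  classical
  induction s using Fin.reverseInduction with
  -- At the terminal time all the weight sits at `T` and the density is `A T` itself.
  | last =>
    refine ⟨A (Fin.last T), fun r => if r = Fin.last T then 1 else 0,
      (hA _).mono (ℱ.le _) le_rfl, hAi _, hA0 _, ⟨fun r => ?_, fun r => ?_, ?_⟩, fun r hr => ?_,
      fun r hr => ?_⟩
    · by_cases h : r = Fin.last T
      · simp only [h, if_true]; exact measurable_const
      · simp only [h, if_false]; exact measurable_const
    · by_cases h : r = Fin.last T <;> simp [h]
    · refine Filter.Eventually.of_forall fun ω => ?_
      rw [Finset.sum_eq_single (Fin.last T)] <;> simp +contextual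
    · simp [hr.ne]
    · obtain rfl := Fin.last_le_iff.1 hr
      rw [condExp_of_stronglyMeasurable (ℱ.le _) (hA _).stronglyMeasurable (hAi _)]
      simp
  | cast i ih =>
    obtain ⟨L, ψ, hLm, hLi, hL0, ⟨hψm, hψ0, hψ1⟩, hψs, hψA⟩ := ih
    set s : Fin (T + 1) := i.castSucc
    set U := P[L | ℱ s]
    have hUm : Measurable[ℱ s] U := measurable_condExp'
    have hU0 : 0 ≤ᵐ[P] U := condExp_nonneg hL0
    have hlt : s < i.succ := Fin.castSucc_lt_succ
    have hS : MeasurableSet[ℱ s] {ω | 0 < U ω} := measurableSet_lt measurable_const hUm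
    -- The new density `g L + k` is to have conditional expectation `A s + U` at time `s`. The
    -- fraction `h` of it is spent at `s`, and `1 - h` is left for later; `g (1 - h) = 1` where `U >
    -- 0`, so the later products are unchanged. Where `U = 0` the old density vanishes, `k` supplies
    -- `A s`, and everything is spent at `s`.
    let g : Ω → ℝ := fun ω => if 0 < U ω then (A s ω + U ω) / U ω else 0
    let k : Ω → ℝ := fun ω => if 0 < U ω then 0 else A s ω
    let h : Ω → ℝ := fun ω => if 0 < U ω then A s ω / (A s ω + U ω) else 1
    have hgm : Measurable[ℱ s] g := Measurable.ite hS (((hA s).add hUm).div hUm) measurable_const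
    have hkm : Measurable[ℱ s] k := Measurable.ite hS measurable_const (hA s)
    have hhm : Measurable[ℱ s] h := Measurable.ite hS ((hA s).div ((hA s).add hUm)) measurable_const
    have hki : Integrable k P := (hAi s).mono (hkm.mono (ℱ.le _) le_rfl).aestronglyMeasurable
      (Filter.Eventually.of_forall fun ω => by
        by_cases hU : 0 < U ω <;> simp [k, hU])
    have hg0 : ∀ᵐ ω ∂P, 0 ≤ g ω := by
      filter_upwards [hA0 s] with ω h1
      by_cases hU : 0 < U ω
      · simp only [g, hU, if_true]; positivity
      · simp [g, hU]
    -- The factor `g` is unbounded, but the expectation of `g L` equals that of `g U`, which is at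
    -- most that of `A s + U`.
    have hgL : Integrable (fun ω => g ω * L ω) P := by
      refine ⟨((hgm.mono (ℱ.le _) le_rfl).mul hLm).aestronglyMeasurable, ?_⟩
      rw [hasFiniteIntegral_iff_ofReal (by
        filter_upwards [hg0, hL0] with ω h1 h2 using mul_nonneg h1 h2)]
      have e1 : ∫⁻ ω, ENNReal.ofReal (g ω * L ω) ∂P =
          ∫⁻ ω, ENNReal.ofReal (g ω) * ENNReal.ofReal (L ω) ∂P :=
        lintegral_congr_ae (hg0.mono fun ω h1 => ENNReal.ofReal_mul h1)
      rw [e1, lintegral_mul_condExp (ℱ.le s) hgm.ennreal_ofReal hLi hL0]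
      have e2 : ∫⁻ ω, ENNReal.ofReal (g ω) * ENNReal.ofReal (P[L | ℱ s] ω) ∂P ≤
          ∫⁻ ω, ENNReal.ofReal (A s ω + U ω) ∂P := by
        refine lintegral_mono_ae ?_
        filter_upwards [hg0, hA0 s, hU0] with ω h1 h2 h3
        rw [← ENNReal.ofReal_mul h1]
        refine ENNReal.ofReal_le_ofReal ?_
        change g ω * U ω ≤ _
        by_cases hU : 0 < U ω
        · simp only [g, hU, if_true]
          rw [div_mul_cancel₀ _ hU.ne']
        · simp only [g, hU, if_false, zero_mul]
          exact add_nonneg h2 h3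
      refine e2.trans_lt ?_
      rw [← hasFiniteIntegral_iff_ofReal (by
        filter_upwards [hA0 s, hU0] with ω h1 h2 using add_nonneg h1 h2)]
      exact ((hAi s).add integrable_condExp).2
    have hE : ∀ r, s ≤ r → P[fun ω => g ω * L ω + k ω | ℱ r] =ᵐ[P]
        fun ω => g ω * P[L | ℱ r] ω + k ω := fun r hr => by
      have h1 := condExp_add hgL hki (ℱ r)
      have h2 := condExp_mul_of_stronglyMeasurable_left
        (hgm.mono (ℱ.mono hr) le_rfl).stronglyMeasurable hgL hLi
      have h3 := condExp_of_stronglyMeasurable (ℱ.le r)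
        (hkm.mono (ℱ.mono hr) le_rfl).stronglyMeasurable hki
      filter_upwards [h1, h2] with ω h1 h2
      refine h1.trans ?_
      rw [Pi.add_apply, h3]
      exact congrArg (· + k ω) h2
    have hh01 : ∀ᵐ ω ∂P, 0 ≤ h ω ∧ h ω ≤ 1 := by
      filter_upwards [hA0 s] with ω h1
      by_cases hU : 0 < U ω
      · simp only [h, hU, if_true]
        exact ⟨by positivity, div_le_one_of_le₀ (by linarith) (by positivity)⟩
      · simp [h, hU]
    have hψss : ψ s = 0 := hψs s hlt
    refine ⟨fun ω => g ω * L ω + k ω, fun r => if r = s then h else fun ω => (1 - h ω) * ψ r ω,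
      ((hgm.mono (ℱ.le _) le_rfl).mul hLm).add (hkm.mono (ℱ.le _) le_rfl), hgL.add hki, ?_,
      ⟨fun r => ?_, fun r => ?_, ?_⟩, fun r hr => ?_, fun r hr => ?_⟩
    · filter_upwards [hg0, hL0, hA0 s] with ω h1 h2 h3
      refine add_nonneg (mul_nonneg h1 h2) ?_
      by_cases hU : 0 < U ω <;> simp [k, hU, h3]
    · rcases lt_trichotomy r s with hr | rfl | hr
      · simp only [hr.ne, if_false, hψs r (hr.trans hlt), Pi.zero_apply, mul_zero]
        exact measurable_const
      · simpa using hhm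
      · simp only [hr.ne', if_false]
        exact (measurable_const.sub (hhm.mono (ℱ.mono hr.le) le_rfl)).mul (hψm r)
    · by_cases hr : r = s
      · simp only [hr, if_true]; exact hh01.mono fun _ h => h.1
      · simp only [hr, if_false]
        filter_upwards [hh01, hψ0 r] with ω h1 h2
        exact mul_nonneg (sub_nonneg.2 h1.2) h2
    · filter_upwards [hψ1] with ω h1
      have e : ∀ r, (if r = s then h else fun ω => (1 - h ω) * ψ r ω) ω =
          (1 - h ω) * ψ r ω + if r = s then h ω else 0 := fun r => by
        by_cases hr : r = s
        · subst hr; simp [hψss]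
        · simp [hr]
      simp only [e, Finset.sum_add_distrib, ← Finset.mul_sum, h1]
      simp
    · simp only [hr.ne, if_false, hψs r (hr.trans hlt)]
      ext; simp
    · rcases hr.eq_or_lt with rfl | hr'
      · filter_upwards [hE s le_rfl, hA0 s, hU0] with ω h1 h2 h3
        simp only [if_true]
        rw [h1]
        change (g ω * U ω + k ω) * h ω = A s ω
        by_cases hU : 0 < U ω
        · simp only [g, h, k, hU, if_true]
          have : A s ω + U ω ≠ 0 := by positivity
          field_simp
          ring
        · simp [g, h, k, hU]
      -- On `U = 0` the conditional expectation of `L` at the later time `r` also vanishes, by the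
      -- tower property, so `A r` is zero there.
      · have htower : P[P[L | ℱ r] | ℱ s] =ᵐ[P] U := condExp_condExp_of_le (ℱ.mono hr) (ℱ.le r)
        filter_upwards [hE r hr, hA0 s, hψA r (Fin.castSucc_lt_iff_succ_le.1 hr'), htower,
          eq_zero_of_condExp_nonpos (ℱ.le s) (integrable_condExp (f := L) (m := ℱ r))
            (condExp_nonneg hL0)] with ω h1 h2 h3 h4 h5
        simp only [hr'.ne', if_false]
        rw [h1, ← h3]
        by_cases hU : 0 < U ω
        · simp only [g, h, k, hU, if_true]
          have : A s ω + U ω ≠ 0 := by positivity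
          field_simp
          ring
        · simp [g, h, k, hU, h5 (by rw [h4]; exact not_lt.1 hU)]

variable [IsProbabilityMeasure P]
  (hcomplete : ∀ A : Set Ω, P A = 0 → MeasurableSet[ℱ 0] A) (hμ : IsReference P ℱ μ)
  {Qbar : @Measure (Ω × Fin (T + 1)) (optSigma ℱ)}

include hμ in
theorem measurable_sect_dens (s : Fin (T + 1)) :
    Measurable[ℱ s] (sect (dens (optMeasure P ℱ μ) Qbar) s) := by
  have := isProbabilityMeasure_optMeasure hμ
  exact measurable_optSigma_iff.1 (measurable_dens (P := optMeasure P ℱ μ) (Q := Qbar)) s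

include hμ in
theorem integrable_sect_dens (hQ : Qbar ∈ probAC (optMeasure P ℱ μ)) (s : Fin (T + 1)) :
    Integrable (sect (dens (optMeasure P ℱ μ) Qbar) s) P := by
  have := isProbabilityMeasure_optMeasure hμ
  exact (integrable_optMeasure_iff hμ (measurable_dens (P := optMeasure P ℱ μ))).1
    (integrable_dens hQ) s

variable (P ℱ μ Qbar) in
/-- The process `μ s dQbar/dPbar`. -/
noncomputable def massProcess (s : Fin (T + 1)) (ω : Ω) : ℝ :=
  μ s ω * sect (dens (optMeasure P ℱ μ) Qbar) s ω

include hμ in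
theorem measurable_massProcess (s : Fin (T + 1)) : Measurable[ℱ s] (massProcess P ℱ μ Qbar s) :=
  (hμ.adapted s).mul (measurable_sect_dens hμ s)

include hμ in
theorem massProcess_nonneg (s : Fin (T + 1)) : ∀ᵐ ω ∂P, 0 ≤ massProcess P ℱ μ Qbar s ω :=
  hμ.pos.mono fun _ h => mul_nonneg (h s).le ENNReal.toReal_nonneg

include hμ in
theorem integrable_massProcess (hQ : Qbar ∈ probAC (optMeasure P ℱ μ)) (s : Fin (T + 1)) :
    Integrable (massProcess P ℱ μ Qbar s) P :=
  (integrable_sect_dens hμ hQ s).bdd_mul (hμ.measurable s).aestronglyMeasurable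
    (by simpa using hμ.abs_le_one s)

theorem integrable_dens_mul {Ω' : Type*} {m0 : MeasurableSpace Ω'} {P : Measure Ω'}
    [IsProbabilityMeasure P] {Q : Measure Ω'} (hQ : Q ∈ probAC P) {X : Ω' → ℝ} (hX : Measurable X)
    {C : ℝ} (hC : ∀ᵐ x ∂P, |X x| ≤ C) :
    Measurable (fun x => dens P Q x * X x) ∧ Integrable (fun x => dens P Q x * X x) P :=
  ⟨measurable_dens.mul hX, integrable_mul_of_bound (integrable_dens hQ) hX.aestronglyMeasurable hC⟩

include hμ in
theorem integral_of_probAC (hQ : Qbar ∈ probAC (optMeasure P ℱ μ)) {X : Ω × Fin (T + 1) → ℝ}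
    (hX : Measurable[optSigma ℱ] X) {C : ℝ} (hC : ∀ᵐ x ∂(optMeasure P ℱ μ), |X x| ≤ C) :
    ∫ x, X x ∂Qbar = ∑ s, ∫ ω, massProcess P ℱ μ Qbar s ω * X (ω, s) ∂P := by
  have := isProbabilityMeasure_optMeasure hμ
  have h := integrable_dens_mul hQ hX hC
  rw [integral_eq_integral_dens_mul hQ, integral_optMeasure hμ h.1 h.2]
  simp only [massProcess, mul_assoc, sect]

include hμ in
theorem real_of_probAC (hQ : Qbar ∈ probAC (optMeasure P ℱ μ)) {B : Set (Ω × Fin (T + 1))}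
    (hB : MeasurableSet[optSigma ℱ] B) :
    Qbar.real B = ∑ s, ∫ ω in {ω | (ω, s) ∈ B}, massProcess P ℱ μ Qbar s ω ∂P := by
  have h := integral_of_probAC (C := 1) hμ hQ (X := B.indicator fun _ => 1)
    (Measurable.indicator measurable_const hB) (Filter.Eventually.of_forall fun x => by
      by_cases h : x ∈ B <;> simp [h])
  rw [integral_indicator_const _ hB] at h
  simp only [smul_eq_mul, mul_one] at h
  rw [h]
  refine Finset.sum_congr rfl fun s _ => ?_
  rw [← integral_indicator (measurableSet_section hB s)]
  refine integral_congr_ae (Filter.Eventually.of_forall fun ω => ?_)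
  by_cases h : (ω, s) ∈ B <;> simp [h]

include hcomplete hμ in
-- Apply the multiplicative decomposition from time zero to `μ_s (dQ̄/dP̄)_s`; the factor `L`
-- becomes `dQ/dP`.
theorem exists_isDecomp (hQ : Qbar ∈ probAC (optMeasure P ℱ μ)) :
    ∃ (Q : Measure Ω) (ψ : Fin (T + 1) → Ω → ℝ), IsDecomp P ℱ μ Qbar Q ψ := by
  obtain ⟨L, ψ, hLm, hLi, hL0, hψ, -, hLψ⟩ := exists_multiplicative_decomposition
    (measurable_massProcess (Qbar := Qbar) hμ) (integrable_massProcess hμ hQ)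
    (massProcess_nonneg hμ) 0
  have := hQ.1
  have hψ1 : ∀ s, ∀ᵐ ω ∂P, |ψ s ω| ≤ 1 := fun s => by
    filter_upwards [ae_all_iff.2 hψ.2.1, hψ.2.2] with ω h0 h1
    rw [abs_of_nonneg (h0 s), ← h1]
    exact Finset.single_le_sum (f := fun s => ψ s ω) (fun s _ => h0 s) (Finset.mem_univ s)
  have key : ∀ X : Ω × Fin (T + 1) → ℝ, Measurable[optSigma ℱ] X → ∀ C : ℝ,
      (∀ᵐ x ∂(optMeasure P ℱ μ), |X x| ≤ C) →
      ∫ x, X x ∂Qbar = ∫ ω, L ω * ∑ s, ψ s ω * X (ω, s) ∂P := fun X hX C hC => by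
    have hXs : ∀ s, Measurable[ℱ s] fun ω => X (ω, s) := measurable_optSigma_iff.1 hX
    have hCs := (ae_optMeasure_iff hcomplete hμ).1 hC
    have hb : ∀ s, ∀ᵐ ω ∂P, |ψ s ω * X (ω, s)| ≤ C := fun s => by
      filter_upwards [hψ1 s, hCs s] with ω h1 h2
      rw [abs_mul]
      calc _ ≤ 1 * |X (ω, s)| := mul_le_mul_of_nonneg_right h1 (abs_nonneg _)
        _ ≤ C := by rwa [one_mul]
    have hi : ∀ s, Integrable (fun ω => L ω * (ψ s ω * X (ω, s))) P := fun s =>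
      integrable_mul_of_bound hLi (((hψ.1 s).mul (hXs s)).mono (ℱ.le s) le_rfl).aestronglyMeasurable
        (hb s)
    rw [integral_of_probAC hμ hQ hX hC]
    simp only [Finset.mul_sum]
    rw [integral_finsetSum _ fun s _ => hi s]
    refine Finset.sum_congr rfl fun s _ => ?_
    -- Since `ψ_s X_s` is known at time `s`, only the conditional expectation of `L` at that time
    -- enters, and its product with `ψ_s` is the prescribed mass.
    rw [← integral_condExp (ℱ.le s) (f := fun ω => L ω * (ψ s ω * X (ω, s)))]
    refine integral_congr_ae ?_
    filter_upwards [condExp_mul_of_stronglyMeasurable_right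
      ((hψ.1 s).mul (hXs s)).stronglyMeasurable (hi s) hLi, hLψ s (Fin.zero_le s)] with ω h1 h2
    rw [← h2, mul_assoc]
    exact h1.symm
  let Q := P.withDensity fun ω => ENNReal.ofReal (L ω)
  -- The total mass of `Q` is obtained by testing with the constant one, because the weights `ψ` sum
  -- to one.
  have hL1 : ∫ ω, L ω ∂P = 1 := by
    have h := key (fun _ => 1) measurable_const 1 (Filter.Eventually.of_forall fun _ => by simp)
    simp only [integral_const, probReal_univ, smul_eq_mul, mul_one] at h
    rw [h]
    exact integral_congr_ae (hψ.2.2.mono fun ω h => by simp only [h, mul_one])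
  have hQac : Q ∈ probAC P := by
    refine ⟨⟨?_⟩, withDensity_absolutelyContinuous _ _⟩
    rw [withDensity_apply _ MeasurableSet.univ, Measure.restrict_univ,
      ← ofReal_integral_eq_lintegral_ofReal hLi hL0, hL1, ENNReal.ofReal_one]
  refine ⟨Q, ψ, hQac, hψ, fun X hX ⟨C, hC⟩ => ?_⟩
  rw [key X hX C hC, integral_eq_integral_dens_mul hQac]
  refine integral_congr_ae ((dens_withDensity hLm hL0).mono fun ω h => ?_)
  simp only [show dens P Q ω = L ω from h]

variable {Q : Measure Ω} {ψ : Fin (T + 1) → Ω → ℝ}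

theorem optRandomMeasures_abs_le_one (hψ : ψ ∈ optRandomMeasures P ℱ) (s : Fin (T + 1)) :
    ∀ᵐ ω ∂P, |ψ s ω| ≤ 1 := by
  filter_upwards [ae_all_iff.2 hψ.2.1, hψ.2.2] with ω h0 h1
  rw [abs_of_nonneg (h0 s), ← h1]
  exact Finset.single_le_sum (f := fun s => ψ s ω) (fun s _ => h0 s) (Finset.mem_univ s)

theorem IsDecomp.real_eq (h : IsDecomp P ℱ μ Qbar Q ψ) {B : Set (Ω × Fin (T + 1))}
    (hB : MeasurableSet[optSigma ℱ] B) :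
    Qbar.real B = ∫ ω, dens P Q ω * ∑ s, ψ s ω * B.indicator (fun _ => (1 : ℝ)) (ω, s) ∂P := by
  have h2 := h.2.2 (B.indicator fun _ => 1) (Measurable.indicator measurable_const hB)
    ⟨1, Filter.Eventually.of_forall fun x => by by_cases h : x ∈ B <;> simp [h]⟩
  rwa [integral_indicator_const _ hB, smul_eq_mul, mul_one, integral_eq_integral_dens_mul h.1] at h2

include hμ in
theorem real_optMeasure {B : Set (Ω × Fin (T + 1))} (hB : MeasurableSet[optSigma ℱ] B) :
    (optMeasure P ℱ μ).real B = ∑ s, ∫ ω in {ω | (ω, s) ∈ B}, μ s ω ∂P := by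
  have := isProbabilityMeasure_optMeasure hμ
  rw [measureReal_def, optMeasure_apply hμ hB, ENNReal.toReal_sum]
  · refine Finset.sum_congr rfl fun s _ => ?_
    rw [integral_eq_lintegral_of_nonneg_ae (ae_restrict_of_ae (hμ.pos.mono fun ω h => (h s).le))
      (hμ.measurable s).aestronglyMeasurable]
  · intro s hs h
    have := measure_ne_top (optMeasure P ℱ μ) B
    rw [optMeasure_apply hμ hB] at this
    exact this (ENNReal.sum_eq_top.2 ⟨s, hs, h⟩)

theorem prod_Ici_mem_optFilt {r : Fin (T + 1)} (hr : r ≤ t) {A : Set Ω}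
    (hA : MeasurableSet[ℱ r] A) : MeasurableSet[optFilt ℱ t] (A ×ˢ Ici r) := by
  refine measurableSet_optFilt_iff.2 ⟨fun s hs => ?_, ?_, fun s hs ω => ?_⟩
  · by_cases h : r ≤ s
    · simpa [h] using ℱ.mono h _ hA
    · simp [h]
  · simpa [hr] using ℱ.mono hr _ hA
  · simp [hr, hr.trans hs]

theorem integrable_reference (hμ : IsReference P ℱ μ) (s : Fin (T + 1)) : Integrable (μ s) P :=
  Integrable.of_bound (hμ.measurable s).aestronglyMeasurable 1 (by simpa using hμ.abs_le_one s)

include hμ in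
-- For `s < t` the sets `A × {s}` are known at time `t`, where the two optional measures agree.
theorem massProcess_of_lt (hQbar : Qbar ∈ probOn (optMeasure P ℱ μ) (optFilt ℱ t))
    (hs : s < t) : massProcess P ℱ μ Qbar s =ᵐ[P] μ s := by
  refine ae_eq_of_setIntegral_eq (ℱ.le s) (measurable_massProcess hμ s) (hμ.adapted s)
    (integrable_massProcess hμ hQbar.1 s) (integrable_reference hμ s) fun A hA => ?_
  have hB : MeasurableSet[optFilt ℱ t] (A ×ˢ {s}) :=
    MeasurableSpace.measurableSet_generateFrom (Or.inl ⟨s, hs, A, hA, rfl⟩)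
  have hB' := optFilt_le_optSigma _ hB
  have h1 := real_of_probAC hμ hQbar.1 hB'
  rw [measureReal_def, hQbar.2 _ hB, ← measureReal_def, real_optMeasure hμ hB',
    Finset.sum_eq_single s (fun r _ hr => by simp [hr]) (by simp),
    Finset.sum_eq_single s (fun r _ hr => by simp [hr]) (by simp)] at h1
  simpa using h1.symm

include hμ in
-- Testing both descriptions of the measure on `A × {s}` shows that this product is the same for all
-- decompositions, even though `Q` and `ψ` separately need not be.
theorem IsDecomp.condExp_mul_eq (h : IsDecomp P ℱ μ Qbar Q ψ)
    (hQbar : Qbar ∈ probAC (optMeasure P ℱ μ)) (s : Fin (T + 1)) :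
    (fun ω => P[dens P Q | ℱ s] ω * ψ s ω) =ᵐ[P] massProcess P ℱ μ Qbar s := by
  have hLi := integrable_dens h.1
  have hb := optRandomMeasures_abs_le_one h.2.1 s
  have hψm := h.2.1.1 s
  have hi : Integrable (fun ω => dens P Q ω * ψ s ω) P :=
    integrable_mul_of_bound hLi (hψm.mono (ℱ.le s) le_rfl).aestronglyMeasurable hb
  have hc : P[fun ω => dens P Q ω * ψ s ω | ℱ s] =ᵐ[P] fun ω => P[dens P Q | ℱ s] ω * ψ s ω :=
    condExp_mul_of_stronglyMeasurable_right hψm.stronglyMeasurable hi hLi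
  refine ae_eq_of_setIntegral_eq (ℱ.le s) (measurable_condExp'.mul hψm)
    (measurable_massProcess hμ s) (integrable_condExp.congr hc)
    (integrable_massProcess hμ hQbar s) fun A hA => ?_
  have hB : MeasurableSet[optSigma ℱ] (A ×ˢ {s}) :=
    MeasurableSpace.measurableSet_generateFrom ⟨s, A, hA, rfl⟩
  have h1 := real_of_probAC hμ hQbar hB
  have e : ∀ ω, dens P Q ω * ∑ r, ψ r ω * (A ×ˢ {s}).indicator (fun _ => (1 : ℝ)) (ω, r) =
      A.indicator (fun ω => dens P Q ω * ψ s ω) ω := fun ω => by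
    rw [Finset.sum_eq_single s (fun r _ hr => by simp [hr]) (by simp)]
    by_cases h : ω ∈ A <;> simp [h]
  rw [h.real_eq hB, Finset.sum_eq_single s (fun r _ hr => by simp [hr]) (by simp)] at h1
  simp only [e, mem_prod, mem_singleton_iff, and_true, ofPred_mem_eq] at h1
  rw [← setIntegral_congr_ae (ℱ.le s _ hA) (hc.mono fun ω h _ => h), ← h1,
    integral_indicator (ℱ.le s _ hA), setIntegral_condExp (ℱ.le s) hi hA]

include hμ in
-- Testing on the sets `A × {r, …, T}`, which for `r ≤ t` belong to the optional filtration at time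
-- `t`, compares the two remaining masses at time `r`.
theorem IsDecomp.condExp_dens_mul_mass (h : IsDecomp P ℱ μ Qbar Q ψ)
    (hQbar : Qbar ∈ probOn (optMeasure P ℱ μ) (optFilt ℱ t)) {r : Fin (T + 1)} (hr : r ≤ t) :
    (fun ω => P[dens P Q | ℱ r] ω * mass ψ r ω) =ᵐ[P] mass μ r := by
  have hLi := integrable_dens h.1
  have hψm : Measurable[ℱ r] (mass ψ r) := measurable_const.sub <|
    Finset.measurable_fun_sum _ fun q hq =>
      (h.2.1.1 q).mono (ℱ.mono (Finset.mem_Iio.1 hq).le) le_rfl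
  have hsum : ∀ᵐ ω ∂P, ∑ s : Ici r, ψ s ω = mass ψ r ω :=
    h.2.1.2.2.mono fun ω h => sum_Ici_eq_sub h
  have hb : ∀ᵐ ω ∂P, |mass ψ r ω| ≤ 1 := by
    filter_upwards [hsum, ae_all_iff.2 h.2.1.2.1] with ω h1 h2
    rw [abs_of_nonneg (by rw [← h1]; exact Finset.sum_nonneg fun s _ => h2 s)]
    exact sub_le_self _ (Finset.sum_nonneg fun s _ => h2 s)
  have hi : Integrable (fun ω => dens P Q ω * mass ψ r ω) P :=
    integrable_mul_of_bound hLi (hψm.mono (ℱ.le r) le_rfl).aestronglyMeasurable hb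
  have hc : P[fun ω => dens P Q ω * mass ψ r ω | ℱ r] =ᵐ[P]
      fun ω => P[dens P Q | ℱ r] ω * mass ψ r ω :=
    condExp_mul_of_stronglyMeasurable_right hψm.stronglyMeasurable hi hLi
  refine ae_eq_of_setIntegral_eq (ℱ.le r) (measurable_condExp'.mul hψm)
    (measurable_mass hμ) (integrable_condExp.congr hc) (Integrable.of_bound
      ((measurable_mass hμ).mono (ℱ.le r) le_rfl).aestronglyMeasurable 1
      (by simpa using mass_le_one hμ)) fun A hA => ?_
  have hB := prod_Ici_mem_optFilt hr hA
  have hB' := optFilt_le_optSigma _ hB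
  have h1 := h.real_eq hB'
  have e : ∀ ω, ∑ s, ψ s ω * (A ×ˢ Ici r).indicator (fun _ => (1 : ℝ)) (ω, s) =
      A.indicator (fun ω => ∑ s : Ici r, ψ s ω) ω := fun ω => by
    rw [sum_eq_sum_Ici (t := r) fun s hs => by simp [not_le.2 hs]]
    by_cases h : ω ∈ A
    · simp only [h, indicator_of_mem]
      exact Finset.sum_congr rfl fun s _ => by simp [h]
    · simp [h]
  have e2 : ∫ ω, dens P Q ω * A.indicator (fun ω => ∑ s : Ici r, ψ s ω) ω ∂P =
      ∫ ω in A, dens P Q ω * mass ψ r ω ∂P := by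
    rw [← integral_indicator (ℱ.le r _ hA)]
    refine integral_congr_ae (hsum.mono fun ω h => ?_)
    by_cases hω : ω ∈ A
    · simp only [hω, indicator_of_mem, h]
    · simp [hω]
  simp only [e] at h1
  rw [measureReal_def, hQbar.2 _ hB, ← measureReal_def, real_optMeasure hμ hB', e2,
    sum_eq_sum_Ici (t := r) fun s hs => by simp [not_le.2 hs]] at h1
  have e3 : ∀ s : Ici r, ∫ ω in {ω | (ω, (s : Fin (T + 1))) ∈ A ×ˢ Ici r}, μ s ω ∂P =
      ∫ ω in A, μ s ω ∂P := fun s => by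
    simp only [mem_prod, s.2, and_true, ofPred_mem_eq]
  simp only [e3] at h1
  rw [← integral_finsetSum _ fun (s : Ici r) _ => (integrable_reference hμ s).integrableOn] at h1
  rw [← setIntegral_congr_ae (ℱ.le r _ hA) (hc.mono fun ω h _ => h),
    setIntegral_condExp (ℱ.le r) hi hA, ← h1]
  exact setIntegral_congr_ae (ℱ.le r _ hA) ((sum_Ici_eq_mass hμ).mono fun ω h _ => h)

include hμ in
/-- The measure in a decomposition of a measure that coincides with the reference measure at
time `t` coincides with `P` at time `t`. -/
theorem IsDecomp.mem_probOn (h : IsDecomp P ℱ μ Qbar Q ψ)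
    (hQbar : Qbar ∈ probOn (optMeasure P ℱ μ) (optFilt ℱ t)) : Q ∈ probOn P (ℱ t) := by
  have key : ∀ r ≤ t, P[dens P Q | ℱ r] =ᵐ[P] fun _ => 1 := by
    intro r
    -- If the density is normalized at all earlier times, then `ψ` and `μ` agree there, so the
    -- remaining masses at `r` coincide; the mass of `μ` is positive and can be cancelled.
    induction r using WellFoundedLT.induction with
    | ind r ih =>
      intro hr
      have hq : ∀ q, ∀ᵐ ω ∂P, q < r → ψ q ω = μ q ω := fun q => by
        by_cases hqr : q < r
        · filter_upwards [ih q hqr (hqr.le.trans hr), h.condExp_mul_eq hμ hQbar.1 q,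
            massProcess_of_lt hμ hQbar (hqr.trans_le hr)] with ω h1 h2 h3 _
          rw [← h3, ← h2, h1, one_mul]
        · exact Filter.Eventually.of_forall fun _ h => absurd h hqr
      filter_upwards [ae_all_iff.2 hq, h.condExp_dens_mul_mass hμ hQbar hr,
        mass_pos (t := r) hμ] with ω h1 h2 h3
      have e : mass ψ r ω = mass μ r ω := by
        simp only [mass]
        rw [Finset.sum_congr rfl fun q hq => h1 q (Finset.mem_Iio.1 hq)]
      rw [e] at h2
      exact mul_right_cancel₀ h3.2.ne' (h2.trans (one_mul _).symm)
  exact mem_probOn_of_condExp_dens (ℱ.le t) h.1 (key t le_rfl)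

end Decomposition

/-! ### Invariance of dual positivity under conditional scaling -/

section Scaling

variable {Ω : Type*} {F G m0 : MeasurableSpace Ω} {P : Measure Ω} [IsProbabilityMeasure P]
  {d m : ℕ}

theorem measurable_vec {X : Ω → Fin d → ℝ} (h : ∀ i, Measurable[F] fun ω => X ω i) :
    Measurable[F] X :=
  @measurable_pi_lambda _ _ _ F _ X h

/-- On the event `w < 0` the conditional density would be non-positive, but its integral over that
event is the probability of the event. -/
theorem nonneg_of_mul_xi_nonneg (hFG : F ≤ G) (hG : G ≤ m0) {Q : Measure Ω} (hQ : Q ∈ probOn P F)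
    {w : Ω → ℝ} (hw : Measurable[F] w) (h : ∀ᵐ ω ∂P, 0 ≤ w ω * xi P F G Q ω) :
    ∀ᵐ ω ∂P, 0 ≤ w ω := by
  have hB : MeasurableSet[F] {ω | w ω < 0} := measurableSet_lt hw measurable_const
  have hBm : MeasurableSet {ω | w ω < 0} := hG _ (hFG _ hB)
  have h1 : ∫ ω in {ω | w ω < 0}, P[dens P Q | G] ω ∂P ≤ 0 := by
    refine setIntegral_nonpos_ae hBm ?_
    filter_upwards [h, xi_ae_eq (G := G) (hFG.trans hG) hQ] with ω h2 h3 h4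
    rw [h3] at h2
    exact nonpos_of_mul_nonneg_right h2 h4
  rw [setIntegral_condExp hG (integrable_dens hQ.1) (hFG _ hB), setIntegral_dens hQ.1,
    measureReal_def, hQ.2 _ hB] at h1
  have h2 : P {ω | w ω < 0} = 0 :=
    ((ENNReal.toReal_eq_zero_iff _).1 (le_antisymm h1 ENNReal.toReal_nonneg)).resolve_right
      (measure_ne_top _ _)
  have h3 : ∀ᵐ ω ∂P, ¬ w ω < 0 := measure_eq_zero_iff_ae_notMem.1 h2
  exact h3.mono fun ω h => not_lt.1 h

theorem pairing_smul_fun (Z X : Ω → Fin d → ℝ) (l : Ω → ℝ) :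
    pairing P (fun ω => l ω • Z ω) X = pairing P Z (fun ω => l ω • X ω) := by
  simp only [pairing, smul_dotProduct, dotProduct_smul]

theorem IsClosedCoherentVec.pairing_smul_nonneg {R : (Ω → Fin d → ℝ) → Set (Ω → Fin d → ℝ)}
    (hR : IsClosedCoherentVec P G F m R) (hFG : F ≤ G) {Z : Ω → Fin d → ℝ} {l : Ω → ℝ}
    (hl : Measurable[F] l) (hl0 : ∀ᵐ ω ∂P, 0 ≤ l ω) {C : ℝ} (hC : ∀ᵐ ω ∂P, |l ω| ≤ C)
    (h : ∀ X ∈ accVec P G R, 0 ≤ pairing P Z X) :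
    ∀ X ∈ accVec P G R, 0 ≤ pairing P (fun ω => l ω • Z ω) X := fun X hX => by
  rw [pairing_smul_fun]
  exact h _ (hR.acc_smul_fun hX hl hl0 (hC.mono fun _ h => (le_abs_self _).trans h) hFG)

/-- A factor known at the evaluation time can be moved onto the acceptable position, which stays
acceptable; bounded inverses make this reversible. It absorbs the factors `μ_s` that come from the
optional measure. -/
theorem IsClosedCoherentVec.pairing_smul_nonneg_iff {R : (Ω → Fin d → ℝ) → Set (Ω → Fin d → ℝ)}
    (hR : IsClosedCoherentVec P G F m R) (hFG : F ≤ G) {Z : Ω → Fin d → ℝ} {l : Ω → ℝ}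
    (hl : Measurable[F] l) (hl0 : ∀ᵐ ω ∂P, 0 < l ω) {C C' : ℝ} (hC : ∀ᵐ ω ∂P, |l ω| ≤ C)
    (hC' : ∀ᵐ ω ∂P, |(l ω)⁻¹| ≤ C') :
    (∀ X ∈ accVec P G R, 0 ≤ pairing P (fun ω => l ω • Z ω) X) ↔
      ∀ X ∈ accVec P G R, 0 ≤ pairing P Z X := by
  refine ⟨fun h X hX => ?_, hR.pairing_smul_nonneg hFG hl (hl0.mono fun _ h => h.le) hC⟩
  have := hR.pairing_smul_nonneg hFG hl.inv (hl0.mono fun _ h => inv_nonneg.2 h.le) hC' h X hX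
  exact this.trans_eq (pairing_congr (hl0.mono fun ω h => inv_smul_smul₀ h.ne' _))

variable {T : ℕ} {ℱ : Filtration (Fin (T + 1)) m0} {t : Fin (T + 1)}
  {ρ : (Fin (T + 1) → Ω → Fin d → ℝ) → Set (Ω → Fin d → ℝ)}

theorem IsClosedCoherentProc.pairing_smul_nonneg (hρ : IsClosedCoherentProc P ℱ m t ρ)
    {Z : Fin (T + 1) → Ω → Fin d → ℝ} {l : Ω → ℝ}
    (hl : Measurable[ℱ t] l) (hl0 : ∀ᵐ ω ∂P, 0 ≤ l ω) {C : ℝ} (hC : ∀ᵐ ω ∂P, |l ω| ≤ C)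
    (h : ∀ X ∈ accProc P ℱ t ρ, 0 ≤ ∑ s : Ici t, pairing P (Z s) (X s)) :
    ∀ X ∈ accProc P ℱ t ρ, 0 ≤ ∑ s : Ici t, pairing P (fun ω => l ω • Z s ω) (X s) :=
  fun X hX => by
  simp only [pairing_smul_fun]
  exact h _ (hρ.acc_smul_fun hX hl hl0 (hC.mono fun _ h => (le_abs_self _).trans h))

/-- Used with the remaining mass or its inverse, the factor by which the two dual maps change the
functional. -/
theorem IsClosedCoherentProc.pairing_smul_nonneg_iff (hρ : IsClosedCoherentProc P ℱ m t ρ)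
    {Z : Fin (T + 1) → Ω → Fin d → ℝ} {l : Ω → ℝ}
    (hl : Measurable[ℱ t] l) (hl0 : ∀ᵐ ω ∂P, 0 < l ω) {C C' : ℝ} (hC : ∀ᵐ ω ∂P, |l ω| ≤ C)
    (hC' : ∀ᵐ ω ∂P, |(l ω)⁻¹| ≤ C') :
    (∀ X ∈ accProc P ℱ t ρ, 0 ≤ ∑ s : Ici t, pairing P (fun ω => l ω • Z s ω) (X s)) ↔
      ∀ X ∈ accProc P ℱ t ρ, 0 ≤ ∑ s : Ici t, pairing P (Z s) (X s) := by
  refine ⟨fun h X hX => ?_, hρ.pairing_smul_nonneg hl (hl0.mono fun _ h => h.le) hC⟩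
  have := hρ.pairing_smul_nonneg (Z := fun s ω => l ω • Z s ω) hl.inv
    (hl0.mono fun _ h => inv_nonneg.2 h.le) hC' h X hX
  refine this.trans_eq (Finset.sum_congr rfl fun s _ => ?_)
  exact pairing_congr (hl0.mono fun ω h => inv_smul_smul₀ h.ne' _)

end Scaling

/-! ### Splitting positivity on the optional acceptance set along time -/

section DualCones

variable {Ω : Type*} {mΩ : MeasurableSpace Ω} {P : Measure Ω} {T d m : ℕ}
  {ℱ : Filtration (Fin (T + 1)) mΩ} {s t : Fin (T + 1)} {μ : Fin (T + 1) → Ω → ℝ}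
  {Rbar : (Ω × Fin (T + 1) → Fin d → ℝ) → Set (Ω × Fin (T + 1) → Fin d → ℝ)}
  {ρ : (Fin (T + 1) → Ω → Fin d → ℝ) → Set (Ω → Fin d → ℝ)}
  {R : Fin (T + 1) → (Ω → Fin d → ℝ) → Set (Ω → Fin d → ℝ)}
  [IsProbabilityMeasure P]
  (hcomplete : ∀ A : Set Ω, P A = 0 → MeasurableSet[ℱ 0] A) (hμ : IsReference P ℱ μ)

section

variable (hR : IsClosedCoherentVec (optMeasure P ℱ μ) (optSigma ℱ) (optFilt ℱ t) m Rbar)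

include hcomplete hμ hR

theorem spike_mem_acc_of_mem_acc (hs : s < t) {X : Ω × Fin (T + 1) → Fin d → ℝ}
    (hX : X ∈ accVec (optMeasure P ℱ μ) (optSigma ℱ) Rbar) :
    spike s (sect X s) ∈ accVec (optMeasure P ℱ μ) (optSigma ℱ) Rbar := by
  have h := hR.acc_smul_fun hX (measurable_spike hs (l := fun _ => 1) measurable_const 0)
    ((ae_iff_of_spike hcomplete hμ (p := fun x => 0 ≤ x) le_rfl).2
      (Filter.Eventually.of_forall fun _ => zero_le_one))
    ((ae_iff_of_spike hcomplete hμ (p := fun x => x ≤ 1) zero_le_one).2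
      (Filter.Eventually.of_forall fun _ => le_rfl)) optFilt_le_optSigma
  convert h using 1
  ext ⟨ω, r⟩ i
  by_cases hr : r = s
  · subst hr; simp [spike, sect]
  · simp [spike, hr]

theorem embed_mem_acc_of_mem_acc {X : Ω × Fin (T + 1) → Fin d → ℝ}
    (hX : X ∈ accVec (optMeasure P ℱ μ) (optSigma ℱ) Rbar) :
    embed t (projFrom t (sect X)) ∈ accVec (optMeasure P ℱ μ) (optSigma ℱ) Rbar := by
  have h := hR.acc_smul_fun hX (measurable_stepFrom (t := t) (l := fun _ => 1) measurable_const 0)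
    ((ae_iff_of_stepFrom hcomplete hμ (p := fun x => 0 ≤ x) le_rfl).2
      (Filter.Eventually.of_forall fun _ => zero_le_one))
    ((ae_iff_of_stepFrom hcomplete hμ (p := fun x => x ≤ 1) zero_le_one).2
      (Filter.Eventually.of_forall fun _ => le_rfl)) optFilt_le_optSigma
  convert h using 1
  ext ⟨ω, r⟩ i
  by_cases hr : t ≤ r <;> simp [embed, projFrom, sect, hr]

/-- Positivity on an acceptance set on the optional space can be tested time by time before `t` and
jointly from `t` on. -/
theorem forall_pairing_nonneg_iff {Z : Ω × Fin (T + 1) → Fin d → ℝ}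
    (hZ : Z ∈ LOne (optMeasure P ℱ μ) (optSigma ℱ) d) :
    (∀ X ∈ accVec (optMeasure P ℱ μ) (optSigma ℱ) Rbar, 0 ≤ pairing (optMeasure P ℱ μ) Z X) ↔
      (∀ s < t, ∀ Y ∈ LInf P (ℱ s) d, spike s Y ∈ accVec (optMeasure P ℱ μ) (optSigma ℱ) Rbar →
        0 ≤ pairing P (fun ω => μ s ω • sect Z s ω) Y) ∧
      ∀ X ∈ ProcInf P ℱ d t, embed t X ∈ accVec (optMeasure P ℱ μ) (optSigma ℱ) Rbar →
        0 ≤ ∑ s : Ici t, pairing P (fun ω => μ s ω • sect Z s ω) (X s) := by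
  constructor
  · intro h
    refine ⟨fun s _ Y hY hYA => ?_, fun X hX hXA => ?_⟩
    · rw [← pairing_spike_right hcomplete hμ hY hZ]; exact h _ hYA
    · rw [← pairing_embed hcomplete hμ hX hZ]; exact h _ hXA
  · rintro ⟨h1, h2⟩ X hX
    have hX' := (mem_LInf_optSigma_iff hcomplete hμ).1 hX.1
    rw [pairing_optMeasure hcomplete hμ hZ hX.1]
    have h3 := h2 _ (projFrom_mem_ProcInf hX') (embed_mem_acc_of_mem_acc hcomplete hμ hR hX)
    -- The pairing is split into the times before `t`, each tested on its own, and the times from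
    -- `t` on, tested jointly through the projected process.
    have e : ∀ s, pairing P (fun ω => μ s ω • sect Z s ω) (sect X s) =
        (if t ≤ s then 0 else pairing P (fun ω => μ s ω • sect Z s ω) (sect X s)) +
          if t ≤ s then pairing P (fun ω => μ s ω • sect Z s ω) (sect X s) else 0 := fun s => by
      split_ifs <;> simp
    rw [Finset.sum_congr rfl fun s _ => e s, Finset.sum_add_distrib]
    refine add_nonneg (Finset.sum_nonneg fun s _ => ?_) ?_
    · split_ifs with hs
      · exact le_rfl
      · exact h1 s (not_le.1 hs) _ (hX' s)
          (spike_mem_acc_of_mem_acc hcomplete hμ hR (not_le.1 hs) hX)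
    · rw [sum_eq_sum_Ici (t := t) fun s hs => if_neg (not_le.2 hs)]
      refine h3.trans_eq (Finset.sum_congr rfl fun s _ => ?_)
      have hs : t ≤ s := s.2
      simp only [projFrom, hs, if_true]

theorem spike_mem_acc_iff_toRestr (hs : s < t) {Y : Ω → Fin d → ℝ} (hY : Y ∈ LInf P (ℱ s) d) :
    spike s Y ∈ accVec (optMeasure P ℱ μ) (optSigma ℱ) Rbar ↔
      Y ∈ accVec P (ℱ s) (toRestr Rbar s) := by
  have e : spike (T := T) s (0 : Ω → Fin d → ℝ) = 0 := by ext; simp [spike]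
  simp only [accVec, mem_ofPred_eq, spike_mem_LInf hcomplete hμ hY, hY, true_and,
    mem_toRestr_iff hcomplete hμ hR hs hY, e]

theorem embed_mem_acc_iff_toProc {X : Fin (T + 1) → Ω → Fin d → ℝ} (hX : X ∈ ProcInf P ℱ d t) :
    embed t X ∈ accVec (optMeasure P ℱ μ) (optSigma ℱ) Rbar ↔
      X ∈ accProc P ℱ t (toProc t Rbar) := by
  have e : stepFrom (T := T) t (0 : Ω → Fin d → ℝ) = 0 := by ext; simp [stepFrom]
  simp only [accVec, accProc, mem_ofPred_eq, embed_mem_LInf hcomplete hμ hX, hX, true_and,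
    mem_toProc_iff hcomplete hμ hR hX, e]

end

section

variable (hρ : IsClosedCoherentProc P ℱ m t ρ)
  (hR : ∀ s < t, IsClosedCoherentVec P (ℱ s) (ℱ s) m (R s))

include hcomplete hμ hρ hR

/-- At all other times the position is zero, and zero is acceptable there, so the only condition
left is the one at time `s`. -/
theorem spike_mem_acc_toOptional_iff (hs : s < t) {Y : Ω → Fin d → ℝ} (hY : Y ∈ LInf P (ℱ s) d) :
    spike s Y ∈ accVec (optMeasure P ℱ μ) (optSigma ℱ) (toOptional t ρ R) ↔
      Y ∈ accVec P (ℱ s) (R s) := by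
  simp only [accVec, mem_ofPred_eq, spike_mem_LInf hcomplete hμ hY, hY, true_and,
    mem_toOptional_iff]
  constructor
  · intro h
    have := h.1 s hs
    rwa [sect_spike_self] at this
  · intro h
    refine ⟨fun r hr => ?_, ?_, fun _ _ => rfl⟩
    · by_cases hrs : r = s
      · subst hrs; rwa [sect_spike_self]
      · rw [sect_spike_of_ne hrs]; exact (hR r hr).zero_mem
    · have : projFrom t (sect (spike s Y)) = 0 := by
        ext r ω i
        by_cases h : t ≤ r
        · simp [projFrom, h, sect_spike_of_ne (hs.trans_le h).ne']
        · simp [projFrom, h]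
      rw [this]; exact hρ.zero_mem

theorem embed_mem_acc_toOptional_iff {X : Fin (T + 1) → Ω → Fin d → ℝ}
    (hX : X ∈ ProcInf P ℱ d t) :
    embed t X ∈ accVec (optMeasure P ℱ μ) (optSigma ℱ) (toOptional t ρ R) ↔
      X ∈ accProc P ℱ t ρ := by
  have e : projFrom t (sect (embed t X)) = X := by
    ext r ω i
    by_cases h : t ≤ r
    · simp [projFrom, h, sect_embed_of_le h]
    · simp [projFrom, h, hX.2 r (not_le.1 h)]
  simp only [accVec, accProc, mem_ofPred_eq, embed_mem_LInf hcomplete hμ hX, hX, true_and,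
    mem_toOptional_iff, e]
  refine ⟨fun h => h.2.1, fun h => ⟨fun r hr => ?_, h, fun _ _ => rfl⟩⟩
  rw [sect_embed_of_lt hr]; exact (hR r hr).zero_mem

end

section DualVariables

variable {p : (Fin d → @Measure (Ω × Fin (T + 1)) (optSigma ℱ)) × (Ω × Fin (T + 1) → Fin d → ℝ)}
  (hp : p ∈ dualVec (optMeasure P ℱ μ) (optFilt ℱ t) d m)

include hcomplete hμ hp

theorem mul_sect_wTrans_ae_eq (s : Fin (T + 1)) : ∀ᵐ ω ∂P, ∀ i,
    μ s ω * sect (wTrans (optMeasure P ℱ μ) (optFilt ℱ t) (optSigma ℱ) p.1 p.2) s ω i =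
      massProcess P ℱ μ (p.1 i) s ω * sect p.2 s ω i := by
  have := isProbabilityMeasure_optMeasure hμ
  refine ae_all_iff.2 fun i => ?_
  have h := (ae_optMeasure_iff hcomplete hμ).1 (xi_self_ae_eq optFilt_le_optSigma (hp.1 i)) s
  filter_upwards [h] with ω h1
  simp only [sect, wTrans, massProcess, h1]
  ring

/-- Membership in the dual cone of `M_+` controls the eligible components only; the others are
non-negative because the transported weight is. -/
theorem sect_dual_nonneg (s : Fin (T + 1)) : ∀ᵐ ω ∂P, ∀ i, 0 ≤ sect p.2 s ω i := by
  have := isProbabilityMeasure_optMeasure hμ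
  refine ae_all_iff.2 fun i => ?_
  exact (ae_optMeasure_iff hcomplete hμ).1 (nonneg_of_mul_xi_nonneg optFilt_le_optSigma le_rfl
    (hp.1 i) (measurable_coord hp.2.1.1.1 i) (hp.2.2.2.mono fun x h => h i)) s

/-- Before `t` the density of each measure in `p.1` is one, so transport leaves the weight
unchanged. -/
theorem sect_wTrans_ae_eq_of_lt (hs : s < t) :
    sect (wTrans (optMeasure P ℱ μ) (optFilt ℱ t) (optSigma ℱ) p.1 p.2) s =ᵐ[P] sect p.2 s := by
  filter_upwards [mul_sect_wTrans_ae_eq hcomplete hμ hp s, hμ.pos,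
    ae_all_iff.2 fun i => massProcess_of_lt hμ (hp.1 i) hs] with ω h1 h2 h3
  ext i
  have := h1 i
  rw [h3 i] at this
  exact mul_left_cancel₀ (h2 s).ne' this

end DualVariables

end DualCones

/-! ### The map `W_t` on dual variables -/

section ToProcesses

variable {Ω : Type*} {mΩ : MeasurableSpace Ω} {P : Measure Ω} {T d m : ℕ}
  {ℱ : Filtration (Fin (T + 1)) mΩ} {s t : Fin (T + 1)} {μ : Fin (T + 1) → Ω → ℝ}
  {ρ : (Fin (T + 1) → Ω → Fin d → ℝ) → Set (Ω → Fin d → ℝ)}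
  {R : Fin (T + 1) → (Ω → Fin d → ℝ) → Set (Ω → Fin d → ℝ)}
  [IsProbabilityMeasure P]
  (hcomplete : ∀ A : Set Ω, P A = 0 → MeasurableSet[ℱ 0] A) (hμ : IsReference P ℱ μ)

section OneMeasure

variable {Qbar : @Measure (Ω × Fin (T + 1)) (optSigma ℱ)} {Q : Measure Ω}
  {ψ : Fin (T + 1) → Ω → ℝ}

include hμ in
-- The right-hand side involves only the optional measure, so the weights produced by `W_t` are the
-- same for all decompositions.
theorem IsDecomp.condQ_ae_eq (h : IsDecomp P ℱ μ Qbar Q ψ)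
    (hQbar : Qbar ∈ probOn (optMeasure P ℱ μ) (optFilt ℱ t)) (hs : t ≤ s) :
    condQ P (ℱ t) Q (ψ s) =ᵐ[P] P[massProcess P ℱ μ Qbar s | ℱ t] :=
  (SetRisk.condQ_ae_eq (ℱ.le t) (ℱ.mono hs) (ℱ.le s) (h.mem_probOn hμ hQbar) (h.2.1.1 s)
    (optRandomMeasures_abs_le_one h.2.1 s)).trans
    (condExp_congr_ae (h.condExp_mul_eq hμ hQbar.1 s))

variable (P ℱ μ t Q ψ s) in
open Classical in
/-- The conditional density at time `s` of the measures in `W_t`. -/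
noncomputable def splitDensity (ω : Ω) : ℝ :=
  if 0 < condQ P (ℱ t) Q (ψ s) ω then
    ψ s ω / condQ P (ℱ t) Q (ψ s) ω * xi P (ℱ t) (ℱ s) Q ω
  else μ s ω / (P[μ s | ℱ t]) ω

include hμ in
theorem condExp_reference_pos : ∀ᵐ ω ∂P, 0 < P[μ s | ℱ t] ω := by
  obtain ⟨ε, hε, h⟩ := hμ.bounded_below
  have h1 := condExp_mono (m := ℱ t) (integrable_const (μ := P) ε) (integrable_reference hμ s)
    (h.mono fun ω h => (h s).le)
  rw [condExp_const (ℱ.le t)] at h1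
  exact h1.mono fun ω h => hε.trans_le h

include hμ in
-- This fallback density has conditional mean one; integrability holds because the conditional
-- expectation of `μ s` inherits the lower bound `ε`.
theorem condExp_reference_normalized :
    Integrable (fun ω => μ s ω / P[μ s | ℱ t] ω) P ∧
      P[fun ω => μ s ω / P[μ s | ℱ t] ω | ℱ t] =ᵐ[P] fun _ => 1 := by
  obtain ⟨ε, hε, h⟩ := hμ.bounded_below
  have h1 := condExp_mono (m := ℱ t) (integrable_const (μ := P) ε) (integrable_reference hμ s)
    (h.mono fun ω h => (h s).le)
  rw [condExp_const (ℱ.le t)] at h1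
  have hi : Integrable (fun ω => μ s ω * (P[μ s | ℱ t] ω)⁻¹) P := by
    refine integrable_mul_of_bound (C := ε⁻¹) (integrable_reference hμ s)
      (measurable_condExp'.inv.mono (ℱ.le t) le_rfl).aestronglyMeasurable ?_
    filter_upwards [h1] with ω h
    have h0 : 0 < P[μ s | ℱ t] ω := hε.trans_le h
    rw [abs_of_pos (inv_pos.2 h0)]
    exact inv_anti₀ hε h
  simp only [div_eq_mul_inv]
  refine ⟨hi, ?_⟩
  filter_upwards [condExp_mul_of_stronglyMeasurable_right
    (measurable_condExp'.inv.stronglyMeasurable) hi (integrable_reference hμ s),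
    condExp_reference_pos (s := s) (t := t) hμ] with ω h2 h3
  exact h2.trans (mul_inv_cancel₀ h3.ne')

include hμ in
-- The product `ψ_s ξ_{t,s}(Q)` is the mass of the optional measure at `s`, and the normalizer is
-- its conditional expectation. The split density is therefore the conditional density of that mass,
-- and multiplying by the normalizer recovers the mass, also where the normalizer vanishes.
theorem IsDecomp.splitDensity_spec (h : IsDecomp P ℱ μ Qbar Q ψ)
    (hQbar : Qbar ∈ probOn (optMeasure P ℱ μ) (optFilt ℱ t)) (hs : t ≤ s) :
    (P.withDensity fun ω => ENNReal.ofReal (splitDensity P ℱ s t μ Q ψ ω)) ∈ probOn P (ℱ t) ∧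
    (fun ω => condQ P (ℱ t) Q (ψ s) ω * xi P (ℱ t) (ℱ s)
      (P.withDensity fun ω => ENNReal.ofReal (splitDensity P ℱ s t μ Q ψ ω)) ω) =ᵐ[P]
      massProcess P ℱ μ Qbar s := by
  have hQ := h.mem_probOn hμ hQbar
  have hc := h.condQ_ae_eq hμ hQbar hs
  have hcm : Measurable[ℱ t] (condQ P (ℱ t) Q (ψ s)) := measurable_condQ
  have hcm' : Measurable[ℱ s] (condQ P (ℱ t) Q (ψ s)) := hcm.mono (ℱ.mono hs) le_rfl
  have hA := integrable_massProcess hμ hQbar.1 s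
  have hA0 := massProcess_nonneg (P := P) (Qbar := Qbar) hμ s
  have hb := condExp_reference_normalized (P := P) (s := s) (t := t) hμ
  have hb0 : ∀ᵐ ω ∂P, 0 ≤ μ s ω / P[μ s | ℱ t] ω := by
    filter_upwards [hμ.pos, condExp_reference_pos (s := s) (t := t) hμ] with ω h1 h2
    exact div_nonneg (h1 s).le h2.le
  have hfm : Measurable[ℱ s] (splitDensity P ℱ s t μ Q ψ) :=
    Measurable.ite (measurableSet_lt measurable_const hcm')
      (((h.2.1.1 s).div hcm').mul (measurable_xi (ℱ.mono hs)))
      ((hμ.adapted s).div (measurable_condExp'.mono (ℱ.mono hs) le_rfl))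
  have hf : ∀ᵐ ω ∂P, splitDensity P ℱ s t μ Q ψ ω = if 0 < condQ P (ℱ t) Q (ψ s) ω then
      massProcess P ℱ μ Qbar s ω / condQ P (ℱ t) Q (ψ s) ω else μ s ω / P[μ s | ℱ t] ω := by
    filter_upwards [h.condExp_mul_eq hμ hQbar.1 s, xi_ae_eq (G := ℱ s) (ℱ.le t) hQ] with ω h1 h2
    by_cases h0 : 0 < condQ P (ℱ t) Q (ψ s) ω
    · simp only [splitDensity, h0, if_true, h2, ← h1]
      ring
    · simp only [splitDensity, h0, if_false]
  have hf0 : 0 ≤ᵐ[P] splitDensity P ℱ s t μ Q ψ := by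
    filter_upwards [hf, hA0, hb0] with ω h1 h2 h3
    rw [Pi.zero_apply, h1]
    split_ifs with h0
    · exact div_nonneg h2 h0.le
    · exact h3
  have key : ∀ A, MeasurableSet[ℱ t] A →
      ∫⁻ ω in A, ENNReal.ofReal (splitDensity P ℱ s t μ Q ψ ω) ∂P = P A := fun A hA' =>
    setLIntegral_condDensity (ℱ.le t) hA hA0 hb.1 hb0 hb.2 hcm hc hf hA'
  refine ⟨withDensity_mem_probOn (ℱ.le t) key, ?_⟩
  filter_upwards [xi_withDensity (ℱ.le t) (ℱ.le s) hfm hf0 key, hf, hc,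
    eq_zero_of_condExp_nonpos (ℱ.le t) hA hA0, condExp_nonneg (m := ℱ t) hA0] with ω h1 h2 h3 h4 h5
  rw [h1, h2]
  split_ifs with h0
  · exact mul_div_cancel₀ _ h0.ne'
  · rw [h4 (h3 ▸ not_lt.1 h0)]
    rw [le_antisymm (not_lt.1 h0) (h3 ▸ h5), zero_mul]

end OneMeasure

variable {p : (Fin d → @Measure (Ω × Fin (T + 1)) (optSigma ℱ)) × (Ω × Fin (T + 1) → Fin d → ℝ)}
  (hp : p ∈ dualVec (optMeasure P ℱ μ) (optFilt ℱ t) d m)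
  {Q : Fin d → Measure Ω} {ψ : Fin d → Fin (T + 1) → Ω → ℝ}
  (hQψ : ∀ i, IsDecomp P ℱ μ (p.1 i) (Q i) (ψ i))

include hcomplete hμ hp hQψ

/-- The normalizer in the new measure cancels against the one in the new weight, leaving the
optional mass at `s` times the optional weight. That weight may be read at `t` or at `s`, being
constant from `t` on. -/
theorem wTrans_Wmap_ae_eq (s : Ici t) :
    wTrans P (ℱ t) (ℱ s) ((Wmap P ℱ μ t Q ψ p.2).1 s) ((Wmap P ℱ μ t Q ψ p.2).2 s) =ᵐ[P]
      fun ω => (mass μ t ω)⁻¹ • μ s ω •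
        sect (wTrans (optMeasure P ℱ μ) (optFilt ℱ t) (optSigma ℱ) p.1 p.2) s ω := by
  have h3 := ((mem_LOne_optFilt_iff hμ).1 hp.2.1.1).2.2 s s.2
  have h4 : ∀ i, ∀ᵐ ω ∂P, condQ P (ℱ t) (Q i) (ψ i s) ω * xi P (ℱ t) (ℱ s)
      (P.withDensity fun ω => ENNReal.ofReal (splitDensity P ℱ s t μ (Q i) (ψ i) ω)) ω =
      massProcess P ℱ μ (p.1 i) s ω := fun i =>
    ((hQψ i).splitDensity_spec hμ (hp.1 i) (s := s.1) s.2).2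
  filter_upwards [mul_sect_wTrans_ae_eq hcomplete hμ hp s, ae_all_iff.2 h4] with ω h1 h2
  ext i
  rw [Pi.smul_apply, Pi.smul_apply, smul_eq_mul, smul_eq_mul, h1 i, ← h2 i, h3]
  simp only [wTrans, Wmap, sect, splitDensity, mass]
  ring

theorem Wmap_fst_mem_probOn (s : Ici t) (i : Fin d) :
    (Wmap P ℱ μ t Q ψ p.2).1 s i ∈ probOn P (ℱ t) :=
  ((hQψ i).splitDensity_spec hμ (hp.1 i) (s := s.1) s.2).1

theorem Wmap_snd_mem_LOne (s : Ici t) : (Wmap P ℱ μ t Q ψ p.2).2 s ∈ LOne P (ℱ t) d := by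
  obtain ⟨C, -, hC⟩ := exists_abs_inv_mass_le (P := P) (t := t) hμ
  have hw := ((mem_LOne_optFilt_iff hμ).1 hp.2.1.1).2.1
  have hm : ∀ i, Measurable[ℱ t] fun ω => condQ P (ℱ t) (Q i) (ψ i s) ω / mass μ t ω := fun i =>
    measurable_condQ.div (measurable_mass hμ)
  refine ⟨measurable_vec fun i => (hm i).mul (measurable_coord hw.1 i), fun i => ?_⟩
  refine (hw.2 i).bdd_mul (c := C) ((hm i).mono (ℱ.le t) le_rfl).aestronglyMeasurable ?_
  filter_upwards [hC, condQ_bound (ℱ.le t) ((hQψ i).mem_probOn hμ (hp.1 i))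
    (((hQψ i).2.1.1 s).mono (ℱ.le s) le_rfl)
    (optRandomMeasures_abs_le_one (hQψ i).2.1 s)] with ω h1 h2
  rw [Real.norm_eq_abs, div_eq_mul_inv, abs_mul]
  calc _ ≤ 1 * C := mul_le_mul h2 h1 (abs_nonneg _) zero_le_one
    _ = C := one_mul C

theorem Wmap_snd_nonneg (s : Ici t) : ∀ᵐ ω ∂P, ∀ i, 0 ≤ (Wmap P ℱ μ t Q ψ p.2).2 s ω i := by
  have hc0 : ∀ i, ∀ᵐ ω ∂P, 0 ≤ condQ P (ℱ t) (Q i) (ψ i s) ω := fun i => by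
    have h0 := condExp_nonneg (m := ℱ t) (massProcess_nonneg (P := P) (Qbar := p.1 i) hμ s)
    filter_upwards [(hQψ i).condQ_ae_eq hμ (hp.1 i) (s := s.1) s.2, h0] with ω h1 h2
    rw [h1]; exact h2
  filter_upwards [sect_dual_nonneg hcomplete hμ hp t, mass_pos (P := P) (t := t) hμ,
    ae_all_iff.2 hc0] with ω h1 h2 h3 i
  exact mul_nonneg (div_nonneg (h3 i) h2.2.le) (h1 i)

theorem Wmap_wTrans_mem_LOnePos (s : Ici t) :
    wTrans P (ℱ t) (ℱ s) ((Wmap P ℱ μ t Q ψ p.2).1 s) ((Wmap P ℱ μ t Q ψ p.2).2 s) ∈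
      LOnePos P (ℱ s) d := by
  obtain ⟨C, -, hC⟩ := exists_abs_inv_mass_le (P := P) (t := t) hμ
  have hst : ℱ t ≤ ℱ s := ℱ.mono s.2
  have hw := Wmap_snd_mem_LOne hcomplete hμ hp hQψ s
  have h1 := (mem_LOne_optSigma_iff hμ).1 hp.2.2.1 s
  have hm : Measurable[ℱ s] fun ω => (mass μ t ω)⁻¹ := (measurable_mass hμ).inv.mono hst le_rfl
  have h2 := smul_fun_mem_LOne (ℱ.le s) (smul_mem_LOne hμ h1) hm hC
  have h3 := wTrans_Wmap_ae_eq hcomplete hμ hp hQψ s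
  refine ⟨⟨measurable_vec fun i => ((measurable_coord hw.1 i).mono hst le_rfl).mul
    (measurable_xi hst), fun i => (h2.2 i).congr (h3.symm.mono fun ω h => congrFun h i)⟩, ?_⟩
  filter_upwards [h3, hμ.pos, mass_pos (P := P) (t := t) hμ,
    (ae_optMeasure_iff hcomplete hμ).1 hp.2.2.2 s] with ω h1 h2 h3 h4 i
  rw [h1]
  exact mul_nonneg (inv_nonneg.2 h3.2.le) (mul_nonneg (h2 s).le (h4 i))

theorem Wmap_mem_dualProc : Wmap P ℱ μ t Q ψ p.2 ∈ dualProc P ℱ d m t :=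
  ⟨Wmap_fst_mem_probOn hcomplete hμ hp hQψ, fun s => mem_dualCone_MPos
    (Wmap_snd_mem_LOne hcomplete hμ hp hQψ s) (Wmap_snd_nonneg hcomplete hμ hp hQψ s),
    Wmap_wTrans_mem_LOnePos hcomplete hμ hp hQψ⟩

/-- Positivity on the optional acceptance set splits into conditions time by time before `t` and a
joint one afterwards. The former are the conditions on the sections of the weight after removing
`μ_s`; the latter is the condition on the image under `W_t` after removing the inverse mass. The
decomposition is arbitrary. -/
theorem mem_dualVecMax_toOptional_iff (hρ : IsClosedCoherentProc P ℱ m t ρ)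
    (hR : ∀ s < t, IsClosedCoherentVec P (ℱ s) (ℱ s) m (R s)) :
    p ∈ dualVecMax (optMeasure P ℱ μ) (optFilt ℱ t) m (toOptional t ρ R) ↔
      (∀ s < t, sect p.2 s ∈ dualRestrMax P (ℱ s) m (R s)) ∧
        Wmap P ℱ μ t Q ψ p.2 ∈ dualProcMax P ℱ m t ρ := by
  have hcoh := isClosedCoherentVec_toOptional hcomplete hμ hρ hR
  have hw := (mem_LOne_optFilt_iff hμ).1 hp.2.1.1
  obtain ⟨C, -, hC⟩ := exists_abs_inv_mass_le (P := P) (t := t) hμ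
  obtain ⟨C', -, hC'⟩ := hμ.exists_abs_inv_le
  have e1 : ∀ s < t, (∀ Y ∈ LInf P (ℱ s) d,
      spike s Y ∈ accVec (optMeasure P ℱ μ) (optSigma ℱ) (toOptional t ρ R) →
      0 ≤ pairing P (fun ω => μ s ω •
        sect (wTrans (optMeasure P ℱ μ) (optFilt ℱ t) (optSigma ℱ) p.1 p.2) s ω) Y) ↔
      sect p.2 s ∈ dualRestrMax P (ℱ s) m (R s) := fun s hs => by
    have h1 := (hR s hs).pairing_smul_nonneg_iff le_rfl (Z := sect p.2 s) (hμ.adapted s)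
      (hμ.pos.mono fun _ h => h s) (hμ.abs_le_one s) (hC' s)
    have h2 : ∀ Y, pairing P (fun ω => μ s ω •
        sect (wTrans (optMeasure P ℱ μ) (optFilt ℱ t) (optSigma ℱ) p.1 p.2) s ω) Y =
        pairing P (fun ω => μ s ω • sect p.2 s ω) Y := fun Y =>
      pairing_congr ((sect_wTrans_ae_eq_of_lt hcomplete hμ hp hs).mono fun ω h => by simp only [h])
    simp only [h2]
    have h0 := sect_dual_nonneg hcomplete hμ hp s
    constructor
    · intro h
      refine ⟨mem_dualCone_MPos (hw.1 s hs) h0, ⟨hw.1 s hs, h0⟩, hw.1 s hs, h1.1 fun Y hY => ?_⟩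
      exact h Y hY.1 ((spike_mem_acc_toOptional_iff hcomplete hμ hρ hR hs hY.1).2 hY)
    · intro h Y hY hYA
      exact h1.2 h.2.2.2 Y ((spike_mem_acc_toOptional_iff hcomplete hμ hρ hR hs hY).1 hYA)
  have e2 : (∀ X ∈ ProcInf P ℱ d t,
      embed t X ∈ accVec (optMeasure P ℱ μ) (optSigma ℱ) (toOptional t ρ R) →
        0 ≤ ∑ s : Ici t, pairing P (fun ω => μ s ω •
          sect (wTrans (optMeasure P ℱ μ) (optFilt ℱ t) (optSigma ℱ) p.1 p.2) s ω) (X s)) ↔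
      Wmap P ℱ μ t Q ψ p.2 ∈ dualProcMax P ℱ m t ρ := by
    rw [hρ.mem_dualProcMax_iff (Wmap_mem_dualProc hcomplete hμ hp hQψ)]
    simp only [fun (s : Ici t) X => pairing_congr (X := X)
      (wTrans_Wmap_ae_eq hcomplete hμ hp hQψ s)]
    rw [hρ.pairing_smul_nonneg_iff (Z := fun s ω => μ s ω •
        sect (wTrans (optMeasure P ℱ μ) (optFilt ℱ t) (optSigma ℱ) p.1 p.2) s ω)
      (l := fun ω => (mass μ t ω)⁻¹)
      (measurable_mass hμ).inv ((mass_pos hμ).mono fun _ h => inv_pos.2 h.2) hC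
      (by simpa only [inv_inv] using mass_le_one hμ)]
    constructor
    · exact fun h X hX => h X hX.1 ((embed_mem_acc_toOptional_iff hcomplete hμ hρ hR hX.1).2 hX)
    · exact fun h X hX hXA => h X ((embed_mem_acc_toOptional_iff hcomplete hμ hρ hR hX).1 hXA)
  rw [← e2, ← forall₂_congr e1, ← forall_pairing_nonneg_iff hcomplete hμ hcoh hp.2.2.1]
  exact ⟨fun h => h.2.2, fun h => ⟨hp, hp.2.2.1, h⟩⟩

end ToProcesses

/-! ### Normalization of conditional densities -/

section XiSpec

variable {Ω : Type*} {F G m0 : MeasurableSpace Ω} {P : Measure Ω} [IsProbabilityMeasure P]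

theorem xi_spec (hFG : F ≤ G) (hG : G ≤ m0) {Q : Measure Ω} (hQ : Q ∈ probOn P F) :
    Integrable (xi P F G Q) P ∧ 0 ≤ᵐ[P] xi P F G Q ∧ P[xi P F G Q | F] =ᵐ[P] fun _ => 1 := by
  have h := xi_ae_eq (G := G) (hFG.trans hG) hQ
  refine ⟨integrable_condExp.congr h.symm, ?_, (condExp_congr_ae h).trans
    ((condExp_condExp_of_le hFG hG).trans (condExp_dens (hFG.trans hG) hQ))⟩
  have h0 := condExp_nonneg (m := G) (dens_nonneg (P := P) (Q := Q))
  filter_upwards [h, h0] with ω h1 h2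
  rw [h1]; exact h2

end XiSpec

/-! ### The map `W̄_t` on dual variables -/

section ToOptionalSpace

variable {Ω : Type*} {mΩ : MeasurableSpace Ω} {P : Measure Ω} {T d m : ℕ}
  {ℱ : Filtration (Fin (T + 1)) mΩ} {s t : Fin (T + 1)} {μ : Fin (T + 1) → Ω → ℝ}
  {Rbar : (Ω × Fin (T + 1) → Fin d → ℝ) → Set (Ω × Fin (T + 1) → Fin d → ℝ)}
  {Q : Ici t → Fin d → Measure Ω} {w : Ici t → Ω → Fin d → ℝ}

theorem sum_congr_of_lt {M : Type*} [AddCommMonoid M] {f g : Fin (T + 1) → M}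
    (h : ∀ s < t, f s = g s) (h' : ∑ s : Ici t, f s = ∑ s : Ici t, g s) :
    ∑ s, f s = ∑ s, g s := by
  have key : ∀ f : Fin (T + 1) → M, ∑ s, f s =
      ∑ s : Ici t, f s + ∑ s ∈ Finset.univ.filter (fun s => ¬ t ≤ s), f s := fun f => by
    rw [← Finset.sum_filter_add_sum_filter_not Finset.univ (fun s => t ≤ s) f,
      Finset.sum_subtype (p := (· ∈ Ici t)) (Finset.univ.filter (t ≤ ·)) (by simp) f]
  rw [key f, key g, h']
  congr 1
  exact Finset.sum_congr rfl fun s hs => h s (not_le.1 (Finset.mem_filter.1 hs).2)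

open Classical in
/-- The proportion of the weight at time `s` in the total weight. -/
noncomputable def splitWeight (w : Ici t → Ω → Fin d → ℝ) (i : Fin d) (s : Ici t) (ω : Ω) : ℝ :=
  if 0 < wbarSum w ω i then w s ω i / wbarSum w ω i else 1 / ((Fintype.card (Ici t) : ℕ) : ℝ)

theorem WbarDensity_of_le (i : Fin d) (s : Ici t) (ω : Ω) :
    WbarDensity P ℱ μ t Q w i (ω, s) =
      mass μ t ω / μ s ω * splitWeight w i s ω * xi P (ℱ t) (ℱ s) (Q s i) ω := by
  have hs : t ≤ s := s.2
  simp only [WbarDensity, hs, dif_pos, splitWeight]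

theorem WbarDensity_of_lt (i : Fin d) (hs : s < t) (ω : Ω) :
    WbarDensity P ℱ μ t Q w i (ω, s) = 1 := by
  simp only [WbarDensity, not_le.2 hs, dif_neg, not_false_eq_true]

theorem wbarSum_eq {ω : Ω} (h : ∀ s i, 0 ≤ w s ω i) (i : Fin d) :
    wbarSum w ω i = ∑ s : Ici t, w s ω i := by
  refine Finset.sum_congr rfl fun s _ => ?_
  split_ifs with h0
  · rfl
  · exact le_antisymm (h s i) (not_lt.1 h0)

theorem wbarSum_nonneg (ω : Ω) (i : Fin d) : 0 ≤ wbarSum w ω i :=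
  Finset.sum_nonneg fun s _ => by split_ifs with h <;> [exact h.le; exact le_rfl]

theorem splitWeight_nonneg {ω : Ω} (h : ∀ s i, 0 ≤ w s ω i) (i : Fin d) (s : Ici t) :
    0 ≤ splitWeight w i s ω := by
  unfold splitWeight
  split_ifs with h0
  · exact div_nonneg (h s i) h0.le
  · positivity

theorem sum_splitWeight {ω : Ω} (h : ∀ s i, 0 ≤ w s ω i) (i : Fin d) :
    ∑ s : Ici t, splitWeight w i s ω = 1 := by
  unfold splitWeight
  split_ifs with h0
  · rw [← Finset.sum_div, ← wbarSum_eq h, div_self h0.ne']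
  · have : Nonempty (Ici t) := ⟨⟨t, mem_Ici.2 le_rfl⟩⟩
    rw [Finset.sum_const, Finset.card_univ, nsmul_eq_mul, mul_one_div_cancel]
    exact Nat.cast_ne_zero.2 Fintype.card_ne_zero

/-- If the total weight vanishes, every summand does, so the even spreading used there is invisible
after multiplication by the total. -/
theorem wbarSum_mul_splitWeight {ω : Ω} (h : ∀ s i, 0 ≤ w s ω i) (i : Fin d) (s : Ici t) :
    wbarSum w ω i * splitWeight w i s ω = w s ω i := by
  unfold splitWeight
  split_ifs with h0
  · exact mul_div_cancel₀ _ h0.ne'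
  · have h1 := le_antisymm (not_lt.1 h0) (wbarSum_nonneg ω i)
    rw [h1, zero_mul]
    rw [wbarSum_eq h, Finset.sum_eq_zero_iff_of_nonneg fun s _ => h s i] at h1
    exact (h1 s (Finset.mem_univ s)).symm

theorem measurable_wbarSum (hw : ∀ s, Measurable[ℱ t] (w s)) (i : Fin d) :
    Measurable[ℱ t] fun ω => wbarSum w ω i :=
  Finset.measurable_fun_sum _ fun s _ => Measurable.ite
    (measurableSet_lt measurable_const (measurable_coord (hw s) i)) (measurable_coord (hw s) i)
    measurable_const

theorem measurable_splitWeight (hw : ∀ s, Measurable[ℱ t] (w s)) (i : Fin d) (s : Ici t) :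
    Measurable[ℱ t] (splitWeight w i s) :=
  Measurable.ite (measurableSet_lt measurable_const (measurable_wbarSum hw i))
    ((measurable_coord (hw s) i).div (measurable_wbarSum hw i)) measurable_const

variable [IsProbabilityMeasure P]
  (hcomplete : ∀ A : Set Ω, P A = 0 → MeasurableSet[ℱ 0] A) (hμ : IsReference P ℱ μ)

include hμ in
theorem measurable_WbarDensity (hw : ∀ s, Measurable[ℱ t] (w s)) (i : Fin d) :
    Measurable[optSigma ℱ] (WbarDensity P ℱ μ t Q w i) := by
  refine measurable_optSigma_iff.2 fun s => ?_
  by_cases hs : t ≤ s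
  · have hst := ℱ.mono hs
    have e : sect (WbarDensity P ℱ μ t Q w i) s = fun ω => mass μ t ω / μ s ω *
        splitWeight w i ⟨s, hs⟩ ω * xi P (ℱ t) (ℱ s) (Q ⟨s, hs⟩ i) ω :=
      funext fun ω => WbarDensity_of_le i ⟨s, hs⟩ ω
    rw [e]
    exact ((((measurable_mass hμ).mono hst le_rfl).div (hμ.adapted s)).mul
      ((measurable_splitWeight hw i _).mono hst le_rfl)).mul (measurable_xi hst)
  · have e : sect (WbarDensity P ℱ μ t Q w i) s = fun ω => 1 :=
      funext fun ω => WbarDensity_of_lt i (not_le.1 hs) ω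
    rw [e]
    exact measurable_const

variable {p : (Ici t → Fin d → Measure Ω) × (Ici t → Ω → Fin d → ℝ)}
  (hp : p ∈ dualProc P ℱ d m t)

include hp in
theorem dualProc_nonneg : ∀ᵐ ω ∂P, ∀ s i, 0 ≤ p.2 s ω i := by
  refine ae_all_iff.2 fun s => ae_all_iff.2 fun i => ?_
  exact nonneg_of_mul_xi_nonneg (ℱ.mono s.2) (ℱ.le s) (hp.1 s i)
    (measurable_coord (hp.2.1 s).1.1 i) ((hp.2.2 s).2.mono fun ω h => h i)

include hcomplete hμ hp

theorem WbarDensity_nonneg (i : Fin d) :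
    ∀ᵐ x ∂(optMeasure P ℱ μ), 0 ≤ WbarDensity P ℱ μ t p.1 p.2 i x := by
  refine (ae_optMeasure_iff hcomplete hμ).2 fun s => ?_
  by_cases hs : t ≤ s
  · filter_upwards [dualProc_nonneg hp, hμ.pos, mass_pos (t := t) hμ,
      (xi_spec (ℱ.mono hs) (ℱ.le s) (hp.1 ⟨s, hs⟩ i)).2.1] with ω h1 h2 h3 h4
    rw [WbarDensity_of_le i ⟨s, hs⟩ ω]
    exact mul_nonneg (mul_nonneg (div_nonneg h3.2.le (h2 s).le) (splitWeight_nonneg h1 i _)) h4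
  · exact Filter.Eventually.of_forall fun ω => by
      rw [WbarDensity_of_lt i (not_le.1 hs)]; exact zero_le_one

/-- Before `t` the density is one. From `t` on, the factor `μ_s` cancels, the conditional densities
average to one given time `t`, and the proportions sum to one, which leaves the remaining mass,
equal to the sum of the later `μ_s`. Hence the new measures agree with the optional one at time `t`.
-/
theorem setLIntegral_WbarDensity (i : Fin d) {B : Set (Ω × Fin (T + 1))}
    (hB : MeasurableSet[optFilt ℱ t] B) :
    ∫⁻ x in B, ENNReal.ofReal (WbarDensity P ℱ μ t p.1 p.2 i x) ∂(optMeasure P ℱ μ) =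
      optMeasure P ℱ μ B := by
  have hw : ∀ s, Measurable[ℱ t] (p.2 s) := fun s => (hp.2.1 s).1.1
  have hB' := optFilt_le_optSigma _ hB
  have hBt := measurableSet_optFilt_iff.1 hB
  have hA := ℱ.le t _ hBt.2.1
  set A := {ω | (ω, t) ∈ B}
  rw [setLIntegral_optMeasure hμ (measurable_WbarDensity hμ hw i).ennreal_ofReal hB',
    optMeasure_apply hμ hB']
  refine sum_congr_of_lt (t := t) (fun s hs => ?_) ?_
  · simp only [WbarDensity_of_lt i hs, ENNReal.ofReal_one, mul_one]
  have hBs : ∀ s : Ici t, {ω | (ω, (s : Fin (T + 1))) ∈ B} = A := fun s =>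
    Set.ext fun ω => hBt.2.2 s s.2 ω
  simp only [hBs]
  have hgm : ∀ s : Ici t, Measurable[ℱ t] fun ω => mass μ t ω * splitWeight p.2 i s ω := fun s =>
    (measurable_mass hμ).mul (measurable_splitWeight hw i s)
  have e1 : ∀ s : Ici t, ∫⁻ ω in A, ENNReal.ofReal (μ s ω) *
      ENNReal.ofReal (WbarDensity P ℱ μ t p.1 p.2 i (ω, s)) ∂P =
      ∫⁻ ω in A, ENNReal.ofReal (mass μ t ω * splitWeight p.2 i s ω) ∂P := fun s => by
    have hx := xi_spec (ℱ.mono s.2) (ℱ.le s) (hp.1 s i)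
    have h1 := setLIntegral_mul_condExp (ℱ.le t) (hgm s).ennreal_ofReal hx.1 hx.2.1 hBt.2.1
    have h2 : ∫⁻ ω in A, ENNReal.ofReal (mass μ t ω * splitWeight p.2 i s ω) *
        ENNReal.ofReal (P[xi P (ℱ t) (ℱ s) (p.1 s i) | ℱ t] ω) ∂P =
        ∫⁻ ω in A, ENNReal.ofReal (mass μ t ω * splitWeight p.2 i s ω) ∂P := by
      refine setLIntegral_congr_fun_ae hA (hx.2.2.mono fun ω h _ => ?_)
      rw [h, ENNReal.ofReal_one, mul_one]
    rw [← h2, ← h1]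
    refine setLIntegral_congr_fun_ae hA ?_
    filter_upwards [hμ.pos, dualProc_nonneg hp, mass_pos (t := t) hμ] with ω h3 h4 h5 _
    rw [← ENNReal.ofReal_mul (h3 s).le,
      ← ENNReal.ofReal_mul (mul_nonneg h5.2.le (splitWeight_nonneg h4 i s)), WbarDensity_of_le]
    congr 1
    have := (h3 s).ne'
    field_simp
  simp only [e1]
  rw [← lintegral_finsetSum _ fun s _ => ((hgm s).mono (ℱ.le t) le_rfl).ennreal_ofReal,
    ← lintegral_finsetSum (f := fun (s : Ici t) ω => ENNReal.ofReal (μ s ω)) _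
      fun (s : Ici t) _ => (hμ.measurable s).ennreal_ofReal]
  refine setLIntegral_congr_fun_ae hA ?_
  filter_upwards [hμ.pos, dualProc_nonneg hp, mass_pos (t := t) hμ, sum_Ici_eq_mass (t := t) hμ]
    with ω h3 h4 h5 h6 _
  rw [← ENNReal.ofReal_sum_of_nonneg fun s _ => mul_nonneg h5.2.le (splitWeight_nonneg h4 i s),
    ← ENNReal.ofReal_sum_of_nonneg fun (s : Ici t) _ => (h3 s).le, ← Finset.mul_sum, sum_splitWeight h4, h6,
    mul_one]

theorem WbarMap_fst_mem_probOn (i : Fin d) :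
    (WbarMap P ℱ μ t p).1 i ∈ probOn (optMeasure P ℱ μ) (optFilt ℱ t) := by
  have := isProbabilityMeasure_optMeasure hμ
  exact withDensity_mem_probOn optFilt_le_optSigma fun B hB =>
    setLIntegral_WbarDensity hcomplete hμ hp i hB

theorem xi_WbarMap_ae_eq (i : Fin d) :
    xi (optMeasure P ℱ μ) (optFilt ℱ t) (optSigma ℱ) ((WbarMap P ℱ μ t p).1 i)
      =ᵐ[optMeasure P ℱ μ] WbarDensity P ℱ μ t p.1 p.2 i := by
  have := isProbabilityMeasure_optMeasure hμ
  exact xi_withDensity optFilt_le_optSigma le_rfl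
    (measurable_WbarDensity hμ (fun s => (hp.2.1 s).1.1) i)
    (WbarDensity_nonneg hcomplete hμ hp i)
    fun B hB => setLIntegral_WbarDensity hcomplete hμ hp i hB

/-- Total weight times proportion restores the individual weight, and `μ_s` cancels against the
denominator of the density; only the remaining mass is left over. -/
theorem mul_sect_wTrans_WbarMap_ae_eq (s : Ici t) :
    (fun ω => μ s ω • sect (wTrans (optMeasure P ℱ μ) (optFilt ℱ t) (optSigma ℱ)
      (WbarMap P ℱ μ t p).1 (WbarMap P ℱ μ t p).2) s ω) =ᵐ[P]
      fun ω => mass μ t ω • wTrans P (ℱ t) (ℱ s) (p.1 s) (p.2 s) ω := by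
  have h : ∀ i, ∀ᵐ ω ∂P, _ := fun i =>
    (ae_optMeasure_iff hcomplete hμ).1 (xi_WbarMap_ae_eq hcomplete hμ hp i) s
  filter_upwards [hμ.pos, dualProc_nonneg hp, ae_all_iff.2 h] with ω h1 h2 h3
  ext i
  have hs : t ≤ s := s.2
  have e : sect (wTrans (optMeasure P ℱ μ) (optFilt ℱ t) (optSigma ℱ)
      (WbarMap P ℱ μ t p).1 (WbarMap P ℱ μ t p).2) s ω i =
      wbarSum p.2 ω i * (mass μ t ω / μ s ω * splitWeight p.2 i s ω *
        xi P (ℱ t) (ℱ s) (p.1 s i) ω) := by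
    rw [← WbarDensity_of_le, ← h3 i]
    simp only [sect, wTrans, WbarMap, hs, if_true]
  simp only [Pi.smul_apply, smul_eq_mul, e, wTrans]
  rw [← wbarSum_mul_splitWeight h2 i s]
  have := (h1 s).ne'
  field_simp

theorem sect_wTrans_WbarMap_of_lt (hs : s < t) :
    sect (wTrans (optMeasure P ℱ μ) (optFilt ℱ t) (optSigma ℱ)
      (WbarMap P ℱ μ t p).1 (WbarMap P ℱ μ t p).2) s = 0 := by
  ext ω i
  simp [sect, wTrans, WbarMap, not_le.2 hs]

theorem WbarMap_snd_mem : (WbarMap P ℱ μ t p).2 ∈ LOne (optMeasure P ℱ μ) (optFilt ℱ t) d ∧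
    ∀ᵐ x ∂(optMeasure P ℱ μ), ∀ i, 0 ≤ (WbarMap P ℱ μ t p).2 x i := by
  constructor
  · refine stepFrom_mem_LOne (t := t) hμ ⟨measurable_vec fun i =>
      measurable_wbarSum (fun s => (hp.2.1 s).1.1) i, fun i => ?_⟩
    refine (integrable_finsetSum Finset.univ fun (s : Ici t) _ => (hp.2.1 s).1.2 i).congr ?_
    filter_upwards [dualProc_nonneg hp] with ω h
    exact (wbarSum_eq h i).symm
  · refine Filter.Eventually.of_forall fun x i => ?_
    by_cases h : t ≤ x.2
    · simpa only [WbarMap, h, if_true] using wbarSum_nonneg x.1 i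
    · simp [WbarMap, h]

theorem WbarMap_mem_dualVec :
    WbarMap P ℱ μ t p ∈ dualVec (optMeasure P ℱ μ) (optFilt ℱ t) d m := by
  have := isProbabilityMeasure_optMeasure hμ
  obtain ⟨C, -, hC⟩ := hμ.exists_abs_inv_le
  have hw := WbarMap_snd_mem hcomplete hμ hp
  have hm : Measurable[optSigma ℱ] (wTrans (optMeasure P ℱ μ) (optFilt ℱ t) (optSigma ℱ)
      (WbarMap P ℱ μ t p).1 (WbarMap P ℱ μ t p).2) := measurable_vec fun i =>
    ((measurable_coord hw.1.1 i).mono optFilt_le_optSigma le_rfl).mul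
      (measurable_xi optFilt_le_optSigma)
  have hm' := measurable_optSigma_iff.1 hm
  have key : ∀ s : Ici t, sect (wTrans (optMeasure P ℱ μ) (optFilt ℱ t) (optSigma ℱ)
      (WbarMap P ℱ μ t p).1 (WbarMap P ℱ μ t p).2) s =ᵐ[P] fun ω => (μ s ω)⁻¹ •
        mass μ t ω • wTrans P (ℱ t) (ℱ s) (p.1 s) (p.2 s) ω := fun s => by
    filter_upwards [mul_sect_wTrans_WbarMap_ae_eq hcomplete hμ hp s, hμ.pos] with ω h1 h2
    rw [← h1, inv_smul_smul₀ (h2 s).ne']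
  refine ⟨WbarMap_fst_mem_probOn hcomplete hμ hp, mem_dualCone_MPos hw.1 hw.2,
    (mem_LOne_optSigma_iff hμ).2 fun s => ⟨hm' s, fun i => ?_⟩,
    (ae_optMeasure_iff hcomplete hμ).2 fun s => ?_⟩
  · by_cases hs : t ≤ s
    · have h1 := smul_fun_mem_LOne (ℱ.le s) (hp.2.2 ⟨s, hs⟩).1
        ((measurable_mass (t := t) hμ).mono (ℱ.mono hs) le_rfl) (mass_le_one hμ)
      have h2 := smul_fun_mem_LOne (ℱ.le s) h1 (hμ.adapted s).inv (hC s)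
      exact (h2.2 i).congr ((key ⟨s, hs⟩).symm.mono fun ω h => congrFun h i)
    · rw [sect_wTrans_WbarMap_of_lt hcomplete hμ hp (not_le.1 hs)]
      exact integrable_zero _ _ _
  · by_cases hs : t ≤ s
    · filter_upwards [key ⟨s, hs⟩, hμ.pos, mass_pos (t := t) hμ, (hp.2.2 ⟨s, hs⟩).2]
        with ω h1 h2 h3 h4 i
      have := congrFun h1 i
      simp only [sect] at this
      rw [this]
      exact mul_nonneg (inv_nonneg.2 (h2 s).le) (mul_nonneg h3.2.le (h4 i))
    · refine Filter.Eventually.of_forall fun ω i => ?_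
      have := congrFun (congrFun (sect_wTrans_WbarMap_of_lt hcomplete hμ hp (not_le.1 hs)) ω) i
      exact this.ge

/-- The optional weight vanishes before `t`, so the conditions at those times are void; the joint
condition differs from the one for processes only by the remaining mass. -/
theorem mem_dualProcMax_toProc_iff
    (hR : IsClosedCoherentVec (optMeasure P ℱ μ) (optSigma ℱ) (optFilt ℱ t) m Rbar) :
    p ∈ dualProcMax P ℱ m t (toProc t Rbar) ↔
      WbarMap P ℱ μ t p ∈ dualVecMax (optMeasure P ℱ μ) (optFilt ℱ t) m Rbar := by
  have hρ := isClosedCoherentProc_toProc hcomplete hμ hR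
  have hmem := WbarMap_mem_dualVec hcomplete hμ hp
  obtain ⟨C, -, hC⟩ := exists_abs_inv_mass_le (P := P) (t := t) hμ
  have e : WbarMap P ℱ μ t p ∈ dualVecMax (optMeasure P ℱ μ) (optFilt ℱ t) m Rbar ↔ _ :=
    Iff.trans ⟨fun h => h.2.2, fun h => ⟨hmem, hmem.2.2.1, h⟩⟩
      (forall_pairing_nonneg_iff hcomplete hμ hR hmem.2.2.1)
  rw [e, hρ.mem_dualProcMax_iff hp]
  have e1 : ∀ s < t, ∀ Y ∈ LInf P (ℱ s) d,
      spike s Y ∈ accVec (optMeasure P ℱ μ) (optSigma ℱ) Rbar →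
      0 ≤ pairing P (fun ω => μ s ω • sect (wTrans (optMeasure P ℱ μ) (optFilt ℱ t) (optSigma ℱ)
        (WbarMap P ℱ μ t p).1 (WbarMap P ℱ μ t p).2) s ω) Y := fun s hs Y _ _ => by
    rw [sect_wTrans_WbarMap_of_lt hcomplete hμ hp hs]
    simp [pairing]
  rw [and_iff_right e1]
  simp only [fun (s : Ici t) X => pairing_congr (X := X)
    (mul_sect_wTrans_WbarMap_ae_eq hcomplete hμ hp s)]
  -- The scaling lemma expects a family indexed by all times; it is extended by zero before `t`,
  -- where it is not evaluated.
  have h1 := hρ.pairing_smul_nonneg_iff (Z := fun s => if h : t ≤ s then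
      wTrans P (ℱ t) (ℱ s) (p.1 ⟨s, h⟩) (p.2 ⟨s, h⟩) else 0) (l := mass μ t)
    (measurable_mass hμ) ((mass_pos hμ).mono fun _ h => h.2) (mass_le_one hμ) hC
  have h2 : ∀ s : Ici t, (if h : t ≤ s then
      wTrans P (ℱ t) (ℱ s) (p.1 ⟨s, h⟩) (p.2 ⟨s, h⟩) else 0) =
      wTrans P (ℱ t) (ℱ s) (p.1 s) (p.2 s) := fun s => dif_pos s.2
  simp only [h2] at h1
  rw [← h1]
  exact ⟨fun h X hX hXA => h X ((embed_mem_acc_iff_toProc hcomplete hμ hR hX).1 hXA),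
    fun h X hX => h X hX.1 ((embed_mem_acc_iff_toProc hcomplete hμ hR hX.1).2 hX)⟩

end ToOptionalSpace

/-! ### Dual variables at the times before `t` -/

section Restrictions

variable {Ω : Type*} {mΩ : MeasurableSpace Ω} {P : Measure Ω} {T d m : ℕ}
  {ℱ : Filtration (Fin (T + 1)) mΩ} {s t : Fin (T + 1)} {μ : Fin (T + 1) → Ω → ℝ}
  {Rbar : (Ω × Fin (T + 1) → Fin d → ℝ) → Set (Ω × Fin (T + 1) → Fin d → ℝ)}
  [IsProbabilityMeasure P]
  (hcomplete : ∀ A : Set Ω, P A = 0 → MeasurableSet[ℱ 0] A) (hμ : IsReference P ℱ μ)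
  (hR : IsClosedCoherentVec (optMeasure P ℱ μ) (optSigma ℱ) (optFilt ℱ t) m Rbar)

theorem self_mem_probOn {Ω' : Type*} {m0 : MeasurableSpace Ω'} {P : Measure Ω'}
    [IsProbabilityMeasure P] (F : MeasurableSpace Ω') : P ∈ probOn P F :=
  ⟨⟨inferInstance, Measure.AbsolutelyContinuous.rfl⟩, fun _ _ => rfl⟩

theorem xi_self_measure_ae_eq {Ω' : Type*} {F m0 : MeasurableSpace Ω'} {P : Measure Ω'}
    [IsProbabilityMeasure P] (hF : F ≤ m0) : xi P F m0 P =ᵐ[P] fun _ => 1 := by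
  filter_upwards [xi_self_ae_eq hF (self_mem_probOn F), Measure.rnDeriv_self P] with ω h1 h2
  rw [h1]
  simp [dens, h2]

include hcomplete hμ hR in
theorem sect_mem_dualRestrMax (hs : s < t)
    {p : (Fin d → @Measure (Ω × Fin (T + 1)) (optSigma ℱ)) × (Ω × Fin (T + 1) → Fin d → ℝ)}
    (hp : p ∈ dualVecMax (optMeasure P ℱ μ) (optFilt ℱ t) m Rbar) :
    sect p.2 s ∈ dualRestrMax P (ℱ s) m (toRestr Rbar s) := by
  have hRs := isClosedCoherentVec_toRestr hcomplete hμ hR hs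
  have hw := ((mem_LOne_optFilt_iff hμ).1 hp.1.2.1.1).1 s hs
  have h0 := sect_dual_nonneg hcomplete hμ hp.1 s
  obtain ⟨C, -, hC⟩ := hμ.exists_abs_inv_le
  refine ⟨mem_dualCone_MPos hw h0, ⟨hw, h0⟩, hw, (hRs.pairing_smul_nonneg_iff le_rfl
    (hμ.adapted s) (hμ.pos.mono fun _ h => h s) (hμ.abs_le_one s) (hC s)).1 fun Y hY => ?_⟩
  have h1 := ((forall_pairing_nonneg_iff hcomplete hμ hR hp.1.2.2.1).1 hp.2.2).1 s hs Y hY.1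
    ((spike_mem_acc_iff_toRestr hcomplete hμ hR hs hY.1).2 hY)
  exact h1.trans_eq (pairing_congr
    ((sect_wTrans_ae_eq_of_lt hcomplete hμ hp.1 hs).mono fun ω h => by simp only [h]))

include hcomplete hμ hR in
-- Taking the reference measure in every component makes the transport trivial, so a weight at time
-- `s` becomes an optional dual variable by placing it there. On an acceptable optional position it
-- sees only the section at `s`, scaled by `μ_s`.
theorem spike_mem_dualVecMax (hs : s < t) {w : Ω → Fin d → ℝ}
    (hw : w ∈ dualRestrMax P (ℱ s) m (toRestr Rbar s)) :
    ((fun _ => optMeasure P ℱ μ, spike s w) : (Fin d → @Measure (Ω × Fin (T + 1)) (optSigma ℱ)) ×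
      (Ω × Fin (T + 1) → Fin d → ℝ)) ∈ dualVecMax (optMeasure P ℱ μ) (optFilt ℱ t) m Rbar := by
  have := isProbabilityMeasure_optMeasure hμ
  have hRs := isClosedCoherentVec_toRestr hcomplete hμ hR hs
  have hx := xi_self_measure_ae_eq (P := optMeasure P ℱ μ) (optFilt_le_optSigma (ℱ := ℱ) (t := t))
  have hZ := spike_mem_LOne_optFilt (t := t) hμ hs hw.2.1.1
  have h0 : ∀ᵐ x ∂(optMeasure P ℱ μ), ∀ i, 0 ≤ spike (T := T) s w x i :=
    (ae_optMeasure_iff hcomplete hμ).2 fun r => hw.2.1.2.mono fun ω h i => by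
      by_cases hr : r = s <;> simp [spike, hr, h i]
  have he : wTrans (optMeasure P ℱ μ) (optFilt ℱ t) (optSigma ℱ) (fun _ : Fin d => optMeasure P ℱ μ)
      (spike s w) =ᵐ[optMeasure P ℱ μ] spike s w := by
    filter_upwards [hx] with x h
    ext i
    simp only [wTrans, h, mul_one]
  have hpos : wTrans (optMeasure P ℱ μ) (optFilt ℱ t) (optSigma ℱ)
      (fun _ : Fin d => optMeasure P ℱ μ) (spike s w) ∈ LOnePos (optMeasure P ℱ μ) (optSigma ℱ) d := by
    refine ⟨⟨measurable_vec fun i => ((measurable_coord hZ.1 i).mono optFilt_le_optSigma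
      le_rfl).mul (measurable_xi optFilt_le_optSigma),
      fun i => (hZ.2 i).congr (he.symm.mono fun x h => congrFun h i)⟩, ?_⟩
    filter_upwards [he, h0] with x h1 h2
    rw [h1]; exact h2
  refine ⟨⟨fun _ => self_mem_probOn _, mem_dualCone_MPos hZ h0, hpos⟩, hpos.1, fun X hX => ?_⟩
  rw [pairing_congr he, pairing_spike_left hcomplete hμ hw.2.1.1 hX.1]
  exact hRs.pairing_smul_nonneg le_rfl (hμ.adapted s) (hμ.pos.mono fun _ h => (h s).le)
    (hμ.abs_le_one s) hw.2.2.2 _ ((spike_mem_acc_iff_toRestr hcomplete hμ hR hs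
      ((mem_LInf_optSigma_iff hcomplete hμ).1 hX.1 s)).1
      (spike_mem_acc_of_mem_acc hcomplete hμ hR hs hX))

end Restrictions
end SetRisk

/-! ### Assembly of the corollary -/

theorem mainTheorem5 {Ω : Type*} [mΩ : MeasurableSpace Ω] (P : Measure Ω) [IsProbabilityMeasure P]
    (T : ℕ) (hT : 1 ≤ T) (ℱ : Filtration (Fin (T + 1)) mΩ)
    (hlast : ℱ (Fin.last T) = mΩ)
    (htrivial : ∀ A : Set Ω, MeasurableSet[ℱ 0] A → P A = 0 ∨ P A = 1)
    (hcomplete : ∀ A : Set Ω, P A = 0 → MeasurableSet[ℱ 0] A)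
    (d m : ℕ) (hm : 1 ≤ m) (hmd : m ≤ d)
    (μ : Fin (T + 1) → Ω → ℝ) (hμ : SetRisk.IsReference P ℱ μ) (t : Fin (T + 1)) :
    -- from processes to the optional filtration
    (∀ (ρ : (Fin (T + 1) → Ω → Fin d → ℝ) → Set (Ω → Fin d → ℝ))
        (R : Fin (T + 1) → (Ω → Fin d → ℝ) → Set (Ω → Fin d → ℝ)),
      SetRisk.IsClosedCoherentProc P ℱ m t ρ →
      (∀ s < t, SetRisk.IsClosedCoherentVec P (ℱ s) (ℱ s) m (R s)) →
      SetRisk.IsClosedCoherentVec (SetRisk.optMeasure P ℱ μ) (SetRisk.optSigma ℱ)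
        (SetRisk.optFilt ℱ t) m (SetRisk.toOptional t ρ R) ∧
      SetRisk.RepVec (SetRisk.optMeasure P ℱ μ) (SetRisk.optFilt ℱ t) m
        (SetRisk.toOptional t ρ R)
        (SetRisk.dualVecMax (SetRisk.optMeasure P ℱ μ) (SetRisk.optFilt ℱ t) m
          (SetRisk.toOptional t ρ R)) ∧
      SetRisk.RepVec (SetRisk.optMeasure P ℱ μ) (SetRisk.optFilt ℱ t) m
        (SetRisk.toOptional t ρ R)
        {p | p ∈ SetRisk.dualVecMax (SetRisk.optMeasure P ℱ μ) (SetRisk.optFilt ℱ t) m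
            (SetRisk.toOptional t ρ R) ∧
          p.2 ∉ SetRisk.MPerp (SetRisk.optMeasure P ℱ μ) (SetRisk.optFilt ℱ t) d m} ∧
      -- `W_t` evaluated through some decomposition of the measures
      SetRisk.dualVecMax (SetRisk.optMeasure P ℱ μ) (SetRisk.optFilt ℱ t) m
          (SetRisk.toOptional t ρ R) =
        {p | p ∈ SetRisk.dualVec (SetRisk.optMeasure P ℱ μ) (SetRisk.optFilt ℱ t) d m ∧
          (∀ s < t, SetRisk.sect p.2 s ∈ SetRisk.dualRestrMax P (ℱ s) m (R s)) ∧
          ∃ (Q : Fin d → Measure Ω) (ψ : Fin d → Fin (T + 1) → Ω → ℝ),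
            (∀ i, SetRisk.IsDecomp P ℱ μ (p.1 i) (Q i) (ψ i)) ∧
            SetRisk.Wmap P ℱ μ t Q ψ p.2 ∈ SetRisk.dualProcMax P ℱ m t ρ} ∧
      -- and, equivalently, through every decomposition
      SetRisk.dualVecMax (SetRisk.optMeasure P ℱ μ) (SetRisk.optFilt ℱ t) m
          (SetRisk.toOptional t ρ R) =
        {p | p ∈ SetRisk.dualVec (SetRisk.optMeasure P ℱ μ) (SetRisk.optFilt ℱ t) d m ∧
          (∀ s < t, SetRisk.sect p.2 s ∈ SetRisk.dualRestrMax P (ℱ s) m (R s)) ∧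
          ∀ (Q : Fin d → Measure Ω) (ψ : Fin d → Fin (T + 1) → Ω → ℝ),
            (∀ i, SetRisk.IsDecomp P ℱ μ (p.1 i) (Q i) (ψ i)) →
            SetRisk.Wmap P ℱ μ t Q ψ p.2 ∈ SetRisk.dualProcMax P ℱ m t ρ}) ∧
    -- from the optional filtration to processes
    (∀ Rbar : (Ω × Fin (T + 1) → Fin d → ℝ) → Set (Ω × Fin (T + 1) → Fin d → ℝ),
      SetRisk.IsClosedCoherentVec (SetRisk.optMeasure P ℱ μ) (SetRisk.optSigma ℱ)
        (SetRisk.optFilt ℱ t) m Rbar →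
      (SetRisk.IsClosedCoherentProc P ℱ m t (SetRisk.toProc t Rbar) ∧
        SetRisk.RepProc P ℱ m t (SetRisk.toProc t Rbar)
          (SetRisk.dualProcMax P ℱ m t (SetRisk.toProc t Rbar)) ∧
        SetRisk.RepProc P ℱ m t (SetRisk.toProc t Rbar)
          {p | p ∈ SetRisk.dualProcMax P ℱ m t (SetRisk.toProc t Rbar) ∧
            ∃ s, p.2 s ∉ SetRisk.MPerp P (ℱ t) d m} ∧
        SetRisk.dualProcMax P ℱ m t (SetRisk.toProc t Rbar) =
          {p | p ∈ SetRisk.dualProc P ℱ d m t ∧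
            SetRisk.WbarMap P ℱ μ t p ∈
              SetRisk.dualVecMax (SetRisk.optMeasure P ℱ μ) (SetRisk.optFilt ℱ t) m Rbar}) ∧
      ∀ s < t,
        SetRisk.IsClosedCoherentVec P (ℱ s) (ℱ s) m (SetRisk.toRestr Rbar s) ∧
        SetRisk.RepRestr P (ℱ s) m (SetRisk.toRestr Rbar s)
          (SetRisk.dualRestrMax P (ℱ s) m (SetRisk.toRestr Rbar s)) ∧
        SetRisk.RepRestr P (ℱ s) m (SetRisk.toRestr Rbar s)
          {w | w ∈ SetRisk.dualRestrMax P (ℱ s) m (SetRisk.toRestr Rbar s) ∧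
            w ∉ SetRisk.MPerp P (ℱ s) d m} ∧
        SetRisk.dualRestrMax P (ℱ s) m (SetRisk.toRestr Rbar s) =
          ⋃ Qbar ∈ {Qbar : Fin d → @Measure (Ω × Fin (T + 1)) (SetRisk.optSigma ℱ) |
              ∀ i, Qbar i ∈ SetRisk.probOn (SetRisk.optMeasure P ℱ μ) (SetRisk.optFilt ℱ t)},
            {w | ∃ wbar, (Qbar, wbar) ∈
              SetRisk.dualVecMax (SetRisk.optMeasure P ℱ μ) (SetRisk.optFilt ℱ t) m Rbar ∧
              w = SetRisk.sect wbar s}) := by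
  have := SetRisk.isProbabilityMeasure_optMeasure hμ
  refine ⟨fun ρ R hρ hR => ?_, fun Rbar hR => ⟨?_, fun s hs => ?_⟩⟩
  · have hcoh := SetRisk.isClosedCoherentVec_toOptional hcomplete hμ hρ hR
    refine ⟨hcoh,
      -- The maximal set and its part outside `M̄^⊥` are the two extreme choices allowed by the
      -- representation.
      SetRisk.repVec_of_subset hcoh SetRisk.optFilt_le_optSigma subset_rfl fun p hp => hp.1,
      SetRisk.repVec_of_subset hcoh SetRisk.optFilt_le_optSigma (fun p hp => hp.1) subset_rfl,
      Set.Subset.antisymm (fun p hp => ?_) ?_, Set.Subset.antisymm (fun p hp => ?_) ?_⟩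
    · choose Q ψ hQψ using fun i => SetRisk.exists_isDecomp hcomplete hμ (hp.1.1 i).1
      have h := (SetRisk.mem_dualVecMax_toOptional_iff hcomplete hμ hp.1 hQψ hρ hR).1 hp
      exact ⟨hp.1, h.1, Q, ψ, hQψ, h.2⟩
    · rintro p ⟨hp, h, Q, ψ, hQψ, hW⟩
      exact (SetRisk.mem_dualVecMax_toOptional_iff hcomplete hμ hp hQψ hρ hR).2 ⟨h, hW⟩
    · choose Q₀ ψ₀ hQψ₀ using fun i => SetRisk.exists_isDecomp hcomplete hμ (hp.1.1 i).1
      exact ⟨hp.1,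
        ((SetRisk.mem_dualVecMax_toOptional_iff hcomplete hμ hp.1 hQψ₀ hρ hR).1 hp).1,
        fun Q ψ hQψ =>
          ((SetRisk.mem_dualVecMax_toOptional_iff hcomplete hμ hp.1 hQψ hρ hR).1 hp).2⟩
    · rintro p ⟨hp, h, hW⟩
      -- Existence of a decomposition keeps the condition on every decomposition from being vacuous.
      choose Q ψ hQψ using fun i => SetRisk.exists_isDecomp hcomplete hμ (hp.1 i).1
      exact (SetRisk.mem_dualVecMax_toOptional_iff hcomplete hμ hp hQψ hρ hR).2
        ⟨h, hW Q ψ hQψ⟩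
  · have hcoh := SetRisk.isClosedCoherentProc_toProc hcomplete hμ hR
    refine ⟨hcoh, SetRisk.repProc_of_subset hcoh subset_rfl fun p hp => hp.1,
      SetRisk.repProc_of_subset hcoh (fun p hp => hp.1) subset_rfl,
      Set.Subset.antisymm (fun p hp => ?_) ?_⟩
    · exact ⟨hp.1, (SetRisk.mem_dualProcMax_toProc_iff hcomplete hμ hp.1 hR).1 hp⟩
    · rintro p ⟨hp, h⟩
      exact (SetRisk.mem_dualProcMax_toProc_iff hcomplete hμ hp hR).2 h
  · have hcoh := SetRisk.isClosedCoherentVec_toRestr hcomplete hμ hR hs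
    refine ⟨hcoh, SetRisk.repRestr_of_subset hcoh rfl (ℱ.le s) subset_rfl fun w hw => hw.1,
      SetRisk.repRestr_of_subset hcoh rfl (ℱ.le s) (fun w hw => hw.1) subset_rfl,
      Set.Subset.antisymm (fun w hw => ?_) ?_⟩
    -- The union is already exhausted by the reference measure, with the weight supported at time
    -- `s`.
    · exact mem_iUnion₂.2 ⟨fun _ => SetRisk.optMeasure P ℱ μ,
        fun _ => SetRisk.self_mem_probOn _, SetRisk.spike s w,
        SetRisk.spike_mem_dualVecMax hcomplete hμ hR hs hw, (SetRisk.sect_spike_self w).symm⟩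
    · intro w hw
      obtain ⟨Qbar, -, wbar, h, rfl⟩ := mem_iUnion₂.1 hw
      exact SetRisk.sect_mem_dualRestrMax hcomplete hμ hR hs h
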